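/- **Setting.** Let $\psi\colon\mathbb R\to[-\infty,\log 2]$, $\psi(x)=\log\bigl(1-\cos(2\pi x)\bigr)$ (with $\log 0=-\infty$), and for $n\in\mathbb N$ let $\psi_n(x)=\sum_{\ell=0}^{n-1}\psi(2^\ell x)$. Let $\mathbb X=\{0,1\}^{\mathbb N}$ be the one-sided binary shift space, where a sequence $x=(x_1,x_2,\dots)\in\mathbb X$ is identified with the number $\sum_{i\ge1}x_i2^{-i}\in[0,1]$ whenever it is inserted into $\psi_n$. For a word $\omega\in\{0,1\}^n$ let $\langle\omega\rangle\subseteq\mathbb X$ be the cylinder of all sequences starting with $\omega$. For $X'\subseteq\mathbb X$ and $t\in\mathbb R$ define the (restricted) pressure $$\mathcal P(t\psi\,|\,X')=\lim_{n\to\infty}\frac1n\log\sum_{\omega\in\{0,1\}^n}\ \sup_{x\in\langle\omega\rangle\cap X'}\exp\bigl(t\,\psi_n(x)\bigr)\in[-\infty,+\infty],$$ whenever the limit exists in $[-\infty,+\infty]$; here a supremum over the empty set is $0$, and $\exp(-\infty)=0$, $\exp(+\infty)=+\infty$, $0\cdot(-\infty)=0$. Put $p(t)=\mathcal P(t\psi)=\mathcal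 P(t\psi\,|\,\mathbb X)$ and, for $m\in\mathbb N=\{1,2,\dots\}$, $p_m(t)=\mathcal P(t\psi\,|\,\mathbb X_m)$, where $\mathbb X_m\subset\mathbb X$ is the subshift of finite type of all sequences that contain neither $0^{m+1}$ nor $1^{m+1}$ as a subword. **Proposition 7.1.** 1. For every $t\in\mathbb R$ the limit defining $p(t)$ exists, and the function $p\colon\mathbb R\to\mathbb R\cup\{+\infty\}$ is convex. 2. For every $m\in\mathbb N$ and $t\in\mathbb R$ the limit defining $p_m(t)$ exists and is finite, and the function $p_m\colon\mathbb R\to\mathbb R$ is convex and real-analytic. For every $t\in\mathbb R$, $\lim_{m\to\infty}p_m(t)=p(t)$ in $\mathbb R\cup\{+\infty\}$. 3. The domain $\{t\in\mathbb R: p(t)<\infty\}$ of $p$ equals $[0,+\infty)$. 4. $p(0)=\log 2$ and $p(1)=\log 2$. 5. $\lim_{t\to\infty}\bigl(p(t)-t\log(3/2)\bigr)=0$. 6. The right derivative of $p$ at $0$ exists and equals $p'(0+)=-\log 2$. -/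

import Mathlib

open Filter Topology

namespace ThueMorse

noncomputable section

/-- The potential `ψ(x) = log (1 - cos (2πx)) ∈ [-∞, log 2]`, with `log 0 = -∞`, as a
(1-periodic) function of a real variable. -/
def psi (x : ℝ) : EReal :=
  ENNReal.log (ENNReal.ofReal (1 - Real.cos (2 * Real.pi * x)))

/-- The Birkhoff sum `ψ_n(x) = ∑_{ℓ < n} ψ(2^ℓ x)` for the doubling map. All summands are
`< +∞`, so no undetermined form `∞ - ∞` occurs. -/
def birkhoffPsi (n : ℕ) (x : ℝ) : EReal :=
  ∑ l ∈ Finset.range n, psi (2 ^ l * x)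

/-- The one-sided binary shift space `𝕏 = {0,1}^ℕ` (letters are indexed from `0`). A sequence
`x` represents the number `Real.ofDigits x = ∑ i, x i * 2^{-(i+1)}` of `[0,1]`. -/
abbrev BinSeq : Type := ℕ → Fin 2

/-- The cylinder `⟨ω⟩` of all sequences that start with the finite word `ω`. -/
def cylinder {n : ℕ} (w : Fin n → Fin 2) : Set BinSeq :=
  {x | ∀ i : Fin n, x i = w i}

/-- The subshift of finite type `𝕏_m`: sequences in which neither `0^{m+1}` nor `1^{m+1}`
occurs as a subword. -/
def subshift (m : ℕ) : Set BinSeq :=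
  {x | ∀ l : ℕ, ∀ a : Fin 2, ¬ ∀ i ≤ m, x (l + i) = a}

/-- `∑_{ω ∈ {0,1}^n} sup_{x ∈ ⟨ω⟩ ∩ X} exp (t ψ_n(x)) ∈ [0, ∞]`, where the supremum over the
empty set is `0`. Here `exp (-∞) = 0` and `exp (+∞) = +∞`, and for `t < 0` one has
`t * (-∞) = +∞`. -/
def partitionSum (X : Set BinSeq) (t : ℝ) (n : ℕ) : ENNReal :=
  ∑ w : Fin n → Fin 2, ⨆ x ∈ cylinder w ∩ X,
    EReal.exp ((t : EReal) * birkhoffPsi n (Real.ofDigits x))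

/-- `(1/n) log ∑_{ω ∈ {0,1}^n} sup_{x ∈ ⟨ω⟩ ∩ X} exp (t ψ_n(x)) ∈ [-∞, ∞]`. -/
def pressureSeq (X : Set BinSeq) (t : ℝ) (n : ℕ) : EReal :=
  ENNReal.log (partitionSum X t n) / (n : EReal)

/-- The restricted topological pressure `𝒫(tψ | X)`, the limit of `pressureSeq X t`. (It is
meaningful only if this limit exists; the existence is asserted wherever it is used.) -/
def restrictedPressure (X : Set BinSeq) (t : ℝ) : EReal :=
  limUnder atTop (pressureSeq X t)

/-- The pressure function `p(t) = 𝒫(tψ) = 𝒫(tψ | 𝕏)`. -/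
def pressure (t : ℝ) : EReal := restrictedPressure Set.univ t

/-- The approximating pressure function `p_m(t) = 𝒫(tψ | 𝕏_m)`. -/
def pressureApprox (m : ℕ) (t : ℝ) : EReal := restrictedPressure (subshift m) t

end

end ThueMorse

/-!
Write `f = exp ψ`, so that `f(x) = 1 - cos (2πx)`, and `W_n = exp ψ_n` for its products along the
doubling map. Restricted pressures of shift-invariant sets exist by submultiplicativity of the
partition sums, and are convex by Hölder's inequality (`exists_hasPressure`,
`HasPressure.convex`). Since `f` vanishes at `0`, the partition sums over all sequences are
infinite for `t < 0`.

*Sub- and supersolutions.* On `𝕏_m` the weight `f` is bounded away from `0`, and bounded distortion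
compares the partition sums with the iterates of the transfer operator `letterOp`. Hence a function
`H` on `𝕏_m` that is bounded away from `0` and `∞` and satisfies `ℒ_t H ≤ ρ H` gives
`p_m(t) ≤ log ρ`, and `≥` likewise; the value of `ρ` is all that matters, not the bounds of `H`.
Letting `m → ∞` this yields the quantitative claims:
`H = 1` gives `p(0) = p(1) = log 2`;
`H = f^{-t/3}` gives `p(t) ≤ log ((3/2)^t + 2^{t/3})`, hence the asymptote, the sequence
`0101⋯`, which represents `1/3`, supplying the lower bound;
`H = f^t` and `H = f^t + δ (log f)^2` give the right derivative at `0`, because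
`f(x/2) f((1+x)/2) = f(x)/2` makes `f^t` an eigenfunction to first order in `t`.

*Analyticity.* The distance `u` of `x` to the integers turns `𝕏_m` into a system with `m` inverse
branches `u ↦ 2^{-j-1} (1 - u)` that prepend a run of length `j + 1`, and `p_m(t)` is the number `s`
for which the induced operator with weights `exp (t φ_j - s (j + 1))` has the eigenvalue `1`
(`approxP_eq_of_eigenfunction`, `eigenvalue_eq_one`). A positive Lipschitz eigenfunction comes
from a contraction estimate for Markov operators (`exists_eigenfunction`). After normalization by it
at `t₀`, the eigenvalue equation is an analytic equation in the Banach space of Lipschitz functions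
whose linearization is a Poisson equation, solvable by the same contraction estimate, so the
analytic implicit function theorem applies (`exists_analytic_solution`).

*Convergence.* For `t ≥ 0` a surgery on a sparse grid cuts all long runs of a sequence. It costs a
factor close to `1` per step in `W_n` and a small exponential factor in the number of words
(`realSum_univ_le`). For `t < 0` the periodic sequence of blocks of length `m` shows that `p_m(t)`
grows at least linearly in `m`.
-/

namespace ThueMorse

noncomputable section

/-! ### Contraction of Markov operators of a contracting function system -/

section Markov

lemma dist_iterate_le {K J : Type*} [MetricSpace K] {S : J → K → K}
    (hS : ∀ j x y, dist (S j x) (S j y) ≤ dist x y / 2) (j₀ : J) (n : ℕ)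
    (x y : K) : dist ((S j₀)^[n] x) ((S j₀)^[n] y) ≤ dist x y / 2 ^ n := by
  induction n with
  | zero => simp
  | succ n ih =>
    rw [Function.iterate_succ_apply', Function.iterate_succ_apply', pow_succ]
    refine (hS j₀ _ _).trans ?_
    rw [← div_div]
    linarith

variable {K J : Type*} [MetricSpace K] [Fintype J]

/-- The transfer operator `g ↦ ∑ j, p j * g ∘ S j` of the function system `S` with weights `p`. -/
def transfer (S : J → K → K) (p : J → K → ℝ) (g : K → ℝ) (x : K) : ℝ :=
  ∑ j, p j x * g (S j x)

/-- Probability weights that are bounded below by `δ` and whose variation is `C`-Lipschitz. -/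
structure IsMarkov (C δ : ℝ) (p : J → K → ℝ) : Prop where
  sum_one : ∀ x, ∑ j, p j x = 1
  le : ∀ j x, δ ≤ p j x
  lip : ∀ x y, ∑ j, |p j x - p j y| ≤ C * dist x y

/-- `g` is `ℓ`-Lipschitz and has oscillation at most `o`. -/
structure Controlled (ℓ o : ℝ) (g : K → ℝ) : Prop where
  lip : ∀ x y, |g x - g y| ≤ ℓ * dist x y
  osc : ∀ x y, g x - g y ≤ o

variable {S : J → K → K} {C δ ℓ o : ℝ} {p : J → K → ℝ} {g : K → ℝ}

lemma Controlled.abs_le (h : Controlled ℓ o g) (x y : K) : |g x - g y| ≤ o :=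
  _root_.abs_le.2 ⟨by linarith [h.osc y x], h.osc x y⟩

lemma Controlled.mono {ℓ' o' : ℝ} (h : Controlled ℓ o g) (hℓ : ℓ ≤ ℓ') (ho : o ≤ o') :
    Controlled ℓ' o' g :=
  ⟨fun x y => (h.lip x y).trans (mul_le_mul_of_nonneg_right hℓ dist_nonneg),
    fun x y => (h.osc x y).trans ho⟩

lemma Controlled.exists_bounds [Nonempty K] (h : Controlled ℓ o g) :
    ∃ b, ∀ u, b - o ≤ g u ∧ g u ≤ b := by
  obtain ⟨x₀⟩ := ‹Nonempty K›
  have hb : BddAbove (Set.range g) := ⟨g x₀ + o, by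
    rintro _ ⟨u, rfl⟩; linarith [h.osc u x₀]⟩
  have : Nonempty K := ⟨x₀⟩
  refine ⟨⨆ u, g u, fun u => ⟨?_, le_ciSup hb u⟩⟩
  have : (⨆ u, g u) ≤ g u + o := ciSup_le fun v => by linarith [h.osc v u]
  linarith

lemma IsMarkov.transfer_sub (hp : IsMarkov C δ p) (x : K) (c : ℝ) :
    transfer S p g x - c = ∑ j, p j x * (g (S j x) - c) := by
  simp only [transfer, mul_sub, Finset.sum_sub_distrib, ← Finset.sum_mul, hp.sum_one, one_mul]

lemma IsMarkov.transfer_le (hδ : 0 ≤ δ) (hp : IsMarkov C δ p) {c : ℝ} (h : ∀ u, g u ≤ c) (x : K) :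
    transfer S p g x ≤ c := by
  have := hp.transfer_sub (S := S) (g := g) x c
  have h2 : ∑ j, p j x * (g (S j x) - c) ≤ 0 := Finset.sum_nonpos fun j _ =>
    mul_nonpos_of_nonneg_of_nonpos (hδ.trans (hp.le j x)) (by linarith [h (S j x)])
  linarith

lemma IsMarkov.le_transfer (hδ : 0 ≤ δ) (hp : IsMarkov C δ p) {c : ℝ} (h : ∀ u, c ≤ g u) (x : K) :
    c ≤ transfer S p g x := by
  have := hp.transfer_sub (S := S) (g := g) x c
  have h2 : 0 ≤ ∑ j, p j x * (g (S j x) - c) := Finset.sum_nonneg fun j _ =>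
    mul_nonneg (hδ.trans (hp.le j x)) (by linarith [h (S j x)])
  linarith

/-- A Lasota–Yorke type inequality: the Lipschitz constant is halved, up to the oscillation. -/
lemma Controlled.transfer [Nonempty K] (hS : ∀ j x y, dist (S j x) (S j y) ≤ dist x y / 2)
    (hℓ : 0 ≤ ℓ) (ho : 0 ≤ o) (hδ : 0 ≤ δ) (hp : IsMarkov C δ p) (h : Controlled ℓ o g) :
    Controlled (ℓ / 2 + C * o) o (transfer S p g) := by
  refine ⟨fun x y => ?_, fun x y => ?_⟩
  · have e : ThueMorse.transfer S p g x - ThueMorse.transfer S p g y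
        = ∑ j, p j x * (g (S j x) - g (S j y)) + ∑ j, (p j x - p j y) * (g (S j y) - g y) := by
      simp only [ThueMorse.transfer, mul_sub, sub_mul, Finset.sum_sub_distrib, ← Finset.sum_mul,
        hp.sum_one]
      ring
    have h1 : |∑ j, p j x * (g (S j x) - g (S j y))| ≤ ℓ / 2 * dist x y := by
      calc _ ≤ ∑ j, |p j x * (g (S j x) - g (S j y))| := Finset.abs_sum_le_sum_abs _ _
        _ ≤ ∑ j, p j x * (ℓ / 2 * dist x y) := by
            refine Finset.sum_le_sum fun j _ => ?_
            have hpj := hδ.trans (hp.le j x)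
            rw [abs_mul, abs_of_nonneg hpj]
            refine mul_le_mul_of_nonneg_left ((h.lip _ _).trans ?_) hpj
            calc ℓ * dist (S j x) (S j y) ≤ ℓ * (dist x y / 2) :=
                  mul_le_mul_of_nonneg_left (hS j x y) hℓ
              _ = _ := by ring
        _ = _ := by rw [← Finset.sum_mul, hp.sum_one, one_mul]
    have h2 : |∑ j, (p j x - p j y) * (g (S j y) - g y)| ≤ C * o * dist x y := by
      calc _ ≤ ∑ j, |(p j x - p j y) * (g (S j y) - g y)| := Finset.abs_sum_le_sum_abs _ _
        _ ≤ ∑ j, |p j x - p j y| * o := by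
            refine Finset.sum_le_sum fun j _ => ?_
            rw [abs_mul]
            exact mul_le_mul_of_nonneg_left (h.abs_le _ _) (abs_nonneg _)
        _ = (∑ j, |p j x - p j y|) * o := by rw [Finset.sum_mul]
        _ ≤ C * dist x y * o := mul_le_mul_of_nonneg_right (hp.lip x y) ho
        _ = _ := by ring
    rw [e]
    refine (abs_add_le _ _).trans ?_
    linarith
  · obtain ⟨b, hb⟩ := h.exists_bounds
    have h1 := hp.transfer_le (S := S) hδ (fun u => (hb u).2) x
    have h2 := hp.le_transfer (S := S) hδ (fun u => (hb u).1) y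
    linarith

/-- Doeblin's argument along the branch `j₀`: a mass of at least `δ ^ n` is transported along
`S j₀ ∘ ⋯ ∘ S j₀`. -/
lemma transfer_iterate_le (hδ : 0 ≤ δ) (j₀ : J) {p : ℕ → J → K → ℝ} {g : ℕ → K → ℝ}
    (hp : ∀ n, IsMarkov C δ (p n)) (hg : ∀ n, g (n + 1) = transfer S (p n) (g n))
    {b : ℝ} (hb : ∀ u, g 0 u ≤ b) (n : ℕ) :
    (∀ x, g n x ≤ b) ∧ ∀ x, g n x ≤ δ ^ n * g 0 ((S j₀)^[n] x) + (1 - δ ^ n) * b := by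
  induction n with
  | zero => simp [hb]
  | succ n ih =>
    obtain ⟨ih1, ih2⟩ := ih
    refine ⟨fun x => ?_, fun x => ?_⟩
    · rw [hg]; exact (hp n).transfer_le hδ ih1 x
    · have e := (hp n).transfer_sub (S := S) (g := g n) x b
      rw [← hg] at e
      have h1 : ∑ j, p n j x * (g n (S j x) - b) ≤ p n j₀ x * (g n (S j₀ x) - b) := by
        classical
        rw [← Finset.add_sum_erase _ _ (Finset.mem_univ j₀)]
        have : ∑ j ∈ Finset.univ.erase j₀, p n j x * (g n (S j x) - b) ≤ 0 :=
          Finset.sum_nonpos fun j _ => mul_nonpos_of_nonneg_of_nonpos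
            (hδ.trans ((hp n).le j x)) (by linarith [ih1 (S j x)])
        linarith
      have h2 : p n j₀ x * (g n (S j₀ x) - b) ≤ δ * (g n (S j₀ x) - b) :=
        mul_le_mul_of_nonpos_right ((hp n).le j₀ x) (by linarith [ih1 (S j₀ x)])
      have h3 := mul_le_mul_of_nonneg_left (ih2 (S j₀ x)) hδ
      rw [Function.iterate_succ_apply, pow_succ]
      linarith

lemma Controlled.iterate_osc [Nonempty K] {D : ℝ} (hD : ∀ x y : K, dist x y ≤ D) (hδ : 0 ≤ δ)
    (hℓ : 0 ≤ ℓ) (hS : ∀ j x y, dist (S j x) (S j y) ≤ dist x y / 2) (j₀ : J)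
    {p : ℕ → J → K → ℝ} {g : ℕ → K → ℝ}
    (hp : ∀ n, IsMarkov C δ (p n)) (hg : ∀ n, g (n + 1) = ThueMorse.transfer S (p n) (g n))
    (h : Controlled ℓ o (g 0)) (n : ℕ) (x y : K) :
    g n x - g n y ≤ (1 - δ ^ n) * o + δ ^ n * (ℓ * (D / 2 ^ n)) := by
  obtain ⟨b, hb⟩ := h.exists_bounds
  have h1 := (transfer_iterate_le hδ j₀ hp hg (fun u => (hb u).2) n).2 x
  have h2 := (transfer_iterate_le (S := S) (g := fun n u => - g n u) (b := o - b) hδ j₀ hp (by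
    intro n; funext u; simp [hg, ThueMorse.transfer, Finset.sum_neg_distrib])
    (fun u => by linarith [(hb u).1]) n).2 y
  have h3 : g 0 ((S j₀)^[n] x) - g 0 ((S j₀)^[n] y) ≤ ℓ * (D / 2 ^ n) := by
    refine (le_abs_self _).trans ((h.lip _ _).trans (mul_le_mul_of_nonneg_left ?_ hℓ))
    exact (dist_iterate_le hS j₀ n x y).trans (by gcongr; exact hD x y)
  have h4 := mul_le_mul_of_nonneg_left h3 (pow_nonneg hδ n)
  linarith

lemma summable_pow_div {ρ : ℝ} (h0 : 0 < ρ) (h1 : ρ < 1) {N : ℕ} (hN : 0 < N) :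
    Summable fun n : ℕ => ρ ^ (n / N) := by
  have hr0 : 0 < ρ ^ ((N : ℝ)⁻¹) := Real.rpow_pos_of_pos h0 _
  have hr1 : ρ ^ ((N : ℝ)⁻¹) < 1 := Real.rpow_lt_one h0.le h1 (by positivity)
  refine Summable.of_nonneg_of_le (fun n => by positivity) (fun n => ?_)
    ((summable_geometric_of_lt_one hr0.le hr1).mul_left ρ⁻¹)
  have e : ρ = (ρ ^ ((N : ℝ)⁻¹)) ^ N := by
    rw [← Real.rpow_natCast, ← Real.rpow_mul h0.le, inv_mul_cancel₀ (by positivity), Real.rpow_one]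
  rw [le_inv_mul_iff₀ h0, ← pow_succ']
  conv_lhs => rw [e]
  rw [← pow_mul]
  refine pow_le_pow_of_le_one hr0.le hr1.le ?_
  have := Nat.div_add_mod n N
  have := Nat.mod_lt n hN
  rw [mul_add, mul_one]; omega

/-- Geometric contraction of inhomogeneous products of Markov operators, in the norm
`max (osc g) (κ * Lip g)`; the rate depends on the constants `C` and `δ` only. -/
theorem exists_summable_controlled [Nonempty K] [Nonempty J] {D : ℝ}
    (hD : ∀ x y : K, dist x y ≤ D) (hδ : 0 < δ) (hC : 0 ≤ C)
    (hS : ∀ j x y, dist (S j x) (S j y) ≤ dist x y / 2) :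
    ∃ κ : ℝ, 0 < κ ∧ ∃ b : ℕ → ℝ, (∀ n, 0 ≤ b n) ∧ Summable b ∧
      ∀ (p : ℕ → J → K → ℝ) (g : ℕ → K → ℝ), (∀ n, IsMarkov C δ (p n)) →
        (∀ n, g (n + 1) = transfer S (p n) (g n)) → ∀ M, 0 ≤ M → Controlled (M / κ) M (g 0) →
        ∀ n, Controlled (b n * M / κ) (b n * M) (g n) := by
  classical
  obtain ⟨j₀⟩ := ‹Nonempty J›
  have hD0 : 0 ≤ D := by
    obtain ⟨x⟩ := ‹Nonempty K›
    exact dist_nonneg.trans (hD x x)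
  set δ' := min δ 1 with hδ'
  have hδ0 : 0 < δ' := lt_min hδ one_pos
  have hδ1 : δ' ≤ 1 := min_le_right _ _
  set κ : ℝ := 1 / (8 * (C + 1)) with hκ
  have hκ0 : 0 < κ := by positivity
  have hCκ : C * κ ≤ 1 / 8 := by
    rw [hκ, mul_one_div, div_le_div_iff₀ (by positivity) (by norm_num)]; linarith
  obtain ⟨N, hN0, hN⟩ : ∃ N : ℕ, 0 < N ∧ D / 2 ^ N / κ ≤ 1 / 2 := by
    have : Tendsto (fun N : ℕ => D / 2 ^ N / κ) atTop (𝓝 (0 / κ)) := by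
      refine Tendsto.div_const ?_ _
      exact tendsto_const_nhds.div_atTop (tendsto_pow_atTop_atTop_of_one_lt one_lt_two)
    rw [zero_div] at this
    obtain ⟨N, h1, h2⟩ := ((this.eventually (eventually_le_nhds (by norm_num :
      (0 : ℝ) < 1 / 2))).and (eventually_gt_atTop 0)).exists
    exact ⟨N, h2, h1⟩
  set ρ : ℝ := max (3 / 4) (1 - δ' ^ N / 2) with hρ
  have hρ0 : 0 < ρ := lt_max_of_lt_left (by norm_num)
  have hρ1 : ρ < 1 := max_lt (by norm_num) (by have := pow_pos hδ0 N; linarith)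
  refine ⟨κ, hκ0, fun n => ρ ^ (n / N), fun n => by positivity, summable_pow_div hρ0 hρ1 hN0, ?_⟩
  intro p g hp hg
  have hp' : ∀ n, IsMarkov C δ' (p n) := fun n =>
    ⟨(hp n).sum_one, fun j x => (min_le_left _ _).trans ((hp n).le j x), (hp n).lip⟩
  have step : ∀ n M, 0 ≤ M → Controlled (M / κ) M (g n) → Controlled (M / κ) M (g (n + 1)) := by
    intro n M hM h
    rw [hg]
    refine (h.transfer hS (by positivity) hM hδ0.le (hp' n)).mono ?_ le_rfl
    have : C * M = C * κ * M / κ := by field_simp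
    rw [this, div_div, mul_comm κ 2, ← div_div, ← add_div]
    gcongr
    nlinarith
  have lip : ∀ n M, 0 ≤ M → Controlled (M / κ) M (g n) → ∀ k,
      Controlled ((1 / 2 ^ k + 1 / 4) * M / κ) M (g (n + k)) := by
    intro n M hM h k
    induction k with
    | zero => exact h.mono (by gcongr; simp; linarith) le_rfl
    | succ k ih =>
      rw [← add_assoc, hg]
      refine (ih.transfer hS (by positivity) hM hδ0.le (hp' _)).mono ?_ le_rfl
      have : C * M = C * κ * M / κ := by field_simp
      rw [this, div_div, mul_comm κ 2, ← div_div, ← add_div]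
      gcongr
      rw [pow_succ, ← div_div]
      nlinarith
  have contract : ∀ n M, 0 ≤ M → Controlled (M / κ) M (g n) →
      Controlled (ρ * M / κ) (ρ * M) (g (n + N)) := by
    intro n M hM h
    refine ⟨fun x y => ((lip n M hM h N).lip x y).trans ?_, fun x y => ?_⟩
    · gcongr
      refine le_trans ?_ (le_max_left _ _)
      have : (1 : ℝ) / 2 ^ N ≤ 1 / 2 := by
        apply one_div_le_one_div_of_le (by norm_num)
        calc (2 : ℝ) = 2 ^ 1 := by norm_num
          _ ≤ 2 ^ N := pow_le_pow_right₀ (by norm_num) hN0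
      linarith
    · have := Controlled.iterate_osc (g := fun k => g (n + k)) (p := fun k => p (n + k)) hD hδ0.le
        (by positivity) hS j₀ (fun k => hp' _) (fun k => hg _) h N x y
      refine this.trans ?_
      have e : M / κ * (D / 2 ^ N) = D / 2 ^ N / κ * M := by ring
      rw [e]
      have h1 := mul_le_mul_of_nonneg_left (mul_le_mul_of_nonneg_right hN hM) (pow_pos hδ0 N).le
      have h2 : (1 - δ' ^ N / 2) * M ≤ ρ * M := mul_le_mul_of_nonneg_right (le_max_right _ _) hM
      linarith
  intro M hM h0
  have main : ∀ k, Controlled (ρ ^ k * M / κ) (ρ ^ k * M) (g (N * k)) := by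
    intro k
    induction k with
    | zero => simpa using h0
    | succ k ih =>
      have := contract _ _ (by positivity) ih
      rw [pow_succ', mul_add, mul_one]
      simpa [mul_assoc] using this
  intro n
  have h1 : ∀ k i, Controlled (ρ ^ k * M / κ) (ρ ^ k * M) (g (N * k + i)) := by
    intro k i
    induction i with
    | zero => exact main k
    | succ i ih => exact step _ _ (by positivity) ih
  have := h1 (n / N) (n % N)
  rwa [Nat.div_add_mod] at this

end Markov

/-! ### The Ruelle–Perron–Frobenius eigenfunction -/

section Eigenfunction

variable {K J : Type*} [MetricSpace K] [Fintype J]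

lemma exp_sub_one_le_mul_exp {t T : ℝ} (h0 : 0 ≤ t) (hT : t ≤ T) :
    Real.exp t - 1 ≤ t * Real.exp T := by
  have h1 := Real.add_one_le_exp (-t)
  have h2 : Real.exp t * (-t + 1) ≤ Real.exp t * Real.exp (-t) :=
    mul_le_mul_of_nonneg_left h1 (Real.exp_pos t).le
  rw [← Real.exp_add, add_neg_cancel, Real.exp_zero] at h2
  have h3 : t * Real.exp t ≤ t * Real.exp T :=
    mul_le_mul_of_nonneg_left (Real.exp_le_exp.2 hT) h0
  linarith

lemma abs_sub_le_of_le_exp_mul {a b t : ℝ} (ha : 0 ≤ a) (hb : 0 ≤ b) (ht : 0 ≤ t)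
    (h1 : a ≤ Real.exp t * b) (h2 : b ≤ Real.exp t * a) :
    |a - b| ≤ (Real.exp t - 1) * (a + b) := by
  have : 0 ≤ Real.exp t - 1 := by linarith [Real.add_one_le_exp t]
  rw [abs_le]
  constructor <;> nlinarith [mul_nonneg this ha, mul_nonneg this hb]

/-- Existence of a Lipschitz logarithm `v` of a positive eigenfunction of the transfer operator with
weights `exp (a j)`. The functions `Lⁿ1` have uniformly Lipschitz logarithms, and the ratios
`Lⁿ⁺¹1 / Lⁿ1` are the images of `L1` under a product of Markov operators. -/
theorem exists_eigenfunction [Nonempty K] [Nonempty J] {S : J → K → K} {D c R : ℝ}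
    (hD : ∀ x y : K, dist x y ≤ D) (hS : ∀ j x y, dist (S j x) (S j y) ≤ dist x y / 2)
    {a : J → K → ℝ} (hc : 0 ≤ c) (ha : ∀ j x y, |a j x - a j y| ≤ c * dist x y)
    (hR : ∀ j x, |a j x| ≤ R) :
    ∃ v : K → ℝ, (∀ x y, |v x - v y| ≤ 2 * c * dist x y) ∧ ∃ lam : ℝ, 0 < lam ∧
      ∀ x, ∑ j, Real.exp (a j x) * Real.exp (v (S j x)) = lam * Real.exp (v x) := by
  obtain ⟨x₀⟩ := ‹Nonempty K›
  have : Nonempty K := ⟨x₀⟩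
  have hD0 : 0 ≤ D := dist_nonneg.trans (hD x₀ x₀)
  let w : J → K → ℝ := fun j x => Real.exp (a j x)
  let h : ℕ → K → ℝ := fun n => (transfer S w)^[n] fun _ => 1
  have hsucc : ∀ n, h (n + 1) = transfer S w (h n) := fun n => Function.iterate_succ_apply' _ _ _
  have hsucc' : ∀ n x, h (n + 1) x = ∑ j, Real.exp (a j x) * h n (S j x) := fun n x => by
    rw [hsucc]; rfl
  have hpos : ∀ n x, 0 < h n x := by
    intro n
    induction n with
    | zero => intro x; exact one_pos
    | succ n ih =>
      intro x
      rw [hsucc']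
      exact Finset.sum_pos (fun j _ => mul_pos (Real.exp_pos _) (ih _)) Finset.univ_nonempty
  have hwlip : ∀ j x y, Real.exp (a j x) ≤ Real.exp (c * dist x y) * Real.exp (a j y) := by
    intro j x y
    rw [← Real.exp_add, Real.exp_le_exp]
    linarith [(abs_le.1 (ha j x y)).2]
  have hlip : ∀ n x y, h n x ≤ Real.exp (2 * c * dist x y) * h n y := by
    intro n
    induction n with
    | zero =>
      intro x y
      have : (1 : ℝ) ≤ Real.exp (2 * c * dist x y) := Real.one_le_exp (by positivity)
      simpa [h] using this
    | succ n ih =>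
      intro x y
      rw [hsucc', hsucc', Finset.mul_sum]
      refine Finset.sum_le_sum fun j _ => ?_
      have h1 := hwlip j x y
      have h2 : h n (S j x) ≤ Real.exp (c * dist x y) * h n (S j y) := by
        refine (ih _ _).trans (mul_le_mul_of_nonneg_right ?_ (hpos _ _).le)
        rw [Real.exp_le_exp]
        nlinarith [hS j x y]
      calc _ ≤ (Real.exp (c * dist x y) * Real.exp (a j y)) *
            (Real.exp (c * dist x y) * h n (S j y)) :=
            mul_le_mul h1 h2 (hpos _ _).le (by positivity)
        _ = _ := by
          rw [show 2 * c * dist x y = c * dist x y + c * dist x y by ring, Real.exp_add]; ring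
  -- the Markov weights
  let p : ℕ → J → K → ℝ := fun n j x => Real.exp (a j x) * h n (S j x) / h (n + 1) x
  have hplip : ∀ n j x y, p n j x ≤ Real.exp (5 * c * dist x y) * p n j y := by
    intro n j x y
    have h1 := hwlip j x y
    have h2 : h n (S j x) ≤ Real.exp (2 * c * dist x y) * h n (S j y) := by
      refine (hlip _ _ _).trans (mul_le_mul_of_nonneg_right ?_ (hpos _ _).le)
      rw [Real.exp_le_exp]
      nlinarith [hS j x y, dist_nonneg (x := x) (y := y)]
    have h3 := hlip (n + 1) y x
    rw [dist_comm] at h3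
    simp only [p]
    rw [div_le_iff₀ (hpos _ _), show 5 * c * dist x y =
      c * dist x y + 2 * c * dist x y + 2 * c * dist x y by ring, Real.exp_add, Real.exp_add]
    calc _ ≤ (Real.exp (c * dist x y) * Real.exp (a j y)) *
          (Real.exp (2 * c * dist x y) * h n (S j y)) :=
          mul_le_mul h1 h2 (hpos _ _).le (by positivity)
      _ = (Real.exp (c * dist x y) * Real.exp (2 * c * dist x y)) *
          (Real.exp (a j y) * h n (S j y) / h (n + 1) y) * h (n + 1) y := by
          have := (hpos (n + 1) y).ne'
          field_simp
      _ ≤ (Real.exp (c * dist x y) * Real.exp (2 * c * dist x y)) *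
          (Real.exp (a j y) * h n (S j y) / h (n + 1) y) *
            (Real.exp (2 * c * dist x y) * h (n + 1) x) := by
          have := hpos n (S j y)
          have := hpos (n + 1) y
          gcongr
      _ = _ := by ring
  have hppos : ∀ n j x, 0 < p n j x := fun n j x =>
    div_pos (mul_pos (Real.exp_pos _) (hpos _ _)) (hpos _ _)
  have hpsum : ∀ n x, ∑ j, p n j x = 1 := by
    intro n x
    simp only [p]
    rw [← Finset.sum_div, ← hsucc', div_self (hpos _ _).ne']
  set C : ℝ := 2 * (5 * c * Real.exp (5 * c * D)) with hCdef
  set δ : ℝ := (Fintype.card J * Real.exp (2 * R + 2 * c * D))⁻¹ with hδdef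
  have hδ : 0 < δ := by
    have : 0 < Fintype.card J := Fintype.card_pos
    positivity
  have hM : ∀ n, IsMarkov C δ (p n) := by
    intro n
    refine ⟨hpsum n, fun j x => ?_, fun x y => ?_⟩
    · have hcard : 0 < Fintype.card J := Fintype.card_pos
      simp only [p]
      rw [le_div_iff₀ (hpos _ _), hδdef, inv_mul_le_iff₀ (by positivity), hsucc']
      calc ∑ i, Real.exp (a i x) * h n (S i x)
          ≤ ∑ _i : J, Real.exp (2 * R + 2 * c * D) * (Real.exp (a j x) * h n (S j x)) := by
            refine Finset.sum_le_sum fun i _ => ?_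
            have h1 : Real.exp (a i x) ≤ Real.exp (2 * R) * Real.exp (a j x) := by
              rw [← Real.exp_add, Real.exp_le_exp]
              linarith [(abs_le.1 (hR i x)).2, (abs_le.1 (hR j x)).1]
            have h2 : h n (S i x) ≤ Real.exp (2 * c * D) * h n (S j x) := by
              refine (hlip _ _ _).trans (mul_le_mul_of_nonneg_right ?_ (hpos _ _).le)
              rw [Real.exp_le_exp]
              exact mul_le_mul_of_nonneg_left (hD _ _) (by positivity)
            calc _ ≤ (Real.exp (2 * R) * Real.exp (a j x)) *
                  (Real.exp (2 * c * D) * h n (S j x)) :=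
                  mul_le_mul h1 h2 (hpos _ _).le (by positivity)
              _ = _ := by rw [Real.exp_add]; ring
        _ = _ := by rw [Finset.sum_const, Finset.card_univ, nsmul_eq_mul]; ring
    · calc ∑ j, |p n j x - p n j y|
          ≤ ∑ j, (Real.exp (5 * c * dist x y) - 1) * (p n j x + p n j y) :=
            Finset.sum_le_sum fun j _ => abs_sub_le_of_le_exp_mul (hppos _ _ _).le
              (hppos _ _ _).le (by positivity) (hplip n j x y)
              (by have := hplip n j y x; rwa [dist_comm] at this)
        _ = 2 * (Real.exp (5 * c * dist x y) - 1) := by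
            rw [← Finset.mul_sum, Finset.sum_add_distrib, hpsum, hpsum]; ring
        _ ≤ 2 * (5 * c * dist x y * Real.exp (5 * c * D)) := by
            have := exp_sub_one_le_mul_exp (t := 5 * c * dist x y) (T := 5 * c * D)
              (by positivity) (mul_le_mul_of_nonneg_left (hD x y) (by positivity))
            linarith
        _ = _ := by rw [hCdef]; ring
  -- the ratios
  let r : ℕ → K → ℝ := fun n x => h (n + 1) x / h n x
  have hr : ∀ n, r (n + 1) = transfer S (p n) (r n) := by
    intro n
    funext x
    simp only [r, transfer, p]
    rw [hsucc' (n + 1), Finset.sum_div]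
    refine Finset.sum_congr rfl fun j _ => ?_
    have := (hpos n (S j x)).ne'
    have := (hpos (n + 1) x).ne'
    field_simp
  have hr0 : ∀ x, r 0 x = ∑ j, Real.exp (a j x) := by
    intro x
    have : h 0 x = 1 := rfl
    simp only [r]
    rw [this, div_one, hsucc']
    simp [h]
  have hrlow : ∀ n x, Real.exp (-R) ≤ r n x := by
    intro n
    induction n with
    | zero =>
      intro x
      rw [hr0]
      obtain ⟨j⟩ := ‹Nonempty J›
      refine le_trans ?_ (Finset.single_le_sum (fun i _ => (Real.exp_pos (a i x)).le)
        (Finset.mem_univ j))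
      rw [Real.exp_le_exp]
      exact (abs_le.1 (hR j x)).1
    | succ n ih =>
      intro x
      rw [hr]
      exact (hM n).le_transfer hδ.le ih x
  obtain ⟨κ, hκ, b, hb0, hbs, hb⟩ := exists_summable_controlled (J := J) (C := C) (δ := δ) hD hδ
    (by positivity) hS
  obtain ⟨ℓ, hℓ0, hℓ⟩ : ∃ ℓ : ℝ, 0 ≤ ℓ ∧ ∀ x y, |r 0 x - r 0 y| ≤ ℓ * dist x y := by
    refine ⟨∑ _j : J, c * Real.exp (c * D) * (2 * Real.exp R), by positivity, fun x y => ?_⟩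
    rw [hr0, hr0, ← Finset.sum_sub_distrib, Finset.sum_mul]
    refine (Finset.abs_sum_le_sum_abs _ _).trans (Finset.sum_le_sum fun j _ => ?_)
    have h1 := abs_sub_le_of_le_exp_mul (Real.exp_pos (a j x)).le (Real.exp_pos (a j y)).le
      (t := c * dist x y) (by positivity) (hwlip j x y)
      (by have := hwlip j y x; rwa [dist_comm] at this)
    have h2 := exp_sub_one_le_mul_exp (t := c * dist x y) (T := c * D)
      (by positivity) (mul_le_mul_of_nonneg_left (hD x y) (by positivity))
    have h3 : Real.exp (a j x) ≤ Real.exp R := Real.exp_le_exp.2 (abs_le.1 (hR j x)).2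
    have h4 : Real.exp (a j y) ≤ Real.exp R := Real.exp_le_exp.2 (abs_le.1 (hR j y)).2
    calc _ ≤ _ := h1
      _ ≤ (c * dist x y * Real.exp (c * D)) * (2 * Real.exp R) :=
          mul_le_mul h2 (by linarith) (by positivity) (by positivity)
      _ = _ := by ring
  set M : ℝ := max (ℓ * D) (κ * ℓ) with hMdef
  have hM0 : 0 ≤ M := le_max_of_le_left (by positivity)
  have hctrl : ∀ n, Controlled (b n * M / κ) (b n * M) (r n) := by
    refine hb p r hM hr M hM0 ⟨fun x y => (hℓ x y).trans ?_, fun x y => ?_⟩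
    · refine mul_le_mul_of_nonneg_right ?_ dist_nonneg
      rw [le_div_iff₀ hκ, mul_comm]; exact le_max_right _ _
    · refine (le_abs_self _).trans ((hℓ x y).trans (le_trans ?_ (le_max_left _ _)))
      exact mul_le_mul_of_nonneg_left (hD x y) hℓ0
  have hbM : Summable fun n => b n * M := hbs.mul_right M
  -- convergence of the ratios at `x₀`
  obtain ⟨lam, hlam⟩ : ∃ lam, Tendsto (fun n => r n x₀) atTop (𝓝 lam) := by
    refine cauchySeq_tendsto_of_complete (cauchySeq_of_summable_dist (hbM.of_nonneg_of_le
      (fun _ => dist_nonneg) fun n => ?_))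
    rw [Real.dist_eq, abs_sub_comm, hr, abs_le]
    have h1 := (hM n).transfer_le (S := S) (g := r n) (c := r n x₀ + b n * M) hδ.le
      (fun u => by linarith [(hctrl n).osc u x₀]) x₀
    have h2 := (hM n).le_transfer (S := S) (g := r n) (c := r n x₀ - b n * M) hδ.le
      (fun u => by linarith [(hctrl n).osc x₀ u]) x₀
    constructor <;> linarith
  have hlam0 : 0 < lam := (Real.exp_pos (-R)).trans_le
    (ge_of_tendsto' hlam fun n => hrlow n x₀)
  -- convergence of the normalized iterates
  let V : ℕ → K → ℝ := fun n x => Real.log (h n x) - Real.log (h n x₀)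
  have hV : ∀ x, ∃ v, Tendsto (fun n => V n x) atTop (𝓝 v) := by
    intro x
    refine cauchySeq_tendsto_of_complete (cauchySeq_of_summable_dist
      ((hbM.mul_left (Real.exp R)).of_nonneg_of_le (fun _ => dist_nonneg) fun n => ?_))
    have e : V (n + 1) x - V n x = Real.log (r n x) - Real.log (r n x₀) := by
      simp only [V, r]
      rw [Real.log_div (hpos _ _).ne' (hpos _ _).ne', Real.log_div (hpos _ _).ne' (hpos _ _).ne']
      ring
    have key : ∀ y z, Real.log (r n y) - Real.log (r n z) ≤ Real.exp R * (b n * M) := by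
      intro y z
      have hz := (Real.exp_pos (-R)).trans_le (hrlow n z)
      have hy := (Real.exp_pos (-R)).trans_le (hrlow n y)
      rw [← Real.log_div hy.ne' hz.ne']
      refine (Real.log_le_sub_one_of_pos (div_pos hy hz)).trans ?_
      rw [div_sub_one hz.ne', div_le_iff₀ hz]
      have h1 := (hctrl n).osc y z
      have h2 : 1 ≤ Real.exp R * r n z := by
        calc (1 : ℝ) = Real.exp R * Real.exp (-R) := by rw [← Real.exp_add]; simp
          _ ≤ _ := mul_le_mul_of_nonneg_left (hrlow n z) (Real.exp_pos _).le
      have h3 : 0 ≤ b n * M := mul_nonneg (hb0 n) hM0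
      nlinarith [mul_le_mul_of_nonneg_right h2 h3]
    rw [Real.dist_eq, abs_sub_comm, e, abs_le]
    constructor <;> linarith [key x x₀, key x₀ x]
  choose v hv using hV
  have hVexp : ∀ n x, Real.exp (V n x) = h n x / h n x₀ := by
    intro n x
    simp only [V]
    rw [Real.exp_sub, Real.exp_log (hpos _ _), Real.exp_log (hpos _ _)]
  refine ⟨v, fun x y => ?_, lam, hlam0, fun x => ?_⟩
  · refine le_of_tendsto' ((hv x).sub (hv y)).abs fun n => ?_
    have key : ∀ x y, V n x - V n y ≤ 2 * c * dist x y := by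
      intro x y
      simp only [V]
      have := Real.log_le_log (hpos n x) (hlip n x y)
      rw [Real.log_mul (Real.exp_pos _).ne' (hpos _ _).ne', Real.log_exp] at this
      linarith
    rw [abs_le]
    have h1 := key x y
    have h2 := key y x
    rw [dist_comm] at h2
    constructor <;> linarith
  · have h1 : Tendsto (fun n => ∑ j, Real.exp (a j x) * Real.exp (V n (S j x))) atTop
        (𝓝 (∑ j, Real.exp (a j x) * Real.exp (v (S j x)))) :=
      tendsto_finsetSum _ fun j _ =>
        ((Real.continuous_exp.tendsto _).comp (hv (S j x))).const_mul _
    have h2 : Tendsto (fun n => r n x₀ * Real.exp (V (n + 1) x)) atTop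
        (𝓝 (lam * Real.exp (v x))) :=
      hlam.mul ((Real.continuous_exp.tendsto _).comp ((hv x).comp (tendsto_add_atTop_nat 1)))
    refine tendsto_nhds_unique h1 (h2.congr fun n => ?_)
    simp only [hVexp, r]
    have := (hpos n x₀).ne'
    have := (hpos (n + 1) x₀).ne'
    rw [div_mul_div_comm, mul_comm (h n x₀), mul_div_mul_left _ _ this, hsucc', Finset.sum_div]
    exact Finset.sum_congr rfl fun j _ => by ring

end Eigenfunction

/-! ### The Banach space of bounded Lipschitz functions -/

section LipFun

open scoped ENNReal

variable {K : Type*} [MetricSpace K]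

/-- The bounded Lipschitz functions on `K`, realized as the closed subspace of
`ℓ^∞(K ⊔ K × K)` of all pairs of a function and its difference quotients. The norm is the maximum
of the supremum norm and the Lipschitz constant. -/
def lipSpace (K : Type*) [MetricSpace K] : Submodule ℝ (lp (fun _ : K ⊕ K × K => ℝ) ∞) where
  carrier := {F | ∀ x y, F (Sum.inr (x, y)) = (F (Sum.inl x) - F (Sum.inl y)) / dist x y}
  add_mem' := by
    intro F G hF hG x y
    simp only [lp.coeFn_add, Pi.add_apply, hF x y, hG x y]
    ring
  zero_mem' := by intro x y; simp
  smul_mem' := by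
    intro c F hF x y
    simp only [lp.coeFn_smul, Pi.smul_apply, hF x y, smul_eq_mul]
    ring

/-- Bounded Lipschitz functions on `K`. -/
def LipFun (K : Type*) [MetricSpace K] : Type _ := lipSpace K

instance : NormedAddCommGroup (LipFun K) := inferInstanceAs (NormedAddCommGroup (lipSpace K))

instance : NormedSpace ℝ (LipFun K) := inferInstanceAs (NormedSpace ℝ (lipSpace K))

/-- Coordinates of `ℓ^∞` as continuous functionals. -/
def lpCoord {ι : Type*} (i : ι) : lp (fun _ : ι => ℝ) ∞ →L[ℝ] ℝ :=
  LinearMap.mkContinuous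
    { toFun := fun F => F i
      map_add' := fun _ _ => rfl
      map_smul' := fun _ _ => rfl } 1
    fun F => by rw [one_mul]; exact lp.norm_apply_le_norm ENNReal.top_ne_zero F i

instance : CompleteSpace (LipFun K) := by
  have : IsClosed ((lipSpace K : Submodule ℝ (lp (fun _ : K ⊕ K × K => ℝ) ∞)) :
      Set (lp (fun _ : K ⊕ K × K => ℝ) ∞)) := by
    have e : ((lipSpace K : Submodule ℝ (lp (fun _ : K ⊕ K × K => ℝ) ∞)) :
        Set (lp (fun _ : K ⊕ K × K => ℝ) ∞)) = ⋂ x : K, ⋂ y : K,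
          {F | lpCoord (Sum.inr (x, y)) F =
            (lpCoord (Sum.inl x) F - lpCoord (Sum.inl y) F) / dist x y} := by
      ext F
      simp only [Set.mem_iInter]
      rfl
    rw [e]
    exact isClosed_iInter fun x => isClosed_iInter fun y => isClosed_eq (by fun_prop) (by fun_prop)
  exact this.completeSpace_coe

/-- Evaluation at a point. -/
def ev (x : K) : LipFun K →L[ℝ] ℝ :=
  ((lpCoord (Sum.inl x)).comp (lipSpace K).subtypeL : lipSpace K →L[ℝ] ℝ)

lemma LipFun.ext {g h : LipFun K} (H : ∀ x, ev x g = ev x h) : g = h := by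
  apply Subtype.ext
  ext i
  rcases i with x | ⟨x, y⟩
  · exact H x
  · have h1 := g.2 x y
    have h2 := h.2 x y
    rw [h1, h2]
    have hx := H x
    have hy := H y
    simp only [ev] at hx hy
    change (g.1 (Sum.inl x) - g.1 (Sum.inl y)) / _ = (h.1 (Sum.inl x) - h.1 (Sum.inl y)) / _
    rw [show g.1 (Sum.inl x) = h.1 (Sum.inl x) from hx,
      show g.1 (Sum.inl y) = h.1 (Sum.inl y) from hy]

lemma LipFun.abs_ev_le (g : LipFun K) (x : K) : |ev x g| ≤ ‖g‖ :=
  lp.norm_apply_le_norm ENNReal.top_ne_zero g.1 (Sum.inl x)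

lemma LipFun.abs_ev_sub_le (g : LipFun K) (x y : K) : |ev x g - ev y g| ≤ ‖g‖ * dist x y := by
  rcases eq_or_ne x y with rfl | hxy
  · simp
  · have h1 := lp.norm_apply_le_norm ENNReal.top_ne_zero g.1 (Sum.inr (x, y))
    rw [g.2 x y, Real.norm_eq_abs, abs_div, abs_of_nonneg (dist_nonneg (x := x) (y := y)),
      div_le_iff₀ (dist_pos.2 hxy)] at h1
    exact h1

lemma LipFun.norm_le {g : LipFun K} {A : ℝ} (hA : 0 ≤ A) (h1 : ∀ x, |ev x g| ≤ A)
    (h2 : ∀ x y, |ev x g - ev y g| ≤ A * dist x y) : ‖g‖ ≤ A := by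
  refine lp.norm_le_of_forall_le hA ?_
  rintro (x | ⟨x, y⟩)
  · exact h1 x
  · have e := g.2 x y
    change ‖(g.1 (Sum.inr (x, y)) : ℝ)‖ ≤ A
    rw [e, Real.norm_eq_abs, abs_div, abs_of_nonneg (dist_nonneg (x := x) (y := y))]
    exact div_le_of_le_mul₀ dist_nonneg hA (h2 x y)

lemma LipFun.exists_of_bounds {f : K → ℝ} {A : ℝ} (h1 : ∀ x, |f x| ≤ A)
    (h2 : ∀ x y, |f x - f y| ≤ A * dist x y) : ∃ g : LipFun K, ∀ x, ev x g = f x := by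
  let F : K ⊕ K × K → ℝ := Sum.elim f fun z => (f z.1 - f z.2) / dist z.1 z.2
  have hF : Memℓp F ∞ := by
    refine memℓp_infty ⟨|A|, ?_⟩
    rintro _ ⟨x | ⟨x, y⟩, rfl⟩
    · exact (h1 x).trans (le_abs_self A)
    · simp only [F, Sum.elim_inr]
      rw [Real.norm_eq_abs, abs_div, abs_of_nonneg (dist_nonneg (x := x) (y := y))]
      exact div_le_of_le_mul₀ dist_nonneg (abs_nonneg _) ((h2 x y).trans
        (mul_le_mul_of_nonneg_right (le_abs_self A) dist_nonneg))
  exact ⟨⟨⟨F, hF⟩, fun x y => rfl⟩, fun x => rfl⟩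

/-- Weighted composition operators `g ↦ m * g ∘ S` with a bounded Lipschitz weight `m` and a
nonexpanding map `S`. -/
lemma LipFun.exists_weightedComp {m : K → ℝ} {A : ℝ} (hA : 0 ≤ A) (h1 : ∀ x, |m x| ≤ A)
    (h2 : ∀ x y, |m x - m y| ≤ A * dist x y) {S : K → K}
    (hS : ∀ x y, dist (S x) (S y) ≤ dist x y) :
    ∃ T : LipFun K →L[ℝ] LipFun K, ∀ g x, ev x (T g) = m x * ev (S x) g := by
  have b1 : ∀ (g : LipFun K) x, |m x * ev (S x) g| ≤ 2 * A * ‖g‖ := by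
    intro g x
    rw [abs_mul]
    nlinarith [mul_le_mul (h1 x) (g.abs_ev_le (S x)) (abs_nonneg _) hA, norm_nonneg g,
      mul_nonneg hA (norm_nonneg g)]
  have b2 : ∀ (g : LipFun K) x y,
      |m x * ev (S x) g - m y * ev (S y) g| ≤ 2 * A * ‖g‖ * dist x y := by
    intro g x y
    have e : m x * ev (S x) g - m y * ev (S y) g
        = (m x - m y) * ev (S x) g + m y * (ev (S x) g - ev (S y) g) := by ring
    have c1 : |(m x - m y) * ev (S x) g| ≤ A * dist x y * ‖g‖ := by
      rw [abs_mul]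
      exact mul_le_mul (h2 x y) (g.abs_ev_le _) (abs_nonneg _) (by positivity)
    have c2 : |m y * (ev (S x) g - ev (S y) g)| ≤ A * (‖g‖ * dist x y) := by
      rw [abs_mul]
      refine mul_le_mul (h1 y) ((g.abs_ev_sub_le _ _).trans ?_) (abs_nonneg _) hA
      exact mul_le_mul_of_nonneg_left (hS x y) (norm_nonneg g)
    rw [e]
    refine (abs_add_le _ _).trans ?_
    linarith
  choose T hT using fun g : LipFun K => LipFun.exists_of_bounds (b1 g) (b2 g)
  let T' : LipFun K →ₗ[ℝ] LipFun K :=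
    { toFun := T
      map_add' := fun g h => LipFun.ext fun x => by
        simp only [map_add, hT]; ring
      map_smul' := fun c g => LipFun.ext fun x => by
        simp only [map_smul, hT, smul_eq_mul, RingHom.id_apply]; ring }
  refine ⟨T'.mkContinuous (2 * A) fun g => LipFun.norm_le (by positivity) (fun x => ?_)
    fun x y => ?_, fun g x => hT g x⟩
  · exact (congrArg abs (hT g x)).trans_le (b1 g x)
  · have : ev x (T' g) - ev y (T' g) = m x * ev (S x) g - m y * ev (S y) g :=
      congrArg₂ _ (hT g x) (hT g y)
    rw [this]
    exact b2 g x y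

/-- If `ℓ` is an eigenfunctional of `Φ`, it is one of `exp (t • Φ)`. -/
lemma apply_exp_of_eigen {E : Type*} [NormedAddCommGroup E] [NormedSpace ℝ E] [CompleteSpace E]
    {Φ : E →L[ℝ] E} {l : E →L[ℝ] ℝ} {c : ℝ} (h : ∀ g, l (Φ g) = c * l g) (t : ℝ) (g : E) :
    l (NormedSpace.exp (t • Φ) g) = Real.exp (t * c) * l g := by
  have h1 : HasSum (fun n : ℕ => ((n.factorial : ℝ)⁻¹) • (t • Φ) ^ n)
      (NormedSpace.exp (t • Φ)) := NormedSpace.exp_series_hasSum_exp' (𝕂 := ℝ) (t • Φ)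
  have h2 := (l.comp (ContinuousLinearMap.apply ℝ E g)).hasSum h1
  have hpow : ∀ n : ℕ, l (((t • Φ) ^ n) g) = (t * c) ^ n * l g := by
    intro n
    induction n with
    | zero => simp
    | succ n ih =>
      have e : ((t • Φ) ^ (n + 1)) g = t • Φ (((t • Φ) ^ n) g) := by rw [pow_succ']; rfl
      rw [e, map_smul, h, ih, smul_eq_mul]
      ring
  have h3 : HasSum (fun n : ℕ => ((n.factorial : ℝ)⁻¹) • (t * c) ^ n) (Real.exp (t * c)) := by
    rw [Real.exp_eq_exp_ℝ]; exact NormedSpace.exp_series_hasSum_exp' (𝕂 := ℝ) (t * c)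
  refine h2.unique ?_
  convert! h3.mul_right (l g) using 2 with n
  change l ((((n.factorial : ℝ)⁻¹) • (t • Φ) ^ n) g) = _
  rw [show (((n.factorial : ℝ)⁻¹) • (t • Φ) ^ n) g = ((n.factorial : ℝ)⁻¹) • (((t • Φ) ^ n) g)
    from rfl, map_smul, hpow, smul_eq_mul, smul_eq_mul, mul_assoc]

end LipFun

/-! ### Analytic dependence of the eigenvalue equation on parameters -/

section AnalyticFamily

open scoped ContDiff

variable {K J : Type*} [MetricSpace K] [Fintype J]

/-- The equation `P k - k = q - c` has a Lipschitz solution `k` and a constant `c` for every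
Lipschitz `q`; the solution is `-∑ (Pⁿ q - c)`, and `c` is the integral of `q` with respect to
the invariant measure of `P`. -/
lemma exists_poisson_solution [Nonempty K] [Nonempty J] {S : J → K → K} {D C δ : ℝ}
    (hD : ∀ x y : K, dist x y ≤ D) (hS : ∀ j x y, dist (S j x) (S j y) ≤ dist x y / 2)
    (hδ : 0 < δ) (hC : 0 ≤ C) {p : J → K → ℝ} (hp : IsMarkov C δ p)
    {P : LipFun K →L[ℝ] LipFun K} (hP : ∀ g x, ev x (P g) = ∑ j, p j x * ev (S j x) g)
    {one : LipFun K} (hone : ∀ x, ev x one = 1) (q : LipFun K) :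
    ∃ k : LipFun K, ∃ c : ℝ, P k - k = q - c • one := by
  obtain ⟨κ, hκ, b, hb0, hbs, hb⟩ := exists_summable_controlled (J := J) (C := C) (δ := δ) hD hδ
    hC hS
  obtain ⟨x₀⟩ := ‹Nonempty K›
  have hD0 : 0 ≤ D := dist_nonneg.trans (hD x₀ x₀)
  let e : ℕ → LipFun K := fun n => (⇑P)^[n] q
  have he : ∀ n, e (n + 1) = P (e n) := fun n => Function.iterate_succ_apply' _ _ _
  have hstep : ∀ n, (fun x => ev x (e (n + 1))) = transfer S p fun x => ev x (e n) := by
    intro n; funext x; rw [he, hP]; rfl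
  set M : ℝ := max (‖q‖ * D) (κ * ‖q‖) with hMdef
  have hM0 : 0 ≤ M := le_max_of_le_left (by positivity)
  have ctrl : ∀ n, Controlled (b n * M / κ) (b n * M) fun x => ev x (e n) := by
    refine hb (fun _ => p) (fun n x => ev x (e n)) (fun _ => hp) hstep M hM0 ⟨fun x y => ?_, fun x y => ?_⟩
    · refine (q.abs_ev_sub_le x y).trans (mul_le_mul_of_nonneg_right ?_ dist_nonneg)
      rw [le_div_iff₀ hκ, mul_comm]; exact le_max_right _ _
    · refine (le_abs_self _).trans ((q.abs_ev_sub_le x y).trans (le_trans ?_ (le_max_left _ _)))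
      exact mul_le_mul_of_nonneg_left (hD x y) (norm_nonneg _)
  have near : ∀ n i x y, |ev y (e (n + i)) - ev x (e n)| ≤ b n * M := by
    intro n i
    induction i with
    | zero => intro x y; exact (ctrl n).abs_le y x
    | succ i ih =>
      intro x y
      have h1 := hp.transfer_le (S := S) (g := fun x => ev x (e (n + i)))
        (c := ev x (e n) + b n * M) hδ.le (fun u => by linarith [(abs_le.1 (ih x u)).2]) y
      have h2 := hp.le_transfer (S := S) (g := fun x => ev x (e (n + i)))
        (c := ev x (e n) - b n * M) hδ.le (fun u => by linarith [(abs_le.1 (ih x u)).1]) y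
      rw [← hstep] at h1 h2
      rw [abs_le, ← add_assoc]
      constructor <;> linarith
  obtain ⟨c, hc⟩ : ∃ c, Tendsto (fun n => ev x₀ (e n)) atTop (𝓝 c) := by
    refine cauchySeq_tendsto_of_complete (cauchySeq_of_summable_dist
      ((hbs.mul_right M).of_nonneg_of_le (fun _ => dist_nonneg) fun n => ?_))
    rw [Real.dist_eq, abs_sub_comm]
    exact near n 1 x₀ x₀
  have nearc : ∀ n x, |c - ev x (e n)| ≤ b n * M := by
    intro n x
    have h1 : Tendsto (fun i => ev x₀ (e (n + i))) atTop (𝓝 c) := by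
      simpa only [add_comm n] using (tendsto_add_atTop_iff_nat n).2 hc
    exact le_of_tendsto' (h1.sub_const _).abs fun i => near n i x x₀
  let u : ℕ → LipFun K := fun n => e n - c • one
  have hu : ∀ n x, ev x (u n) = ev x (e n) - c := by
    intro n x; simp [u, hone]
  have hPone : P one = one := LipFun.ext fun x => by simp [hP, hone, hp.sum_one]
  have hPu : ∀ n, P (u n) = u (n + 1) := by
    intro n; simp only [u]; rw [map_sub, map_smul, hPone, he]
  have hus : Summable u := by
    refine Summable.of_norm_bounded ((hbs.mul_right M).mul_right (1 + 1 / κ)) fun n => ?_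
    have h0 : 0 ≤ b n * M := mul_nonneg (hb0 n) hM0
    have h1 : b n * M * (1 + 1 / κ) = b n * M + b n * M / κ := by ring
    rw [h1]
    refine LipFun.norm_le (by positivity) (fun x => ?_) fun x y => ?_
    · rw [hu, abs_sub_comm]
      exact (nearc n x).trans (le_add_of_nonneg_right (by positivity))
    · rw [hu, hu, sub_sub_sub_cancel_right]
      refine ((ctrl n).lip x y).trans (mul_le_mul_of_nonneg_right ?_ dist_nonneg)
      exact le_add_of_nonneg_left h0
  refine ⟨-∑' n, u n, c, ?_⟩
  have h1 : P (∑' n, u n) = ∑' n, u (n + 1) := by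
    rw [P.map_tsum hus]; simp only [hPu]
  have h2 := hus.tsum_eq_zero_add
  rw [map_neg, h1, h2]
  simp only [u, e, Function.iterate_zero, id]
  abel

/-- Around a Markov operator `P = ∑ p j * (· ∘ S j)`, the equation
`∑ p j * exp (t φ j - s τ j) * h ∘ S j = h` with `τ j > 0` has a solution `s = s(t)` that
is analytic in `t`, with a positive function `h`. This is the implicit function theorem in the
space of Lipschitz functions. -/
theorem exists_analytic_solution [CompactSpace K] [Nonempty K] [Nonempty J] {S : J → K → K}
    {C δ B : ℝ} (hS : ∀ j x y, dist (S j x) (S j y) ≤ dist x y / 2)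
    (hδ : 0 < δ) (hC : 0 ≤ C) {p : J → K → ℝ} (hp : IsMarkov C δ p)
    {φ : J → K → ℝ} (hφB : ∀ j x, |φ j x| ≤ B) (hφ : ∀ j x y, |φ j x - φ j y| ≤ B * dist x y)
    {τ : J → ℝ} (hτ : ∀ j, 0 < τ j) :
    ∃ s : ℝ → ℝ, AnalyticAt ℝ s 0 ∧ s 0 = 0 ∧ ∀ᶠ t in 𝓝 (0 : ℝ), ∃ h : K → ℝ,
      (∀ x, 1 / 2 ≤ h x ∧ h x ≤ 3 / 2) ∧
      ∀ x, ∑ j, p j x * Real.exp (t * φ j x - s t * τ j) * h (S j x) = h x := by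
  obtain ⟨x₀⟩ := ‹Nonempty K›
  have : Nonempty K := ⟨x₀⟩
  obtain ⟨D, hD⟩ : ∃ D, ∀ x y : K, dist x y ≤ D := by
    obtain ⟨D, hD⟩ := Metric.isBounded_iff.1 (isCompact_univ (X := K)).isBounded
    exact ⟨D, fun x y => hD (Set.mem_univ x) (Set.mem_univ y)⟩
  obtain ⟨j₀⟩ := ‹Nonempty J›
  have : Nonempty J := ⟨j₀⟩
  have hB : 0 ≤ B := (abs_nonneg _).trans (hφB j₀ x₀)
  have hS' : ∀ j x y, dist (S j x) (S j y) ≤ dist x y := fun j x y =>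
    (hS j x y).trans (half_le_self dist_nonneg)
  obtain ⟨one, hone⟩ : ∃ one : LipFun K, ∀ x, ev x one = 1 :=
    LipFun.exists_of_bounds (A := 1) (by simp) (by simp [dist_nonneg])
  have hp1 : ∀ j x, |p j x| ≤ C + 1 := by
    intro j x
    rw [abs_of_nonneg (hδ.le.trans (hp.le j x))]
    have : p j x ≤ ∑ i, p i x := Finset.single_le_sum
      (fun i _ => hδ.le.trans (hp.le i x)) (Finset.mem_univ j)
    rw [hp.sum_one] at this
    linarith
  have hp2 : ∀ j x y, |p j x - p j y| ≤ (C + 1) * dist x y := by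
    intro j x y
    refine (Finset.single_le_sum (f := fun j => |p j x - p j y|) (fun i _ => abs_nonneg _)
      (Finset.mem_univ j)).trans ((hp.lip x y).trans ?_)
    exact mul_le_mul_of_nonneg_right (by linarith) dist_nonneg
  choose A hA using fun j => LipFun.exists_weightedComp (by linarith) (hp1 j) (hp2 j) (hS' j)
  choose Φ hΦ using fun j => LipFun.exists_weightedComp hB (hφB j) (hφ j) (S := id)
    (fun x y => le_rfl)
  let P : LipFun K →L[ℝ] LipFun K := ∑ j, A j
  have hPapp : ∀ g, P g = ∑ j, A j g := fun g => by
    simp only [P]; exact sum_apply _ _ _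
  have hP : ∀ g x, ev x (P g) = ∑ j, p j x * ev (S j x) g := by
    intro g x; rw [hPapp, map_sum]; simp only [hA]
  have hPone : P one = one := LipFun.ext fun x => by simp [hP, hone, hp.sum_one]
  -- the projection to functions vanishing at `x₀`
  let N : LipFun K →L[ℝ] LipFun K :=
    ContinuousLinearMap.id ℝ _ - (ev x₀).smulRight one
  have hN : ∀ z, N z = z - ev x₀ z • one := fun z => rfl
  -- one unknown `z` encodes both the parameter `s = z x₀` and the function `h = 1 + N z`, which is
  -- normalized by `h x₀ = 1`
  let G : ℝ × LipFun K → LipFun K := fun u =>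
    (∑ j, Real.exp (-(τ j * ev x₀ u.2)) • NormedSpace.exp (u.1 • Φ j) (A j (one + N u.2)))
      - (one + N u.2)
  have hexp : ContDiff ℝ ω (NormedSpace.exp : (LipFun K →L[ℝ] LipFun K) → _) := by
    rw [contDiff_omega_iff_analyticOnNhd]
    exact fun x _ => NormedSpace.exp_analytic x
  have hG : ContDiff ℝ ω G := by
    refine ContDiff.sub (ContDiff.sum fun j _ => ContDiff.fun_smul ?_ ?_) (by fun_prop)
    · exact Real.contDiff_exp.comp (by fun_prop)
    · exact ContDiff.clm_apply (hexp.comp (by fun_prop)) (by fun_prop)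
  let r : LipFun K := ∑ j, τ j • A j one
  have hr : ∀ x, ev x r = ∑ j, τ j * p j x := by
    intro x; simp [r, map_sum, hA, hone]
  have hrpos : ∀ x, 0 < ev x r := fun x => by
    rw [hr]
    exact Finset.sum_pos (fun j _ => mul_pos (hτ j) (hδ.trans_le (hp.le j x)))
      Finset.univ_nonempty
  -- the derivative in the second variable
  let L : LipFun K →L[ℝ] LipFun K := P.comp N - N - (ev x₀).smulRight r
  have hL : ∀ z, L z = P (N z) - N z - ev x₀ z • r := fun z => rfl
  have hGL : fderiv ℝ G (0, 0) ∘L .inr ℝ ℝ (LipFun K) = L := by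
    have h1 : HasFDerivAt (fun z : LipFun K => G (0, z))
        (fderiv ℝ G (0, 0) ∘L .inr ℝ ℝ (LipFun K)) 0 := by
      have h2 : HasFDerivAt G (fderiv ℝ G (0, 0)) ((0 : ℝ), (0 : LipFun K)) :=
        (hG.differentiable (by simp)).differentiableAt.hasFDerivAt
      exact h2.comp (0 : LipFun K) (hasFDerivAt_prodMk_right (0 : ℝ) (0 : LipFun K))
    refine h1.unique ?_
    have h3 : (fun z : LipFun K => G (0, z)) = fun z =>
        (∑ j, Real.exp (-(τ j * ev x₀ z)) • A j (one + N z)) - (one + N z) := by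
      funext z
      simp only [G, zero_smul, NormedSpace.exp_zero]
      rfl
    rw [h3]
    have h4 : ∀ j, HasFDerivAt (fun z : LipFun K => Real.exp (-(τ j * ev x₀ z)) • A j (one + N z))
        ((A j).comp N + (-(τ j) • (ev x₀)).smulRight (A j one)) 0 := by
      intro j
      have a1 : HasFDerivAt (fun z : LipFun K => -(τ j * ev x₀ z)) (-(τ j) • (ev x₀)) 0 := by
        have := (-(τ j) • (ev x₀)).hasFDerivAt (x := (0 : LipFun K))
        convert! this using 1
        funext z
        change _ = -(τ j) * ev x₀ z
        ring
      have a2 : HasFDerivAt (fun z : LipFun K => A j (one + N z)) ((A j).comp N) 0 :=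
        (A j).hasFDerivAt.comp 0 (N.hasFDerivAt.const_add one)
      have a3 := a1.exp.smul a2
      convert! a3 using 1
      simp
    have h5 := (HasFDerivAt.fun_sum (u := Finset.univ) fun j _ => h4 j).sub
      (N.hasFDerivAt (x := (0 : LipFun K)) |>.const_add one)
    convert! h5 using 1
    refine ContinuousLinearMap.ext fun z => ?_
    rw [hL, hPapp]
    have e1 : (∑ j, ((A j).comp N + (-(τ j) • (ev x₀)).smulRight (A j one)) - N) z
        = ∑ j, (A j (N z) + (-(τ j) * ev x₀ z) • A j one) - N z := by
      have := sum_apply Finset.univ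
        (fun j => (A j).comp N + (-(τ j) • (ev x₀)).smulRight (A j one)) z
      exact congrArg (· - N z) this
    rw [e1, Finset.sum_add_distrib]
    have e2 : ∑ j, (-(τ j) * ev x₀ z) • A j one = - (ev x₀ z • r) := by
      simp only [r, Finset.smul_sum, ← Finset.sum_neg_distrib, smul_smul, ← neg_smul]
      exact Finset.sum_congr rfl fun j _ => by congr 1; ring
    rw [e2]
    abel
  have hcont : ∀ g : LipFun K, Continuous fun x => ev x g := by
    intro g
    refine LipschitzWith.continuous (K := ⟨‖g‖, norm_nonneg g⟩)
      (LipschitzWith.of_dist_le_mul fun x y => ?_)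
    rw [Real.dist_eq]; exact g.abs_ev_sub_le x y
  have hmax : ∀ g : LipFun K, ∃ x, ev x (P g) ≤ ev x g := by
    intro g
    obtain ⟨x, hx⟩ := (isCompact_univ (X := K)).exists_isMaxOn Set.univ_nonempty
      (hcont g).continuousOn
    refine ⟨x, ?_⟩
    rw [hP]
    exact hp.transfer_le hδ.le (fun u => hx.2 (Set.mem_univ u)) x
  have hbij : L.IsInvertible := by
    have hinj : ∀ z, L z = 0 → z = 0 := by
      intro z hz
      rw [hL] at hz
      have hzx : ∀ x, ev x (P (N z)) - ev x (N z) = ev x₀ z * ev x r := by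
        intro x
        have := congrArg (ev x) hz
        simp only [map_sub, map_smul, smul_eq_mul, map_zero] at this
        linarith
      -- at a maximum of `N z` and at one of `-N z`, both sides of `hzx` have opposite signs
      have hσ : ev x₀ z = 0 := by
        obtain ⟨x, hx⟩ := hmax (N z)
        obtain ⟨y, hy⟩ := hmax (-N z)
        simp only [map_neg] at hy
        have h1 := hzx x
        have h2 := hzx y
        have h3 := hrpos x
        have h4 := hrpos y
        refine le_antisymm ?_ ?_
        · by_contra! hcon; nlinarith [mul_pos hcon h3]
        · by_contra! hcon; nlinarith [mul_neg_of_neg_of_pos hcon h4]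
      have hNz : N z = z := by rw [hN, hσ, zero_smul, sub_zero]
      rw [hNz] at hzx
      have hfix : ∀ n : ℕ, (fun x => ev x z) = transfer S p fun x => ev x z := by
        intro _; funext x
        have := hzx x
        rw [hσ, zero_mul, hP] at this
        simp only [transfer]
        linarith
      obtain ⟨κ, hκ, b, hb0, hbs, hb⟩ :=
        exists_summable_controlled (J := J) (C := C) (δ := δ) hD hδ hC hS
      have hD0 : 0 ≤ D := dist_nonneg.trans (hD x₀ x₀)
      have hctrl := hb (fun _ => p) (fun _ x => ev x z) (fun _ => hp) hfix
        (max (‖z‖ * D) (κ * ‖z‖)) (le_max_of_le_left (by positivity))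
        ⟨fun x y => by
          refine (z.abs_ev_sub_le x y).trans (mul_le_mul_of_nonneg_right ?_ dist_nonneg)
          rw [le_div_iff₀ hκ, mul_comm]; exact le_max_right _ _, fun x y => by
          refine (le_abs_self _).trans ((z.abs_ev_sub_le x y).trans
            (le_trans ?_ (le_max_left _ _)))
          exact mul_le_mul_of_nonneg_left (hD x y) (norm_nonneg _)⟩
      refine LipFun.ext fun x => ?_
      rw [map_zero]
      have hlim := hbs.tendsto_atTop_zero.mul_const (max (‖z‖ * D) (κ * ‖z‖))
      rw [zero_mul] at hlim
      have h6 : |ev x z - ev x₀ z| ≤ 0 := ge_of_tendsto' hlim fun n => (hctrl n).abs_le x x₀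
      rw [hσ, sub_zero] at h6
      exact abs_nonpos_iff.1 h6
    -- solve the Poisson equation for `q` and for `r`, and combine the two solutions so that the
    -- constants cancel
    have hsurj : ∀ q, ∃ z, L z = q := by
      intro q
      obtain ⟨kq, cq, hkq⟩ := exists_poisson_solution hD hS hδ hC hp hP hone q
      obtain ⟨kr, cr, hkr⟩ := exists_poisson_solution hD hS hδ hC hp hP hone r
      have hcr : 0 < cr := by
        obtain ⟨x, hx⟩ := hmax kr
        have := congrArg (ev x) hkr
        simp only [map_sub, map_smul, smul_eq_mul, hone, mul_one] at this
        linarith [hrpos x]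
      let σ : ℝ := -cq / cr
      let k : LipFun K := kq + σ • kr
      have hk : P k - k = q + σ • r := by
        have e : P k - k = (P kq - kq) + σ • (P kr - kr) := by
          simp only [k, map_add, map_smul, smul_sub]; abel
        rw [e, hkq, hkr]
        have : σ * cr = -cq := div_mul_cancel₀ _ hcr.ne'
        rw [smul_sub, smul_smul, this, neg_smul]
        abel
      refine ⟨k + (σ - ev x₀ k) • one, ?_⟩
      have e0 : ev x₀ (k + (σ - ev x₀ k) • one) = σ := by
        simp [hone]
      have e1 : N (k + (σ - ev x₀ k) • one) = k - ev x₀ k • one := by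
        rw [hN, e0, sub_smul]; abel
      rw [hL, e0, e1, map_sub, map_smul, hPone]
      have : P k = q + σ • r + k := by rw [← hk]; abel
      rw [this]; abel
    refine ⟨ContinuousLinearEquiv.ofBijective L ?_ ?_, ?_⟩
    · exact LinearMap.ker_eq_bot'.2 hinj
    · exact LinearMap.range_eq_top.2 hsurj
    · exact ContinuousLinearEquiv.coe_ofBijective ..
  have cdf : ContDiffAt ℝ ω G ((0 : ℝ), (0 : LipFun K)) := hG.contDiffAt
  have hinv : (fderiv ℝ G ((0 : ℝ), (0 : LipFun K)) ∘L .inr ℝ ℝ (LipFun K)).IsInvertible := by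
    rw [hGL]; exact hbij
  let ψ : ℝ → LipFun K := cdf.implicitFunction (by simp) hinv
  have hψ0 : ψ 0 = 0 := cdf.implicitFunction_apply_self (by simp) hinv
  have hψ : ContDiffAt ℝ ω ψ 0 := cdf.contDiffAt_implicitFunction (by simp) hinv
  have hψeq : ∀ᶠ t in 𝓝 (0 : ℝ), G (t, ψ t) = G (0, 0) :=
    cdf.eventually_apply_implicitFunction (by simp) hinv
  have hG0 : G (0, 0) = 0 := by
    have : G (0, 0) = P one - one := by
      simp only [G, zero_smul, NormedSpace.exp_zero, map_zero, mul_zero, neg_zero, Real.exp_zero,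
        one_smul, add_zero, hPapp]
      rfl
    rw [this, hPone, sub_self]
  refine ⟨fun t => ev x₀ (ψ t), ?_, by simp [hψ0], ?_⟩
  · exact ContDiffAt.analyticAt ((ev x₀).contDiff.contDiffAt.comp 0 hψ)
  have hsmall : ∀ᶠ t in 𝓝 (0 : ℝ), ‖N (ψ t)‖ < 1 / 2 := by
    have h1 : ContinuousAt (fun t => ‖N (ψ t)‖) 0 :=
      (N.continuous.continuousAt.comp hψ.continuousAt).norm
    refine h1.eventually_lt continuousAt_const ?_
    simp [hψ0]
  filter_upwards [hψeq, hsmall] with t ht hst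
  refine ⟨fun x => 1 + ev x (N (ψ t)), fun x => ?_, fun x => ?_⟩
  · have := (N (ψ t)).abs_ev_le x
    have := abs_le.1 (this.trans hst.le)
    constructor <;> linarith
  · rw [hG0] at ht
    have h1 := congrArg (ev x) ht
    simp only [G, map_sub, map_sum, map_smul, map_zero, smul_eq_mul] at h1
    rw [map_add, hone] at h1
    rw [← sub_eq_zero, ← h1]
    congr 1
    refine Finset.sum_congr rfl fun j _ => ?_
    rw [apply_exp_of_eigen (fun g => hΦ j g x), hA, map_add, hone, sub_eq_add_neg, Real.exp_add,
      mul_comm (τ j)]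
    ring

end AnalyticFamily

/-! ### The potential on binary sequences -/

section Sequences

/-- `f x = 1 - cos (2πx) = exp (ψ x)`. -/
def wt (x : ℝ) : ℝ := 1 - Real.cos (2 * Real.pi * x)

lemma wt_eq_sin (x : ℝ) : wt x = 2 * Real.sin (Real.pi * x) ^ 2 := by
  rw [wt, show 2 * Real.pi * x = 2 * (Real.pi * x) by ring, Real.cos_two_mul, Real.cos_sq']
  ring

lemma wt_nonneg (x : ℝ) : 0 ≤ wt x := by rw [wt_eq_sin]; positivity

lemma wt_le_two (x : ℝ) : wt x ≤ 2 := by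
  rw [wt]; linarith [Real.neg_one_le_cos (2 * Real.pi * x)]

lemma wt_add_nat (x : ℝ) (n : ℕ) : wt (x + n) = wt x := by
  rw [wt, wt, show 2 * Real.pi * (x + n) = 2 * Real.pi * x + n * (2 * Real.pi) by ring,
    Real.cos_add_nat_mul_two_pi]

lemma wt_one_sub (x : ℝ) : wt (1 - x) = wt x := by
  rw [wt, wt, show 2 * Real.pi * (1 - x) = 2 * Real.pi - 2 * Real.pi * x by ring,
    Real.cos_two_pi_sub]

lemma wt_half_add (x : ℝ) : wt (x / 2) + wt ((1 + x) / 2) = 2 := by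
  rw [wt, wt, show 2 * Real.pi * ((1 + x) / 2) = 2 * Real.pi * (x / 2) + Real.pi by ring,
    Real.cos_add_pi]
  ring

lemma wt_half_mul (x : ℝ) : wt (x / 2) * wt ((1 + x) / 2) = wt x / 2 := by
  rw [wt, wt, wt, show 2 * Real.pi * ((1 + x) / 2) = 2 * Real.pi * (x / 2) + Real.pi by ring,
    Real.cos_add_pi, show 2 * Real.pi * x = 2 * (2 * Real.pi * (x / 2)) by ring, Real.cos_two_mul]
  ring

lemma wt_third : wt (1 / 3) = 3 / 2 := by
  rw [wt, show 2 * Real.pi * (1 / 3) = Real.pi - Real.pi / 3 by ring, Real.cos_pi_sub,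
    Real.cos_pi_div_three]
  norm_num

lemma abs_wt_sub_le (x y : ℝ) : |wt x - wt y| ≤ 2 * Real.pi * |x - y| := by
  rw [wt, wt]
  have h : |Real.cos (2 * Real.pi * x) - Real.cos (2 * Real.pi * y)|
      ≤ |2 * Real.pi * x - 2 * Real.pi * y| := Real.abs_cos_sub_cos_le _ _
  rw [← mul_sub, abs_mul, abs_of_pos (by positivity : 0 < 2 * Real.pi)] at h
  rw [abs_sub_comm] at h
  rwa [sub_sub_sub_cancel_left]

lemma wt_mono {x y : ℝ} (hx : 0 ≤ x) (hxy : x ≤ y) (hy : y ≤ 1 / 2) : wt x ≤ wt y := by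
  rw [wt, wt]
  have := Real.cos_le_cos_of_nonneg_of_le_pi (x := 2 * Real.pi * x) (y := 2 * Real.pi * y)
    (by positivity) (by nlinarith [Real.pi_pos]) (by gcongr)
  linarith

lemma sq_mul_wt_le {c x : ℝ} (hc0 : 0 ≤ c) (hc1 : c ≤ 1) (hx0 : 0 ≤ x) (hx : x ≤ 1 / 2) :
    c ^ 2 * wt x ≤ wt (c * x) := by
  have h1 : c * Real.sin (Real.pi * x) ≤ Real.sin (Real.pi * (c * x)) := by
    have := strictConcaveOn_sin_Icc.concaveOn.2 (x := Real.pi * x) (y := 0)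
      ⟨by positivity, by nlinarith [Real.pi_pos]⟩ ⟨le_rfl, Real.pi_pos.le⟩ hc0 (sub_nonneg.2 hc1)
      (by ring)
    simp only [smul_eq_mul, Real.sin_zero, mul_zero, add_zero] at this
    rwa [show Real.pi * (c * x) = c * (Real.pi * x) by ring]
  have h0 : 0 ≤ Real.sin (Real.pi * x) :=
    Real.sin_nonneg_of_nonneg_of_le_pi (by positivity) (by nlinarith [Real.pi_pos])
  rw [wt_eq_sin, wt_eq_sin]
  have := pow_le_pow_left₀ (mul_nonneg hc0 h0) h1 2
  nlinarith

lemma le_wt {x : ℝ} (hx0 : 0 ≤ x) (hx : x ≤ 1 / 2) : 8 * x ^ 2 ≤ wt x := by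
  have h := sq_mul_wt_le (c := 2 * x) (x := 1 / 2) (by linarith) (by linarith) (by norm_num) le_rfl
  have h2 : wt (1 / 2) = 2 := by
    rw [wt, show 2 * Real.pi * (1 / 2) = Real.pi by ring, Real.cos_pi]; norm_num
  rw [h2, show 2 * x * (1 / 2) = x by ring] at h
  linarith

lemma wt_le (x : ℝ) : wt x ≤ 20 * x ^ 2 := by
  rw [wt_eq_sin]
  have h1 : |Real.sin (Real.pi * x)| ≤ |Real.pi * x| := Real.abs_sin_le_abs
  have h2 := sq_le_sq' (by linarith [neg_abs_le (Real.sin (Real.pi * x)), abs_nonneg (Real.pi * x)])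
    ((le_abs_self _).trans h1)
  rw [sq_abs] at h2
  have h3 : Real.pi ^ 2 ≤ 10 := by nlinarith [Real.pi_lt_d2, Real.pi_pos]
  nlinarith [sq_nonneg x]

/-- The shifted sequence `σⁿ x`. -/
def shift (n : ℕ) (x : BinSeq) : BinSeq := fun i => x (i + n)

/-- The sequence `a y`. -/
def cons (a : Fin 2) (y : BinSeq) : BinSeq
  | 0 => a
  | i + 1 => y i

@[simp] lemma cons_zero (a : Fin 2) (y : BinSeq) : cons a y 0 = a := rfl

@[simp] lemma cons_succ (a : Fin 2) (y : BinSeq) (i : ℕ) : cons a y (i + 1) = y i := rfl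

@[simp] lemma shift_zero (x : BinSeq) : shift 0 x = x := rfl

lemma shift_shift (m n : ℕ) (x : BinSeq) : shift m (shift n x) = shift (m + n) x := by
  funext i; simp [shift, add_assoc]

@[simp] lemma shift_succ_cons (a : Fin 2) (y : BinSeq) (n : ℕ) :
    shift (n + 1) (cons a y) = shift n y := rfl

lemma cons_shift (x : BinSeq) : cons (x 0) (shift 1 x) = x := by
  funext i; cases i <;> rfl

lemma fin2_ne_iff {a b : Fin 2} : a ≠ b ↔ a = 1 - b := by decide +revert

/-- The number `∑ x_i 2^{-i-1}` represented by `x`. -/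
def val (x : BinSeq) : ℝ := Real.ofDigits x

lemma val_nonneg (x : BinSeq) : 0 ≤ val x := Real.ofDigits_nonneg x

lemma val_le_one (x : BinSeq) : val x ≤ 1 := Real.ofDigits_le_one x

lemma val_cons (a : Fin 2) (y : BinSeq) : val (cons a y) = ((a : ℕ) + val y) / 2 := by
  have h := Real.ofDigits_eq_sum_add_ofDigits (cons a y) 1
  simp only [Finset.sum_range_one, Real.ofDigitsTerm, pow_one, zero_add, cons_zero] at h
  rw [val, h, val]
  have : (fun i => cons a y (i + 1)) = y := rfl
  rw [this]
  push_cast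
  ring

lemma val_cons_zero (y : BinSeq) : val (cons 0 y) = val y / 2 := by simp [val_cons]

lemma val_cons_one (y : BinSeq) : val (cons 1 y) = (1 + val y) / 2 := by simp [val_cons]

lemma exists_two_pow_mul_val (l : ℕ) (x : BinSeq) :
    ∃ k : ℕ, 2 ^ l * val x = val (shift l x) + k := by
  induction l with
  | zero => exact ⟨0, by simp⟩
  | succ l ih =>
    obtain ⟨k, hk⟩ := ih
    refine ⟨2 * k + (x l : ℕ), ?_⟩
    have h := val_cons (shift l x 0) (shift 1 (shift l x))
    rw [cons_shift, shift_shift, add_comm 1 l] at h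
    have h0 : shift l x 0 = x l := by simp [shift]
    rw [h0] at h
    rw [pow_succ', mul_assoc, hk, h]
    push_cast
    ring

/-- The weight `exp ψ(x) = f(val x)` of a sequence. -/
def sw (x : BinSeq) : ℝ := wt (val x)

lemma sw_nonneg (x : BinSeq) : 0 ≤ sw x := wt_nonneg _

lemma sw_le_two (x : BinSeq) : sw x ≤ 2 := wt_le_two _

lemma sw_cons_add (y : BinSeq) : sw (cons 0 y) + sw (cons 1 y) = 2 := by
  rw [sw, sw, val_cons_zero, val_cons_one, wt_half_add]

lemma sw_cons_mul (y : BinSeq) : sw (cons 0 y) * sw (cons 1 y) = sw y / 2 := by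
  rw [sw, sw, val_cons_zero, val_cons_one, wt_half_mul, sw]

/-- The product `exp ψ_n(x) = ∏_{l < n} f(2^l x)`. -/
def prodWt (n : ℕ) (x : BinSeq) : ℝ := ∏ l ∈ Finset.range n, sw (shift l x)

@[simp] lemma prodWt_zero (x : BinSeq) : prodWt 0 x = 1 := rfl

lemma prodWt_nonneg (n : ℕ) (x : BinSeq) : 0 ≤ prodWt n x :=
  Finset.prod_nonneg fun _ _ => sw_nonneg _

lemma prodWt_le (n : ℕ) (x : BinSeq) : prodWt n x ≤ 2 ^ n :=
  (Finset.prod_le_prod (fun _ _ => sw_nonneg _) fun _ _ => sw_le_two _).trans_eq (by simp)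

lemma prodWt_add (n k : ℕ) (x : BinSeq) : prodWt (n + k) x = prodWt n x * prodWt k (shift n x) := by
  rw [prodWt, Finset.prod_range_add]
  simp only [prodWt, shift_shift, add_comm]

lemma prodWt_succ (n : ℕ) (x : BinSeq) : prodWt (n + 1) x = prodWt n x * sw (shift n x) :=
  Finset.prod_range_succ _ _

lemma prodWt_succ_cons (n : ℕ) (a : Fin 2) (y : BinSeq) :
    prodWt (n + 1) (cons a y) = sw (cons a y) * prodWt n y := by
  rw [prodWt, Finset.prod_range_succ', mul_comm]
  rfl

lemma exp_mul_birkhoffPsi (t : ℝ) (n : ℕ) (x : BinSeq) :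
    EReal.exp ((t : EReal) * birkhoffPsi n (Real.ofDigits x))
      = ENNReal.ofReal (prodWt n x) ^ t := by
  have h1 : ∀ l, psi (2 ^ l * Real.ofDigits x) = ENNReal.log (ENNReal.ofReal (sw (shift l x))) := by
    intro l
    obtain ⟨k, hk⟩ := exists_two_pow_mul_val l x
    rw [psi]
    change ENNReal.log (ENNReal.ofReal (wt (2 ^ l * val x))) = _
    rw [hk, wt_add_nat, sw]
  have h2 : birkhoffPsi n (Real.ofDigits x) = ENNReal.log (ENNReal.ofReal (prodWt n x)) := by
    rw [birkhoffPsi]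
    simp only [h1]
    induction n with
    | zero => simp
    | succ n ih =>
      rw [Finset.sum_range_succ, ih, prodWt_succ, ENNReal.ofReal_mul (prodWt_nonneg _ _),
        ENNReal.log_mul_add]
  rw [h2, ← ENNReal.log_rpow, ENNReal.exp_log]

lemma partitionSum_eq (X : Set BinSeq) (t : ℝ) (n : ℕ) :
    partitionSum X t n
      = ∑ w : Fin n → Fin 2, ⨆ x ∈ cylinder w ∩ X, ENNReal.ofReal (prodWt n x) ^ t := by
  simp only [partitionSum, exp_mul_birkhoffPsi]

/-- The distance of `val x` to the nearest integer: it is `val x` or `1 - val x`, according to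
the first digit. -/
def fold (x : BinSeq) : ℝ := if x 0 = 0 then val x else 1 - val x

lemma wt_fold (x : BinSeq) : wt (fold x) = sw x := by
  unfold fold
  split_ifs
  · rfl
  · rw [wt_one_sub, sw]

lemma fin2_eq_one_of_ne {a : Fin 2} (h : a ≠ 0) : a = 1 := by
  have := fin2_ne_iff.1 h; simpa using this

lemma fold_of_zero {x : BinSeq} (h : x 0 = 0) : fold x = val x := if_pos h

lemma fold_of_one {x : BinSeq} (h : x 0 = 1) : fold x = 1 - val x :=
  if_neg (by rw [h]; decide)

lemma fold_cons_same {a : Fin 2} {y : BinSeq} (h : a = y 0) : fold (cons a y) = fold y / 2 := by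
  by_cases h0 : a = 0
  · rw [fold_of_zero (x := cons a y) h0, fold_of_zero (h ▸ h0), h0, val_cons_zero]
  · have h1 := fin2_eq_one_of_ne h0
    rw [fold_of_one (x := cons a y) h1, fold_of_one (h ▸ h1), h1, val_cons_one]; ring

lemma fold_cons_ne {a : Fin 2} {y : BinSeq} (h : a ≠ y 0) :
    fold (cons a y) = (1 - fold y) / 2 := by
  by_cases h0 : a = 0
  · have h1 : y 0 = 1 := fin2_eq_one_of_ne fun h1 => h (h0.trans h1.symm)
    rw [fold_of_zero (x := cons a y) h0, fold_of_one h1, h0, val_cons_zero]; ring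
  · have h2 := fin2_eq_one_of_ne h0
    have h1 : y 0 = 0 := by
      by_contra h1
      exact h (h2.trans (fin2_eq_one_of_ne h1).symm)
    rw [fold_of_one (x := cons a y) h2, fold_of_zero h1, h2, val_cons_one]; ring

lemma fold_nonneg (x : BinSeq) : 0 ≤ fold x := by
  unfold fold
  split_ifs
  · exact val_nonneg x
  · linarith [val_le_one x]

lemma fold_le_half (x : BinSeq) : fold x ≤ 1 / 2 := by
  rw [← cons_shift x]
  by_cases h : x 0 = shift 1 x 0
  · rw [fold_cons_same h]
    have : fold (shift 1 x) ≤ 1 := by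
      unfold fold
      split_ifs
      · exact val_le_one _
      · linarith [val_nonneg (shift 1 x)]
    linarith
  · rw [fold_cons_ne h]
    linarith [fold_nonneg (shift 1 x)]

lemma fold_eq_of_eq {x : BinSeq} (h : x 0 = x 1) : fold x = fold (shift 1 x) / 2 := by
  conv_lhs => rw [← cons_shift x]
  exact fold_cons_same h

lemma fold_eq_of_ne {x : BinSeq} (h : x 0 ≠ x 1) : fold x = (1 - fold (shift 1 x)) / 2 := by
  conv_lhs => rw [← cons_shift x]
  exact fold_cons_ne h

/-- An initial run of length at least `k` forces `val x` to be `2^{-k}`-close to an integer. -/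
lemma fold_le_of_run {k : ℕ} {x : BinSeq} (h : ∀ i < k, x i = x 0) : fold x ≤ (1 / 2) ^ k := by
  induction k generalizing x with
  | zero => simpa using (fold_le_half x).trans (by norm_num)
  | succ k ih =>
    rcases k with _ | k
    · simpa using fold_le_half x
    · have h1 := h 1 (by omega)
      rw [fold_eq_of_eq h1.symm, pow_succ]
      have := ih (x := shift 1 x) fun i hi => by
        simp only [shift, zero_add]
        rw [h (i + 1) (by omega), h1]
      linarith

/-- The first run of `x` ends before the index `k`. -/
lemma le_fold_of_ne {k : ℕ} {x : BinSeq} (h : x k ≠ x 0) : (1 / 2 : ℝ) ^ (k + 1) ≤ fold x := by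
  induction k generalizing x with
  | zero => exact absurd rfl h
  | succ k ih =>
    by_cases h1 : x 0 = x 1
    · rw [fold_eq_of_eq h1, pow_succ]
      have := ih (x := shift 1 x) (by simpa [shift, ← h1] using h)
      linarith
    · rw [fold_eq_of_ne h1]
      have : (1 / 2 : ℝ) ^ (k + 1 + 1) ≤ (1 / 2) ^ 2 :=
        pow_le_pow_of_le_one (by norm_num) (by norm_num) (by omega)
      have := fold_le_half (shift 1 x)
      linarith

lemma abs_fold_sub_le {n : ℕ} (hn : 0 < n) {x y : BinSeq} (h : ∀ i < n, x i = y i) :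
    |fold x - fold y| ≤ (1 / 2) ^ n := by
  have h1 : |val x - val y| ≤ (1 / 2) ^ n := by
    have := Real.abs_ofDigits_sub_ofDigits_le h
    simpa [val] using this
  unfold fold
  rw [← h 0 hn]
  split_ifs
  · exact h1
  · rw [sub_sub_sub_cancel_left, abs_sub_comm]; exact h1

/-- The alternating sequence starting with `a`, which represents `1/3` or `2/3`. -/
def alt (a : Fin 2) : BinSeq := fun i => Fin.ofNat 2 (a + i)

lemma shift_alt (n : ℕ) (a : Fin 2) : ∃ b, shift n (alt a) = alt b := by
  refine ⟨Fin.ofNat 2 (a + n), ?_⟩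
  funext i
  apply Fin.ext
  simp only [shift, alt, Fin.val_ofNat]
  omega

lemma alt_zero (a : Fin 2) : alt a 0 = a := by
  apply Fin.ext; simp only [alt, Fin.val_ofNat]; omega

lemma alt_ne (a : Fin 2) (i : ℕ) : alt a i ≠ alt a (i + 1) := by
  rw [Ne, Fin.ext_iff]; simp only [alt, Fin.val_ofNat]; omega

lemma fold_alt (a : Fin 2) : fold (alt a) = 1 / 3 := by
  have h : ∀ n, fold (shift n (alt a)) = (1 - fold (shift (n + 1) (alt a))) / 2 := by
    intro n
    rw [fold_eq_of_ne, shift_shift, add_comm]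
    obtain ⟨b, hb⟩ := shift_alt n a
    rw [hb]; exact alt_ne b 0
  have h0 := h 0
  have h1 := h 1
  have h2 : shift 2 (alt a) = shift 0 (alt a) := by
    funext i
    apply Fin.ext
    simp only [shift, alt, Fin.val_ofNat]
    omega
  rw [h2] at h1
  rw [shift_zero] at h0 h1
  simp only [zero_add] at h0
  linarith

lemma sw_alt (a : Fin 2) : sw (alt a) = 3 / 2 := by rw [← wt_fold, fold_alt, wt_third]

lemma prodWt_alt (n : ℕ) (a : Fin 2) : prodWt n (alt a) = (3 / 2) ^ n := by
  have : ∀ l, sw (shift l (alt a)) = 3 / 2 := fun l => by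
    obtain ⟨b, hb⟩ := shift_alt l a
    rw [hb, sw_alt]
  rw [prodWt, Finset.prod_congr rfl fun l _ => this l, Finset.prod_const, Finset.card_range]

lemma shift_mem_subshift {m n : ℕ} {x : BinSeq} (hx : x ∈ subshift m) : shift n x ∈ subshift m := by
  intro l a h
  exact hx (l + n) a fun i hi => by rw [← h i hi, shift]; congr 1; omega

lemma alt_mem_subshift {m : ℕ} (hm : 1 ≤ m) (a : Fin 2) : alt a ∈ subshift m := fun l _ h =>
  alt_ne a l ((h 0 (by omega)).trans (h 1 hm).symm)

lemma subshift_mono {m m' : ℕ} (h : m ≤ m') : subshift m ⊆ subshift m' :=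
  fun _ hx l a H => hx l a fun i hi => H i (hi.trans h)

lemma le_fold_of_mem_subshift {m : ℕ} {x : BinSeq} (hx : x ∈ subshift m) :
    (1 / 2 : ℝ) ^ (m + 1) ≤ fold x := by
  have := hx 0 (x 0)
  push Not at this
  obtain ⟨i, hi, h⟩ := this
  rw [zero_add] at h
  refine le_trans (pow_le_pow_of_le_one (by norm_num) (by norm_num) ?_) (le_fold_of_ne h)
  omega

/-- A positive lower bound of the weight on the subshift `𝕏_m`. -/
def minWt (m : ℕ) : ℝ := 8 * ((1 / 2) ^ (m + 1)) ^ 2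

lemma minWt_pos (m : ℕ) : 0 < minWt m := by unfold minWt; positivity

lemma minWt_le_wt {m : ℕ} {u : ℝ} (h : (1 / 2 : ℝ) ^ (m + 1) ≤ u) (hu : u ≤ 1 / 2) :
    minWt m ≤ wt u := by
  have h0 : (0 : ℝ) ≤ (1 / 2) ^ (m + 1) := by positivity
  refine le_trans ?_ (le_wt (h0.trans h) hu)
  unfold minWt
  gcongr

lemma minWt_le_sw {m : ℕ} {x : BinSeq} (hx : x ∈ subshift m) : minWt m ≤ sw x := by
  rw [← wt_fold]; exact minWt_le_wt (le_fold_of_mem_subshift hx) (fold_le_half x)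

lemma sw_pos {m : ℕ} {x : BinSeq} (hx : x ∈ subshift m) : 0 < sw x :=
  (minWt_pos m).trans_le (minWt_le_sw hx)

lemma prodWt_pos {m : ℕ} {x : BinSeq} (hx : x ∈ subshift m) (n : ℕ) : 0 < prodWt n x :=
  Finset.prod_pos fun _ _ => sw_pos (shift_mem_subshift hx)

lemma minWt_pow_le {m : ℕ} {x : BinSeq} (hx : x ∈ subshift m) (n : ℕ) :
    minWt m ^ n ≤ prodWt n x := by
  calc minWt m ^ n = ∏ _l ∈ Finset.range n, minWt m := by simp
    _ ≤ _ := Finset.prod_le_prod (fun _ _ => (minWt_pos m).le)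
      fun l _ => minWt_le_sw (shift_mem_subshift hx)

end Sequences

/-! ### Existence and convexity of the pressure -/

section Pressure

open scoped ENNReal

lemma shift_mem_cylinder_append {n k : ℕ} {w : Fin n → Fin 2} {v : Fin k → Fin 2} {x : BinSeq}
    (hx : x ∈ cylinder (Fin.append w v)) : x ∈ cylinder w ∧ shift n x ∈ cylinder v := by
  refine ⟨fun i => ?_, fun i => ?_⟩
  · have := hx (Fin.castAdd k i)
    rwa [Fin.append_left, Fin.val_castAdd] at this
  · have := hx (Fin.natAdd n i)
    rwa [Fin.append_right, Fin.val_natAdd, add_comm] at this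

lemma partitionSum_add_le {X : Set BinSeq} (hX : ∀ n, ∀ x ∈ X, shift n x ∈ X) (t : ℝ) (n k : ℕ) :
    partitionSum X t (n + k) ≤ partitionSum X t n * partitionSum X t k := by
  rw [partitionSum_eq, partitionSum_eq, partitionSum_eq, Finset.sum_mul_sum,
    ← Finset.sum_product', ← (Fin.appendEquiv n k).sum_comp]
  refine Finset.sum_le_sum fun wv _ => iSup₂_le fun x hx => ?_
  obtain ⟨h1, h2⟩ := shift_mem_cylinder_append hx.1
  rw [prodWt_add, ENNReal.ofReal_mul (prodWt_nonneg _ _),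
    ENNReal.mul_rpow_of_ne_top ENNReal.ofReal_ne_top ENNReal.ofReal_ne_top]
  exact mul_le_mul' (le_iSup₂_of_le (f := fun x _ => ENNReal.ofReal (prodWt n x) ^ t) x
    ⟨h1, hx.2⟩ le_rfl) (le_iSup₂_of_le (f := fun x _ => ENNReal.ofReal (prodWt k x) ^ t) _
    ⟨h2, hX n x hx.2⟩ le_rfl)

lemma le_partitionSum {X : Set BinSeq} {x : BinSeq} (hx : x ∈ X) (t : ℝ) (n : ℕ) :
    ENNReal.ofReal (prodWt n x) ^ t ≤ partitionSum X t n := by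
  rw [partitionSum_eq]
  refine le_trans ?_ (Finset.single_le_sum (fun _ _ => zero_le)
    (Finset.mem_univ fun i : Fin n => x i))
  exact le_iSup₂_of_le (f := fun x _ => ENNReal.ofReal (prodWt n x) ^ t) x
    ⟨fun _ => rfl, hx⟩ le_rfl

lemma partitionSum_mono {X Y : Set BinSeq} (h : X ⊆ Y) (t : ℝ) (n : ℕ) :
    partitionSum X t n ≤ partitionSum Y t n := by
  rw [partitionSum_eq, partitionSum_eq]
  exact Finset.sum_le_sum fun w _ => biSup_mono fun x hx => ⟨hx.1, h hx.2⟩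

lemma partitionSum_le_of_forall {X : Set BinSeq} {t : ℝ} {n : ℕ} {A : ℝ≥0∞}
    (h : ∀ x ∈ X, ENNReal.ofReal (prodWt n x) ^ t ≤ A) : partitionSum X t n ≤ 2 ^ n * A := by
  rw [partitionSum_eq]
  calc _ ≤ ∑ _w : Fin n → Fin 2, A := Finset.sum_le_sum fun w _ => iSup₂_le fun x hx => h x hx.2
    _ = _ := by simp

/-- The partition sum as a real number. -/
def realSum (X : Set BinSeq) (t : ℝ) (n : ℕ) : ℝ := (partitionSum X t n).toReal

/-- `𝒫(tψ | X)` is well defined and equal to the real number `P`. -/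
structure HasPressure (X : Set BinSeq) (t P : ℝ) : Prop where
  ne_zero : ∀ n, partitionSum X t n ≠ 0
  ne_top : ∀ n, partitionSum X t n ≠ ⊤
  tendsto : Tendsto (fun n : ℕ => Real.log (realSum X t n) / n) atTop (𝓝 P)

namespace HasPressure

variable {X Y : Set BinSeq} {s t P Q : ℝ}

lemma pos (h : HasPressure X t P) (n : ℕ) : 0 < realSum X t n :=
  ENNReal.toReal_pos (h.ne_zero n) (h.ne_top n)

lemma ofReal_realSum (h : HasPressure X t P) (n : ℕ) :
    ENNReal.ofReal (realSum X t n) = partitionSum X t n := ENNReal.ofReal_toReal (h.ne_top n)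

lemma tendsto_pressureSeq (h : HasPressure X t P) :
    Tendsto (pressureSeq X t) atTop (𝓝 (P : EReal)) := by
  refine (continuous_coe_real_ereal.tendsto P |>.comp h.tendsto).congr fun n => ?_
  simp only [Function.comp, pressureSeq]
  rw [ENNReal.log_pos_real (h.ne_zero n) (h.ne_top n), EReal.coe_div]
  rfl

lemma restrictedPressure_eq (h : HasPressure X t P) : restrictedPressure X t = P :=
  h.tendsto_pressureSeq.limUnder_eq

/-- Upper bounds of the partition sums along the multiples of `d`. -/
lemma le_of_forall (h : HasPressure X t P) {d : ℕ} (hd : 0 < d) {A ρ : ℝ} (hA : 0 < A) (hρ : 0 < ρ)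
    (H : ∀ k : ℕ, realSum X t (d * k) ≤ A * ρ ^ k) : P ≤ Real.log ρ / d := by
  have hd' : Tendsto (fun k : ℕ => d * k) atTop atTop := tendsto_id.const_mul_atTop' hd
  have h1 := h.tendsto.comp hd'
  have h2 : Tendsto (fun k : ℕ => Real.log A / d / k + Real.log ρ / d) atTop
      (𝓝 (0 + Real.log ρ / d)) := (tendsto_const_div_atTop_nhds_zero_nat _).add_const _
  rw [zero_add] at h2
  refine le_of_tendsto_of_tendsto h1 h2 ?_
  filter_upwards [eventually_gt_atTop 0] with k hk
  have hk' : (0 : ℝ) < k := by exact_mod_cast hk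
  have hd'' : (0 : ℝ) < d := by exact_mod_cast hd
  have h3 := Real.log_le_log (h.pos _) (H k)
  rw [Real.log_mul hA.ne' (by positivity), Real.log_pow] at h3
  simp only [Function.comp]
  rw [div_le_iff₀ (by positivity)]
  push_cast
  have : (Real.log A / d / k + Real.log ρ / d) * (d * k) = Real.log A + k * Real.log ρ := by
    field_simp
  linarith

/-- Lower bounds of the partition sums along the multiples of `d`. -/
lemma ge_of_forall (h : HasPressure X t P) {d : ℕ} (hd : 0 < d) {A ρ : ℝ} (hA : 0 < A) (hρ : 0 < ρ)
    (H : ∀ k : ℕ, A * ρ ^ k ≤ realSum X t (d * k)) : Real.log ρ / d ≤ P := by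
  have hd' : Tendsto (fun k : ℕ => d * k) atTop atTop := tendsto_id.const_mul_atTop' hd
  have h1 := h.tendsto.comp hd'
  have h2 : Tendsto (fun k : ℕ => Real.log A / d / k + Real.log ρ / d) atTop
      (𝓝 (0 + Real.log ρ / d)) := (tendsto_const_div_atTop_nhds_zero_nat _).add_const _
  rw [zero_add] at h2
  refine le_of_tendsto_of_tendsto h2 h1 ?_
  filter_upwards [eventually_gt_atTop 0] with k hk
  have hk' : (0 : ℝ) < k := by exact_mod_cast hk
  have hd'' : (0 : ℝ) < d := by exact_mod_cast hd
  have h3 := Real.log_le_log (by positivity) (H k)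
  rw [Real.log_mul hA.ne' (by positivity), Real.log_pow] at h3
  simp only [Function.comp]
  rw [le_div_iff₀ (by positivity)]
  push_cast
  have : (Real.log A / d / k + Real.log ρ / d) * (d * k) = Real.log A + k * Real.log ρ := by
    field_simp
  linarith

lemma le_of_subset (h : HasPressure X t P) (h' : HasPressure Y t Q) (hXY : X ⊆ Y) : P ≤ Q := by
  refine le_of_tendsto_of_tendsto' h.tendsto h'.tendsto fun n => ?_
  gcongr
  · exact h.pos n
  · exact ENNReal.toReal_mono (h'.ne_top n) (partitionSum_mono hXY t n)

/-- Convexity of the pressure, by Hölder's inequality for the partition sums. -/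
lemma convex {R a b : ℝ} (h : HasPressure X s P) (h' : HasPressure X t Q) (ha : 0 < a) (hb : 0 < b)
    (hab : a + b = 1) (h'' : HasPressure X (a * s + b * t) R) : R ≤ a * P + b * Q := by
  have key : ∀ n, partitionSum X (a * s + b * t) n
      ≤ partitionSum X s n ^ a * partitionSum X t n ^ b := by
    intro n
    have hpq : a⁻¹.HolderConjugate b⁻¹ :=
      (Real.holderConjugate_iff).2 ⟨(one_lt_inv₀ ha).2 (by linarith), by simpa using hab⟩
    set F : ℝ → (Fin n → Fin 2) → ℝ≥0∞ := fun s w =>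
      ⨆ x ∈ cylinder w ∩ X, ENNReal.ofReal (prodWt n x) ^ s with hF
    have hHol := ENNReal.inner_le_Lp_mul_Lq Finset.univ (fun w => F s w ^ a) (fun w => F t w ^ b) hpq
    simp only [← ENNReal.rpow_mul, mul_inv_cancel₀ ha.ne', mul_inv_cancel₀ hb.ne',
      ENNReal.rpow_one, one_div, inv_inv] at hHol
    rw [partitionSum_eq, partitionSum_eq, partitionSum_eq]
    refine le_trans (Finset.sum_le_sum fun w _ => iSup₂_le fun x hx => ?_) hHol
    have e : ENNReal.ofReal (prodWt n x) ^ (a * s + b * t) ≤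
        (ENNReal.ofReal (prodWt n x) ^ s) ^ a * (ENNReal.ofReal (prodWt n x) ^ t) ^ b := by
      rw [← ENNReal.rpow_mul, ← ENNReal.rpow_mul, mul_comm s, mul_comm t]
      rcases eq_or_ne (ENNReal.ofReal (prodWt n x)) 0 with h0 | h0
      -- at a zero of the weight, finiteness of the partition sums forces `s, t ≥ 0`
      · have hs : ENNReal.ofReal (prodWt n x) ^ s ≠ ⊤ := fun hs => h.ne_top n
          (top_le_iff.1 (hs ▸ le_partitionSum hx.2 s n))
        have ht : ENNReal.ofReal (prodWt n x) ^ t ≠ ⊤ := fun ht => h'.ne_top n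
          (top_le_iff.1 (ht ▸ le_partitionSum hx.2 t n))
        rw [h0] at hs ht ⊢
        have hs0 : 0 ≤ s := by
          by_contra! hs'; exact hs (ENNReal.zero_rpow_of_neg hs')
        have ht0 : 0 ≤ t := by
          by_contra! ht'; exact ht (ENNReal.zero_rpow_of_neg ht')
        rw [ENNReal.rpow_add_of_nonneg _ _ (by positivity) (by positivity)]
      · rw [ENNReal.rpow_add _ _ h0 ENNReal.ofReal_ne_top]
    refine e.trans (mul_le_mul' ?_ ?_)
    · exact ENNReal.rpow_le_rpow (le_iSup₂_of_le
        (f := fun x _ => ENNReal.ofReal (prodWt n x) ^ s) x hx le_rfl) ha.le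
    · exact ENNReal.rpow_le_rpow (le_iSup₂_of_le
        (f := fun x _ => ENNReal.ofReal (prodWt n x) ^ t) x hx le_rfl) hb.le
  refine le_of_tendsto_of_tendsto' h''.tendsto
    ((h.tendsto.const_mul a).add (h'.tendsto.const_mul b)) fun n => ?_
  rw [← mul_div_assoc, ← mul_div_assoc, ← add_div]
  gcongr
  have h1 : realSum X (a * s + b * t) n ≤ realSum X s n ^ a * realSum X t n ^ b := by
    have := ENNReal.toReal_mono (ENNReal.mul_ne_top
      (ENNReal.rpow_ne_top_of_nonneg ha.le (h.ne_top n))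
      (ENNReal.rpow_ne_top_of_nonneg hb.le (h'.ne_top n))) (key n)
    rwa [ENNReal.toReal_mul, ← ENNReal.toReal_rpow, ← ENNReal.toReal_rpow] at this
  have h2 := Real.log_le_log (h''.pos n) h1
  rwa [Real.log_mul (Real.rpow_pos_of_pos (h.pos n) _).ne'
    (Real.rpow_pos_of_pos (h'.pos n) _).ne', Real.log_rpow (h.pos n), Real.log_rpow (h'.pos n)] at h2

end HasPressure

/-- Fekete's lemma for the partition sums of a shift invariant set. -/
lemma exists_hasPressure {X : Set BinSeq} (hX : ∀ n, ∀ x ∈ X, shift n x ∈ X) {t c C : ℝ}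
    (hc : 0 < c) (h1 : ∀ n, ENNReal.ofReal (c ^ n) ≤ partitionSum X t n)
    (h2 : ∀ n, partitionSum X t n ≤ ENNReal.ofReal (C ^ n)) :
    ∃ P, HasPressure X t P := by
  have hne0 : ∀ n, partitionSum X t n ≠ 0 := fun n =>
    ((ENNReal.ofReal_pos.2 (pow_pos hc n)).trans_le (h1 n)).ne'
  have hnet : ∀ n, partitionSum X t n ≠ ⊤ := fun n =>
    ((h2 n).trans_lt ENNReal.ofReal_lt_top).ne
  have hpos : ∀ n, 0 < realSum X t n := fun n => ENNReal.toReal_pos (hne0 n) (hnet n)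
  have hsub : Subadditive fun n => Real.log (realSum X t n) := by
    intro n k
    rw [← Real.log_mul (hpos n).ne' (hpos k).ne']
    refine Real.log_le_log (hpos _) ?_
    rw [realSum, realSum, realSum, ← ENNReal.toReal_mul]
    exact ENNReal.toReal_mono (ENNReal.mul_ne_top (hnet n) (hnet k)) (partitionSum_add_le hX t n k)
  refine ⟨hsub.lim, hne0, hnet, hsub.tendsto_lim ⟨min 0 (Real.log c), ?_⟩⟩
  rintro _ ⟨n, rfl⟩
  rcases Nat.eq_zero_or_pos n with rfl | hn
  · simp
  · have h3 : c ^ n ≤ realSum X t n := (ENNReal.ofReal_le_iff_le_toReal (hnet n)).1 (h1 n)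
    have h4 := Real.log_le_log (pow_pos hc n) h3
    rw [Real.log_pow] at h4
    refine (min_le_right _ _).trans ?_
    rw [le_div_iff₀ (by exact_mod_cast hn)]
    linarith

lemma ofReal_rpow_prodWt {t : ℝ} (ht : 0 ≤ t) (n : ℕ) (x : BinSeq) :
    ENNReal.ofReal (prodWt n x) ^ t = ENNReal.ofReal (prodWt n x ^ t) :=
  ENNReal.ofReal_rpow_of_nonneg (prodWt_nonneg n x) ht

lemma ofReal_le_partitionSum {X : Set BinSeq} {a : Fin 2} (ha : alt a ∈ X) (t : ℝ) (n : ℕ) :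
    ENNReal.ofReal (((3 / 2 : ℝ) ^ t) ^ n) ≤ partitionSum X t n := by
  refine le_trans (le_of_eq ?_) (le_partitionSum ha t n)
  rw [prodWt_alt, ENNReal.ofReal_rpow_of_pos (by positivity), ← Real.rpow_natCast,
    ← Real.rpow_natCast, ← Real.rpow_mul (by norm_num), ← Real.rpow_mul (by norm_num), mul_comm]

lemma exists_hasPressure_univ {t : ℝ} (ht : 0 ≤ t) : ∃ P, HasPressure Set.univ t P := by
  refine exists_hasPressure (fun _ _ _ => Set.mem_univ _) (c := (3 / 2 : ℝ) ^ t)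
    (C := 2 * 2 ^ t) (by positivity) (ofReal_le_partitionSum (a := 0) (Set.mem_univ _) t)
    fun n => ?_
  refine (partitionSum_le_of_forall (A := ENNReal.ofReal ((2 ^ t) ^ n)) fun x _ => ?_).trans_eq ?_
  · rw [ofReal_rpow_prodWt ht]
    refine ENNReal.ofReal_le_ofReal ((Real.rpow_le_rpow (prodWt_nonneg n x) (prodWt_le n x)
      ht).trans_eq ?_)
    rw [← Real.rpow_natCast, ← Real.rpow_natCast, ← Real.rpow_mul (by norm_num),
      ← Real.rpow_mul (by norm_num), mul_comm]
  · rw [mul_pow, ENNReal.ofReal_mul (by positivity), ENNReal.ofReal_pow two_pos.le,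
      ENNReal.ofReal_ofNat]

/-- Bounds of the powers of a number that lies between two powers. -/
lemma rpow_le_max_pow {m M y t : ℝ} (hm : 0 < m) (n : ℕ) (h1 : m ^ n ≤ y) (h2 : y ≤ M ^ n)
    (hM : 0 < M) : y ^ t ≤ (max (m ^ t) (M ^ t)) ^ n := by
  have hy : 0 < y := (pow_pos hm n).trans_le h1
  have e : ∀ z : ℝ, 0 < z → (z ^ n) ^ t = (z ^ t) ^ n := fun z hz => by
    rw [← Real.rpow_natCast, ← Real.rpow_natCast, ← Real.rpow_mul hz.le, ← Real.rpow_mul hz.le,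
      mul_comm]
  rcases le_total 0 t with ht | ht
  · refine (Real.rpow_le_rpow hy.le h2 ht).trans ?_
    rw [e M hM]
    exact pow_le_pow_left₀ (by positivity) (le_max_right _ _) n
  · refine (Real.rpow_le_rpow_of_nonpos (pow_pos hm n) h1 ht).trans ?_
    rw [e m hm]
    exact pow_le_pow_left₀ (by positivity) (le_max_left _ _) n

lemma exists_hasPressure_subshift {m : ℕ} (hm : 1 ≤ m) (t : ℝ) :
    ∃ P, HasPressure (subshift m) t P := by
  refine exists_hasPressure (fun _ _ hx => shift_mem_subshift hx) (c := (3 / 2 : ℝ) ^ t)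
    (C := 2 * max (minWt m ^ t) (2 ^ t)) (by positivity)
    (ofReal_le_partitionSum (alt_mem_subshift hm 0) t) fun n => ?_
  refine (partitionSum_le_of_forall (A := ENNReal.ofReal ((max (minWt m ^ t) (2 ^ t)) ^ n))
    fun x hx => ?_).trans_eq ?_
  · rw [ENNReal.ofReal_rpow_of_pos (prodWt_pos hx n)]
    exact ENNReal.ofReal_le_ofReal (rpow_le_max_pow (minWt_pos m) n (minWt_pow_le hx n)
      (prodWt_le n x) two_pos)
  · rw [mul_pow, ENNReal.ofReal_mul (by positivity), ENNReal.ofReal_pow two_pos.le,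
      ENNReal.ofReal_ofNat]

/-- The real value of the pressure `p_m(t)`. -/
def approxP (m : ℕ) (t : ℝ) : ℝ := (pressureApprox m t).toReal

/-- The real value of the pressure `p(t)`, meaningful only for `t ≥ 0`: for `t < 0`, where
`p(t) = ⊤`, it is `0`. -/
def fullP (t : ℝ) : ℝ := (pressure t).toReal

lemma hasPressure_approxP {m : ℕ} (hm : 1 ≤ m) (t : ℝ) :
    HasPressure (subshift m) t (approxP m t) := by
  obtain ⟨P, hP⟩ := exists_hasPressure_subshift hm t
  have : approxP m t = P := by
    rw [approxP, pressureApprox, hP.restrictedPressure_eq, EReal.toReal_coe]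
  rwa [this]

lemma hasPressure_fullP {t : ℝ} (ht : 0 ≤ t) : HasPressure Set.univ t (fullP t) := by
  obtain ⟨P, hP⟩ := exists_hasPressure_univ ht
  have : fullP t = P := by
    rw [fullP, pressure, hP.restrictedPressure_eq, EReal.toReal_coe]
  rwa [this]

lemma pressureApprox_eq {m : ℕ} (hm : 1 ≤ m) (t : ℝ) : pressureApprox m t = approxP m t :=
  (hasPressure_approxP hm t).restrictedPressure_eq

lemma pressure_eq {t : ℝ} (ht : 0 ≤ t) : pressure t = fullP t :=
  (hasPressure_fullP ht).restrictedPressure_eq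

lemma tendsto_pressureSeq_of_neg {t : ℝ} (ht : t < 0) :
    Tendsto (pressureSeq Set.univ t) atTop (𝓝 ⊤) := by
  refine tendsto_const_nhds.congr' ?_
  filter_upwards [eventually_gt_atTop 0] with n hn
  have h0 : prodWt n (fun _ => 0) = 0 := by
    refine Finset.prod_eq_zero (Finset.mem_range.2 hn) ?_
    have hv : val (fun _ => 0) = 0 := by simp [val, Real.ofDigits, Real.ofDigitsTerm]
    rw [shift_zero, sw, hv, wt]; simp
  have h1 : partitionSum Set.univ t n = ⊤ := by
    have := le_partitionSum (Set.mem_univ (fun _ : ℕ => (0 : Fin 2))) t n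
    rw [h0, ENNReal.ofReal_zero, ENNReal.zero_rpow_of_neg ht] at this
    exact top_le_iff.1 this
  rw [pressureSeq, h1, ENNReal.log_top, EReal.top_div_of_pos_ne_top (by exact_mod_cast hn)
    (EReal.natCast_ne_top n)]

lemma pressure_of_neg {t : ℝ} (ht : t < 0) : pressure t = ⊤ :=
  (tendsto_pressureSeq_of_neg ht).limUnder_eq

end Pressure

/-! ### The transfer operator on sequences -/

section LetterOperator

open scoped ENNReal

/-- The concatenation of a finite word and a sequence. -/
def prep {n : ℕ} (w : Fin n → Fin 2) (y : BinSeq) : BinSeq :=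
  fun i => if h : i < n then w ⟨i, h⟩ else y (i - n)

lemma prep_of_lt {n i : ℕ} (w : Fin n → Fin 2) (y : BinSeq) (h : i < n) :
    prep w y i = w ⟨i, h⟩ := dif_pos h

lemma prep_of_ge {n i : ℕ} (w : Fin n → Fin 2) (y : BinSeq) (h : n ≤ i) :
    prep w y i = y (i - n) := dif_neg (not_lt.2 h)

lemma prep_mem_cylinder {n : ℕ} (w : Fin n → Fin 2) (y : BinSeq) : prep w y ∈ cylinder w :=
  fun i => prep_of_lt w y i.2

lemma prep_zero (w : Fin 0 → Fin 2) (y : BinSeq) : prep w y = y := by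
  funext i; rw [prep_of_ge _ _ (Nat.zero_le i), Nat.sub_zero]

lemma prep_cons {n : ℕ} (a : Fin 2) (w : Fin n → Fin 2) (y : BinSeq) :
    prep (Fin.cons a w : Fin (n + 1) → Fin 2) y = cons a (prep w y) := by
  funext i
  cases i with
  | zero => rw [prep_of_lt _ _ (by omega)]; rfl
  | succ i =>
    rw [cons_succ]
    by_cases h : i < n
    · rw [prep_of_lt _ _ h, prep_of_lt _ _ (by omega : i + 1 < n + 1)]; rfl
    · rw [prep_of_ge _ _ (by omega), prep_of_ge _ _ (by omega), Nat.add_sub_add_right]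

lemma sum_words_succ {M : Type*} [AddCommMonoid M] {n : ℕ} (F : (Fin (n + 1) → Fin 2) → M) :
    ∑ w, F w = ∑ w : Fin n → Fin 2, ∑ a : Fin 2, F (Fin.cons a w) := by
  rw [← (Fin.consEquiv fun _ => Fin 2).sum_comp, Fintype.sum_prod_type_right]
  rfl

/-- The transfer operator of `tψ` on functions of sequences in `X`: it sums over the preimages
of a sequence under the shift that lie in `X`. -/
def letterOp (X : Set BinSeq) (t : ℝ) (H : BinSeq → ℝ) (y : BinSeq) : ℝ :=
  ∑ a : Fin 2, X.indicator (fun z => sw z ^ t * H z) (cons a y)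

variable {X : Set BinSeq} {t : ℝ}

lemma letterOp_mono {H G : BinSeq → ℝ} (h : ∀ y ∈ X, H y ≤ G y) (y : BinSeq) :
    letterOp X t H y ≤ letterOp X t G y := by
  refine Finset.sum_le_sum fun a _ => ?_
  by_cases hy : cons a y ∈ X
  · rw [Set.indicator_of_mem hy, Set.indicator_of_mem hy]
    exact mul_le_mul_of_nonneg_left (h _ hy) (Real.rpow_nonneg (sw_nonneg _) _)
  · rw [Set.indicator_of_notMem hy, Set.indicator_of_notMem hy]

lemma letterOp_const_mul (c : ℝ) (H : BinSeq → ℝ) :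
    letterOp X t (fun z => c * H z) = fun y => c * letterOp X t H y := by
  funext y
  simp only [letterOp, Finset.mul_sum]
  refine Finset.sum_congr rfl fun a _ => ?_
  by_cases hy : cons a y ∈ X
  · rw [Set.indicator_of_mem hy, Set.indicator_of_mem hy]; ring
  · rw [Set.indicator_of_notMem hy, Set.indicator_of_notMem hy, mul_zero]

lemma iterate_letterOp_const_mul (n : ℕ) (c : ℝ) (H : BinSeq → ℝ) :
    (letterOp X t)^[n] (fun z => c * H z) = fun y => c * (letterOp X t)^[n] H y := by
  induction n generalizing H with
  | zero => rfl
  | succ n ih => rw [Function.iterate_succ_apply, letterOp_const_mul, ih]; rfl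

lemma iterate_letterOp_mono {H G : BinSeq → ℝ} (h : ∀ y ∈ X, H y ≤ G y) (n : ℕ) :
    ∀ y ∈ X, (letterOp X t)^[n] H y ≤ (letterOp X t)^[n] G y := by
  induction n with
  | zero => exact h
  | succ n ih =>
    intro y _
    rw [Function.iterate_succ_apply', Function.iterate_succ_apply']
    exact letterOp_mono ih y

lemma iterate_letterOp_le {H : BinSeq → ℝ} {ρ : ℝ} (hρ : 0 ≤ ρ)
    (h : ∀ y ∈ X, letterOp X t H y ≤ ρ * H y) (n : ℕ) :
    ∀ y ∈ X, (letterOp X t)^[n] H y ≤ ρ ^ n * H y := by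
  induction n with
  | zero => intro y _; simp
  | succ n ih =>
    intro y hy
    rw [Function.iterate_succ_apply]
    refine (iterate_letterOp_mono h n y hy).trans ?_
    rw [iterate_letterOp_const_mul, pow_succ', mul_assoc]
    exact mul_le_mul_of_nonneg_left (ih y hy) hρ

lemma le_iterate_letterOp {H : BinSeq → ℝ} {ρ : ℝ} (hρ : 0 ≤ ρ)
    (h : ∀ y ∈ X, ρ * H y ≤ letterOp X t H y) (n : ℕ) :
    ∀ y ∈ X, ρ ^ n * H y ≤ (letterOp X t)^[n] H y := by
  induction n with
  | zero => intro y _; simp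
  | succ n ih =>
    intro y hy
    rw [Function.iterate_succ_apply]
    refine le_trans ?_ (iterate_letterOp_mono h n y hy)
    rw [iterate_letterOp_const_mul, pow_succ', mul_assoc]
    exact mul_le_mul_of_nonneg_left (ih y hy) hρ

lemma iterate_letterOp_eq_sum (hX : ∀ n, ∀ x ∈ X, shift n x ∈ X) (n : ℕ) (H : BinSeq → ℝ)
    {y : BinSeq} (hy : y ∈ X) :
    (letterOp X t)^[n] H y
      = ∑ w : Fin n → Fin 2, X.indicator (fun z => prodWt n z ^ t * H z) (prep w y) := by
  induction n generalizing H with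
  | zero => simp [prep_zero, hy]
  | succ n ih =>
    rw [Function.iterate_succ_apply, ih, sum_words_succ]
    refine Finset.sum_congr rfl fun w _ => ?_
    simp only [prep_cons]
    by_cases hz : prep w y ∈ X
    · rw [Set.indicator_of_mem hz, letterOp, Finset.mul_sum]
      refine Finset.sum_congr rfl fun a _ => ?_
      by_cases ha : cons a (prep w y) ∈ X
      · rw [Set.indicator_of_mem ha, Set.indicator_of_mem ha, prodWt_succ_cons,
          Real.mul_rpow (sw_nonneg _) (prodWt_nonneg _ _)]
        ring
      · rw [Set.indicator_of_notMem ha, Set.indicator_of_notMem ha, mul_zero]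
    · rw [Set.indicator_of_notMem hz]
      refine (Finset.sum_eq_zero fun a _ => Set.indicator_of_notMem (fun ha => hz ?_) _).symm
      exact hX 1 _ ha

lemma ofReal_rpow_le {x t : ℝ} (hx : 0 ≤ x) : ENNReal.ofReal (x ^ t) ≤ ENNReal.ofReal x ^ t := by
  rcases hx.eq_or_lt with rfl | hx
  · rcases le_or_gt 0 t with ht | ht
    · rw [ENNReal.ofReal_rpow_of_nonneg le_rfl ht]
    · rw [ENNReal.ofReal_zero, ENNReal.zero_rpow_of_neg ht]; exact le_top
  · rw [ENNReal.ofReal_rpow_of_pos hx]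

/-- The partition sums dominate the iterates of the transfer operator. -/
lemma iterate_letterOp_le_realSum (hX : ∀ n, ∀ x ∈ X, shift n x ∈ X) {P : ℝ}
    (h : HasPressure X t P) (n : ℕ) {y : BinSeq} (hy : y ∈ X) :
    (letterOp X t)^[n] (fun _ => 1) y ≤ realSum X t n := by
  rw [iterate_letterOp_eq_sum hX n _ hy]
  rw [← ENNReal.ofReal_le_ofReal_iff (h.pos n).le, h.ofReal_realSum, partitionSum_eq,
    ENNReal.ofReal_sum_of_nonneg fun w _ => Set.indicator_nonneg
      (fun z _ => mul_nonneg (Real.rpow_nonneg (prodWt_nonneg n z) _) zero_le_one) _]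
  refine Finset.sum_le_sum fun w _ => ?_
  by_cases hw : prep w y ∈ X
  · rw [Set.indicator_of_mem hw, mul_one]
    exact (ofReal_rpow_le (prodWt_nonneg _ _)).trans (le_iSup₂_of_le
      (f := fun x _ => ENNReal.ofReal (prodWt n x) ^ t) _ ⟨prep_mem_cylinder w y, hw⟩ le_rfl)
  · rw [Set.indicator_of_notMem hw, ENNReal.ofReal_zero]; exact zero_le

/-- Bounded distortion on the subshift `𝕏_m`. -/
lemma prodWt_le_exp_mul {m : ℕ} (n : ℕ) {x z : BinSeq} (hx : x ∈ subshift m) (hz : z ∈ subshift m)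
    (h : ∀ i < n, x i = z i) :
    prodWt n x ≤ Real.exp (2 * Real.pi / minWt m * (1 - (1 / 2) ^ n)) * prodWt n z := by
  induction n generalizing x z with
  | zero => simp
  | succ n ih =>
    rw [add_comm n 1, prodWt_add, prodWt_add]
    have h1 := ih (shift_mem_subshift (n := 1) hx) (shift_mem_subshift (n := 1) hz)
      fun i hi => h (i + 1) (by omega)
    have h2 : prodWt 1 x ≤ Real.exp (2 * Real.pi / minWt m * (1 / 2) ^ (n + 1)) * prodWt 1 z := by
      have hc := minWt_pos m
      have e : ∀ y, prodWt 1 y = sw y := fun y => by simp [prodWt]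
      rw [e, e]
      have h3 : |fold x - fold z| ≤ (1 / 2) ^ (n + 1) := abs_fold_sub_le (Nat.succ_pos n) h
      have h4 := abs_wt_sub_le (fold x) (fold z)
      rw [wt_fold, wt_fold] at h4
      have h5 : sw x ≤ sw z + 2 * Real.pi * (1 / 2) ^ (n + 1) := by
        have := mul_le_mul_of_nonneg_left h3 (by positivity : 0 ≤ 2 * Real.pi)
        linarith [le_abs_self (sw x - sw z)]
      have h6 : 2 * Real.pi * (1 / 2) ^ (n + 1)
          ≤ 2 * Real.pi / minWt m * (1 / 2) ^ (n + 1) * sw z := by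
        have := mul_le_mul_of_nonneg_left (minWt_le_sw hz)
          (by positivity : 0 ≤ 2 * Real.pi / minWt m * (1 / 2) ^ (n + 1))
        have e2 : 2 * Real.pi / minWt m * (1 / 2) ^ (n + 1) * minWt m
          = 2 * Real.pi * (1 / 2) ^ (n + 1) := by field_simp
        linarith
      have h7 := mul_le_mul_of_nonneg_right
        (Real.add_one_le_exp (2 * Real.pi / minWt m * (1 / 2) ^ (n + 1))) (sw_nonneg z)
      linarith
    refine (mul_le_mul h2 h1 (prodWt_nonneg _ _) (mul_nonneg (Real.exp_pos _).le
      (prodWt_nonneg _ _))).trans_eq ?_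
    rw [mul_mul_mul_comm, ← Real.exp_add]
    congr 2
    rw [add_comm 1 n]
    ring

/-- Bounded distortion on `𝕏_m`, uniformly in the length of the common word. -/
lemma prodWt_rpow_le {m : ℕ} (t : ℝ) (n : ℕ) {x z : BinSeq} (hx : x ∈ subshift m)
    (hz : z ∈ subshift m) (h : ∀ i < n, x i = z i) :
    prodWt n x ^ t ≤ Real.exp (2 * Real.pi / minWt m * |t|) * prodWt n z ^ t := by
  have hc := minWt_pos m
  have key : ∀ x ∈ subshift m, ∀ z ∈ subshift m, (∀ i < n, x i = z i) →
      Real.log (prodWt n x) ≤ 2 * Real.pi / minWt m + Real.log (prodWt n z) := by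
    intro x hx z hz h
    have h1 := Real.log_le_log (prodWt_pos hx n) (prodWt_le_exp_mul n hx hz h)
    rw [Real.log_mul (Real.exp_pos _).ne' (prodWt_pos hz n).ne', Real.log_exp] at h1
    have h2 : 2 * Real.pi / minWt m * (1 - (1 / 2) ^ n) ≤ 2 * Real.pi / minWt m :=
      mul_le_of_le_one_right (by positivity) (sub_le_self _ (by positivity))
    linarith
  rw [Real.rpow_def_of_pos (prodWt_pos hx n), Real.rpow_def_of_pos (prodWt_pos hz n),
    ← Real.exp_add, Real.exp_le_exp]
  have h1 := key x hx z hz h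
  have h2 := key z hz x hx fun i hi => (h i hi).symm
  rcases abs_cases t with ⟨ht, ht'⟩ | ⟨ht, ht'⟩ <;> rw [ht] <;> nlinarith

/-- A word that occurs in `𝕏_m` can be continued by an alternating sequence. -/
lemma prep_alt_mem_subshift {m n : ℕ} (hm : 1 ≤ m) {w : Fin n → Fin 2} {x : BinSeq}
    (hx : x ∈ cylinder w ∩ subshift m) :
    prep w (alt 0) ∈ subshift m ∨ prep w (alt 1) ∈ subshift m := by
  have main : ∀ a, (∀ i (h : i < n), i + 1 = n → w ⟨i, h⟩ ≠ a) →
      prep w (alt a) ∈ subshift m := by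
    intro a ha l b H
    rcases lt_or_ge (l + m) n with h1 | h1
    · refine hx.2 l b fun i hi => ?_
      rw [← H i hi, prep_of_lt _ _ (by omega)]
      exact hx.1 ⟨l + i, by omega⟩
    · rcases lt_or_ge l n with h2 | h2
      · have e1 := H (n - 1 - l) (by omega)
        have e2 := H (n - l) (by omega)
        rw [prep_of_lt _ _ (by omega)] at e1
        rw [prep_of_ge _ _ (by omega), show l + (n - l) - n = 0 by omega, alt_zero] at e2
        exact ha _ _ (by omega) (e1.trans e2.symm)
      · refine alt_mem_subshift hm a (l - n) b fun i hi => ?_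
        rw [← H i hi, prep_of_ge _ _ (by omega)]
        congr 1; omega
  by_cases h : ∀ i (h : i < n), i + 1 = n → w ⟨i, h⟩ ≠ 0
  · exact Or.inl (main 0 h)
  · push Not at h
    obtain ⟨i, hi, hin, hw⟩ := h
    refine Or.inr (main 1 fun j hj hjn => ?_)
    have : j = i := by omega
    subst this
    rw [hw]; decide

/-- On `𝕏_m` the partition sums are comparable to the iterates of the transfer operator. -/
lemma realSum_le {m : ℕ} (hm : 1 ≤ m) (t : ℝ) (n : ℕ) :
    realSum (subshift m) t n ≤ Real.exp (2 * Real.pi / minWt m * |t|) *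
      ((letterOp (subshift m) t)^[n] (fun _ => 1) (alt 0) +
        (letterOp (subshift m) t)^[n] (fun _ => 1) (alt 1)) := by
  have hnn : ∀ a (w : Fin n → Fin 2),
      0 ≤ (subshift m).indicator (fun z => prodWt n z ^ t * 1) (prep w (alt a)) := fun a w =>
    Set.indicator_nonneg (fun z _ => mul_nonneg (Real.rpow_nonneg (prodWt_nonneg n z) _)
      zero_le_one) _
  rw [iterate_letterOp_eq_sum (fun _ _ h => shift_mem_subshift h) n _ (alt_mem_subshift hm 0),
    iterate_letterOp_eq_sum (fun _ _ h => shift_mem_subshift h) n _ (alt_mem_subshift hm 1),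
    ← Finset.sum_add_distrib, Finset.mul_sum]
  have hP := hasPressure_approxP hm t
  have h0 : 0 ≤ ∑ w : Fin n → Fin 2, Real.exp (2 * Real.pi / minWt m * |t|) *
      ((subshift m).indicator (fun z => prodWt n z ^ t * 1) (prep w (alt 0)) +
        (subshift m).indicator (fun z => prodWt n z ^ t * 1) (prep w (alt 1))) :=
    Finset.sum_nonneg fun w _ => mul_nonneg (Real.exp_pos _).le (add_nonneg (hnn 0 w) (hnn 1 w))
  rw [← ENNReal.ofReal_le_ofReal_iff h0, hP.ofReal_realSum, partitionSum_eq,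
    ENNReal.ofReal_sum_of_nonneg fun w _ =>
      mul_nonneg (Real.exp_pos _).le (add_nonneg (hnn 0 w) (hnn 1 w))]
  refine Finset.sum_le_sum fun w _ => iSup₂_le fun x hx => ?_
  rw [ENNReal.ofReal_rpow_of_pos (prodWt_pos hx.2 n)]
  refine ENNReal.ofReal_le_ofReal ?_
  have hag : ∀ a, ∀ i < n, x i = prep w (alt a) i := fun a i hi => by
    rw [prep_of_lt _ _ hi]; exact hx.1 ⟨i, hi⟩
  rcases prep_alt_mem_subshift hm hx with hw | hw
  · refine (prodWt_rpow_le t n hx.2 hw (hag 0)).trans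
      (mul_le_mul_of_nonneg_left ?_ (Real.exp_pos _).le)
    have := hnn 1 w
    rw [Set.indicator_of_mem hw]
    linarith
  · refine (prodWt_rpow_le t n hx.2 hw (hag 1)).trans
      (mul_le_mul_of_nonneg_left ?_ (Real.exp_pos _).le)
    have := hnn 0 w
    rw [Set.indicator_of_mem (s := subshift m) hw]
    linarith

/-- A positive supersolution bounds the pressure from above. -/
lemma approxP_le_of_supersolution {m : ℕ} (hm : 1 ≤ m) {H : BinSeq → ℝ} {c C ρ : ℝ} (hc : 0 < c)
    (hH : ∀ y ∈ subshift m, c ≤ H y ∧ H y ≤ C) (hρ : 0 < ρ)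
    (h : ∀ y ∈ subshift m, letterOp (subshift m) t H y ≤ ρ * H y) :
    approxP m t ≤ Real.log ρ := by
  have hC : 0 < C := hc.trans_le ((hH _ (alt_mem_subshift hm 0)).1.trans
    (hH _ (alt_mem_subshift hm 0)).2)
  have h1 : ∀ n, ∀ a, (letterOp (subshift m) t)^[n] (fun _ => 1) (alt a) ≤ c⁻¹ * (ρ ^ n * C) := by
    intro n a
    have ha := alt_mem_subshift hm a
    have e1 := iterate_letterOp_mono (X := subshift m) (t := t) (H := fun _ => 1)
      (G := fun y => c⁻¹ * H y) (fun y hy => by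
        rw [le_inv_mul_iff₀ hc, mul_one]; exact (hH y hy).1) n _ ha
    rw [iterate_letterOp_const_mul] at e1
    refine e1.trans (mul_le_mul_of_nonneg_left ?_ (inv_pos.2 hc).le)
    refine (iterate_letterOp_le hρ.le h n _ ha).trans ?_
    gcongr
    exact (hH _ ha).2
  have := (hasPressure_approxP hm t).le_of_forall (d := 1) one_pos
    (A := Real.exp (2 * Real.pi / minWt m * |t|) * (2 * c⁻¹ * C)) (ρ := ρ) (by positivity) hρ
    fun k => by
      rw [one_mul]
      refine (realSum_le hm t k).trans ?_
      rw [mul_assoc]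
      refine mul_le_mul_of_nonneg_left ?_ (Real.exp_pos _).le
      linarith [h1 k 0, h1 k 1]
  simpa using this

/-- A positive subsolution bounds the pressure from below. -/
lemma le_approxP_of_subsolution {m : ℕ} (hm : 1 ≤ m) {H : BinSeq → ℝ} {c C ρ : ℝ} (hc : 0 < c)
    (hH : ∀ y ∈ subshift m, c ≤ H y ∧ H y ≤ C) (hρ : 0 < ρ)
    (h : ∀ y ∈ subshift m, ρ * H y ≤ letterOp (subshift m) t H y) :
    Real.log ρ ≤ approxP m t := by
  have ha := alt_mem_subshift hm 0
  have hC : 0 < C := hc.trans_le ((hH _ ha).1.trans (hH _ ha).2)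
  have := (hasPressure_approxP hm t).ge_of_forall (d := 1) one_pos
    (A := C⁻¹ * c) (ρ := ρ) (by positivity) hρ
    fun k => by
      rw [one_mul]
      refine le_trans ?_ (iterate_letterOp_le_realSum (fun _ _ h => shift_mem_subshift h)
        (hasPressure_approxP hm t) k ha)
      have e1 := iterate_letterOp_mono (X := subshift m) (t := t) (G := fun _ => 1)
        (H := fun y => C⁻¹ * H y) (fun y hy => by
          rw [inv_mul_le_iff₀ hC, mul_one]; exact (hH y hy).2) k _ ha
      rw [iterate_letterOp_const_mul] at e1
      refine le_trans ?_ e1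
      rw [mul_assoc]
      refine mul_le_mul_of_nonneg_left ?_ (inv_pos.2 hC).le
      rw [mul_comm]
      exact le_trans (mul_le_mul_of_nonneg_left (hH _ ha).1 (by positivity))
        (le_iterate_letterOp hρ.le h k _ ha)
  simpa using this

/-- Uniform bounds of an iterate of the unrestricted transfer operator bound all pressures. -/
lemma approxP_le_of_iterate_le {m : ℕ} (hm : 1 ≤ m) {d : ℕ} (hd : 0 < d) {ρ : ℝ} (hρ : 0 < ρ)
    (h : ∀ y, (letterOp Set.univ t)^[d] (fun _ => 1) y ≤ ρ) :
    approxP m t ≤ Real.log ρ / d := by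
  have h1 : ∀ k y, (letterOp Set.univ t)^[d * k] (fun _ => 1) y ≤ ρ ^ k := by
    intro k
    induction k with
    | zero => intro y; simp
    | succ k ih =>
      intro y
      rw [mul_add, mul_one, Function.iterate_add_apply]
      have e := iterate_letterOp_mono (X := Set.univ) (t := t)
        (H := (letterOp Set.univ t)^[d] fun _ => 1) (G := fun _ => ρ * 1) (fun y _ => by
          rw [mul_one]; exact h y) (d * k) y (Set.mem_univ y)
      rw [iterate_letterOp_const_mul] at e
      refine e.trans ?_
      rw [pow_succ']
      exact mul_le_mul_of_nonneg_left (ih y) hρ.le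
  have h2 : ∀ n, ∀ a, (letterOp (subshift m) t)^[n] (fun _ => 1) (alt a)
      ≤ (letterOp Set.univ t)^[n] (fun _ => 1) (alt a) := by
    intro n a
    rw [iterate_letterOp_eq_sum (fun _ _ h => shift_mem_subshift h) n _ (alt_mem_subshift hm a),
      iterate_letterOp_eq_sum (fun _ _ _ => Set.mem_univ _) n _ (Set.mem_univ _)]
    refine Finset.sum_le_sum fun w _ => Set.indicator_le_indicator_of_subset (Set.subset_univ _)
      (fun z => mul_nonneg (Real.rpow_nonneg (prodWt_nonneg n z) _) zero_le_one) _
  refine (hasPressure_approxP hm t).le_of_forall hd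
    (A := Real.exp (2 * Real.pi / minWt m * |t|) * 2) (ρ := ρ) (by positivity) hρ fun k => ?_
  refine (realSum_le hm t _).trans ?_
  rw [mul_assoc]
  refine mul_le_mul_of_nonneg_left ?_ (Real.exp_pos _).le
  linarith [h1 k (alt 0), h1 k (alt 1), h2 (d * k) 0, h2 (d * k) 1]

end LetterOperator

/-! ### Inducing on the runs: analyticity of the approximating pressures -/

section Runs

/-- The sequence `a^q y`. -/
def rep (q : ℕ) (a : Fin 2) (y : BinSeq) : BinSeq := prep (fun _ : Fin q => a) y

lemma rep_zero (a : Fin 2) (y : BinSeq) : rep 0 a y = y := prep_zero _ _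

lemma rep_of_lt {q i : ℕ} (a : Fin 2) (y : BinSeq) (h : i < q) : rep q a y i = a :=
  prep_of_lt _ _ h

lemma rep_of_ge {q i : ℕ} (a : Fin 2) (y : BinSeq) (h : q ≤ i) : rep q a y i = y (i - q) :=
  prep_of_ge _ _ h

lemma rep_succ (q : ℕ) (a : Fin 2) (y : BinSeq) : rep (q + 1) a y = cons a (rep q a y) := by
  rw [rep, rep, ← prep_cons]
  congr 1
  funext i
  exact Fin.cases rfl (fun _ => rfl) i

lemma rep_cons (q : ℕ) (a : Fin 2) (y : BinSeq) : rep q a (cons a y) = rep (q + 1) a y := by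
  induction q with
  | zero => rw [rep_succ, rep_zero, rep_zero]
  | succ q ih => rw [rep_succ, ih, ← rep_succ]

lemma shift_rep (q k : ℕ) (a : Fin 2) (y : BinSeq) : shift q (rep (q + k) a y) = rep k a y := by
  induction q with
  | zero => rw [zero_add, shift_zero]
  | succ q ih => rw [show q + 1 + k = (q + k) + 1 by omega, rep_succ, shift_succ_cons, ih]

lemma rep_mem_subshift {m q : ℕ} {a : Fin 2} {y : BinSeq} (hy : y ∈ subshift m) (ha : a ≠ y 0)
    (hq : q ≤ m) : rep q a y ∈ subshift m := by
  intro l b H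
  rcases lt_or_ge l q with h | h
  · have h1 := H 0 (Nat.zero_le m)
    have h2 := H (q - l) (by omega)
    rw [rep_of_lt _ _ (by omega)] at h1
    rw [rep_of_ge _ _ (by omega), show l + (q - l) - q = 0 by omega] at h2
    exact ha (h1.trans h2.symm)
  · refine hy (l - q) b fun i hi => ?_
    rw [← H i hi, rep_of_ge _ _ (by omega)]
    congr 1; omega

/-- The state space of the induced system: the distance to the nearest integer. -/
abbrev HalfInt : Type := Set.Icc (0 : ℝ) (1 / 2)

/-- The distance of `val x` to the nearest integer, as a point of `[0, 1/2]`. -/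
def foldI (x : BinSeq) : HalfInt := ⟨fold x, fold_nonneg x, fold_le_half x⟩

/-- The inverse branch `u ↦ 2^{-(j+1)} (1 - u)` that prepends a run of length `j + 1`. -/
def branch (j : ℕ) (u : HalfInt) : HalfInt :=
  ⟨(1 - u) / 2 ^ (j + 1), div_nonneg (by linarith [u.2.2]) (by positivity), by
    rw [pow_succ, ← div_div]
    have : (1 - (u : ℝ)) / 2 ^ j ≤ 1 :=
      div_le_one_of_le₀ (by linarith [u.2.1, one_le_pow₀ (n := j) (one_le_two (α := ℝ))])
        (by positivity)
    linarith⟩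

/-- The Birkhoff sum of `ψ` along a run of length `j + 1`. -/
def runSum (j : ℕ) (u : HalfInt) : ℝ := ∑ i ∈ Finset.range (j + 1), Real.log (wt (branch i u))

lemma dist_branch_le (j : ℕ) (u v : HalfInt) : dist (branch j u) (branch j v) ≤ dist u v / 2 := by
  rw [Subtype.dist_eq, Subtype.dist_eq, Real.dist_eq, Real.dist_eq]
  simp only [branch]
  rw [← sub_div, sub_sub_sub_cancel_left, abs_div, abs_sub_comm, abs_of_pos (by positivity :
    (0 : ℝ) < 2 ^ (j + 1))]
  gcongr
  calc (2 : ℝ) = 2 ^ 1 := by norm_num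
    _ ≤ _ := pow_le_pow_right₀ one_le_two (by omega)

lemma minWt_le_wt_branch {m j : ℕ} (hj : j < m) (u : HalfInt) : minWt m ≤ wt (branch j u) := by
  refine minWt_le_wt ?_ (branch j u).2.2
  simp only [branch]
  have e : ((1 : ℝ) / 2) ^ (m + 1) = (2 ^ (m + 1))⁻¹ := by rw [one_div, inv_pow]
  rw [e, le_div_iff₀ (by positivity)]
  have h1 : (2 : ℝ) ^ (j + 1) ≤ 2 ^ m := pow_le_pow_right₀ one_le_two (by omega)
  have h2 : ((2 : ℝ) ^ (m + 1))⁻¹ * 2 ^ (j + 1) ≤ (2 ^ (m + 1))⁻¹ * 2 ^ m := by gcongr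
  have h3 : ((2 : ℝ) ^ (m + 1))⁻¹ * 2 ^ m = 1 / 2 := by rw [pow_succ]; field_simp
  have := u.2.2
  linarith

lemma abs_log_sub_log_le {c a b : ℝ} (hc : 0 < c) (ha : c ≤ a) (hb : c ≤ b) :
    |Real.log a - Real.log b| ≤ |a - b| / c := by
  have key : ∀ a b : ℝ, c ≤ a → c ≤ b → Real.log a - Real.log b ≤ |a - b| / c := by
    intro a b ha hb
    have ha0 := hc.trans_le ha
    have hb0 := hc.trans_le hb
    rw [← Real.log_div ha0.ne' hb0.ne']
    refine (Real.log_le_sub_one_of_pos (div_pos ha0 hb0)).trans ?_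
    rw [div_sub_one hb0.ne']
    calc (a - b) / b ≤ |a - b| / b := by gcongr; exact le_abs_self _
      _ ≤ _ := by gcongr
  rw [abs_le]
  have h1 := key a b ha hb
  have h2 := key b a hb ha
  rw [abs_sub_comm] at h2
  constructor <;> linarith

/-- The potentials `runSum j`, `j < m`, are bounded and Lipschitz. -/
lemma exists_runSum_bound (m : ℕ) : ∃ B : ℝ, 0 ≤ B ∧ ∀ j < m, (∀ u, |runSum j u| ≤ B) ∧
    ∀ u v, |runSum j u - runSum j v| ≤ B * dist u v := by
  have hc := minWt_pos m
  set A : ℝ := |Real.log (minWt m)| + Real.log 2 + 2 * Real.pi / minWt m with hA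
  have hl2 := Real.log_pos one_lt_two
  have hA0 : 0 ≤ A := by positivity
  have hA1 : |Real.log (minWt m)| ≤ A ∧ Real.log 2 ≤ A ∧ 2 * Real.pi / minWt m ≤ A := by
    have : 0 ≤ 2 * Real.pi / minWt m := by positivity
    have := abs_nonneg (Real.log (minWt m))
    refine ⟨?_, ?_, ?_⟩ <;> linarith
  refine ⟨m * A, by positivity, fun j hj => ⟨fun u => ?_, fun u v => ?_⟩⟩
  · calc |runSum j u| ≤ ∑ i ∈ Finset.range (j + 1), |Real.log (wt (branch i u))| :=
          Finset.abs_sum_le_sum_abs _ _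
      _ ≤ ∑ _i ∈ Finset.range (j + 1), A := by
          refine Finset.sum_le_sum fun i hi => ?_
          rw [Finset.mem_range] at hi
          have h1 := minWt_le_wt_branch (by omega : i < m) u
          have h2 := Real.log_le_log hc h1
          have h3 := Real.log_le_log (hc.trans_le h1) (wt_le_two (branch i u))
          rw [abs_le]
          constructor <;> linarith [neg_abs_le (Real.log (minWt m))]
      _ = (j + 1 : ℕ) * A := by simp
      _ ≤ _ := by gcongr; exact_mod_cast hj
  · rw [runSum, runSum, ← Finset.sum_sub_distrib]
    calc _ ≤ ∑ i ∈ Finset.range (j + 1), |Real.log (wt (branch i u)) - Real.log (wt (branch i v))| :=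
          Finset.abs_sum_le_sum_abs _ _
      _ ≤ ∑ _i ∈ Finset.range (j + 1), A * dist u v := by
          refine Finset.sum_le_sum fun i hi => ?_
          rw [Finset.mem_range] at hi
          refine (abs_log_sub_log_le hc (minWt_le_wt_branch (by omega : i < m) u)
            (minWt_le_wt_branch (by omega : i < m) v)).trans ?_
          have h1 := abs_wt_sub_le (branch i u) (branch i v)
          have h2 : |(branch i u : ℝ) - branch i v| ≤ dist u v := by
            have := dist_branch_le i u v
            rw [Subtype.dist_eq, Real.dist_eq] at this
            exact this.trans (half_le_self dist_nonneg)
          calc _ ≤ 2 * Real.pi * dist u v / minWt m := by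
                gcongr
                exact h1.trans (by gcongr)
            _ = 2 * Real.pi / minWt m * dist u v := by ring
            _ ≤ _ := mul_le_mul_of_nonneg_right hA1.2.2 dist_nonneg
      _ = (j + 1 : ℕ) * (A * dist u v) := by simp
      _ ≤ m * (A * dist u v) := by
          have : 0 ≤ A * dist u v := by positivity
          gcongr; exact_mod_cast hj
      _ = _ := by ring

lemma foldI_rep {a : Fin 2} {y : BinSeq} (ha : a ≠ y 0) (q : ℕ) :
    foldI (rep (q + 1) a y) = branch q (foldI y) := by
  apply Subtype.ext
  change fold (rep (q + 1) a y) = (1 - fold y) / 2 ^ (q + 1)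
  induction q with
  | zero => rw [rep_succ, rep_zero, fold_cons_ne ha]; simp
  | succ q ih =>
    rw [rep_succ, fold_cons_same (by rw [rep_of_lt _ _ (by omega)]), ih, pow_succ _ (q + 1), div_div]

lemma prodWt_rep {m : ℕ} {a : Fin 2} {y : BinSeq} (ha : a ≠ y 0) {q : ℕ} (hq : q < m) :
    prodWt (q + 1) (rep (q + 1) a y) = Real.exp (runSum q (foldI y)) := by
  induction q with
  | zero =>
    have h := minWt_le_wt_branch hq (foldI y)
    rw [runSum, Finset.sum_range_one, Real.exp_log ((minWt_pos m).trans_le h), ← foldI_rep ha,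
      prodWt, Finset.prod_range_one, shift_zero]
    exact (wt_fold _).symm
  | succ q ih =>
    have h := minWt_le_wt_branch hq (foldI y)
    have e : runSum (q + 1) (foldI y) = runSum q (foldI y) +
        Real.log (wt (branch (q + 1) (foldI y))) := Finset.sum_range_succ _ _
    rw [rep_succ, prodWt_succ_cons, ih (by omega), e, Real.exp_add,
      Real.exp_log ((minWt_pos m).trans_le h), ← foldI_rep ha, ← rep_succ, mul_comm]
    congr 1
    exact (wt_fold _).symm

/-- The function on `𝕏_m` obtained from a function `h` of the induced system by summing over all
ways to lengthen the first run. -/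
def tower (m : ℕ) (s t : ℝ) (h : HalfInt → ℝ) (y : BinSeq) : ℝ :=
  ∑ q ∈ Finset.range m, (subshift m).indicator
    (fun z => Real.exp (-(s * q)) * prodWt q z ^ t * h (foldI z)) (rep q (y 0) y)

variable {m : ℕ} {s t lam : ℝ} {h : HalfInt → ℝ}

lemma sum_fin2 (F : Fin 2 → ℝ) (b : Fin 2) : ∑ a, F a = F b + F (1 - b) := by
  fin_cases b
  · simp
  · simp [add_comm]

/-- An eigenfunction of the induced operator with eigenvalue `1` gives an eigenfunction of the
transfer operator on `𝕏_m` with eigenvalue `exp s`; the identity also quantifies the defect for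
other eigenvalues. -/
lemma letterOp_tower (hm : 1 ≤ m)
    (hh : ∀ u, ∑ j : Fin m, Real.exp (t * runSum j u - s * ((j : ℕ) + 1)) * h (branch j u)
      = lam * h u) {y : BinSeq} (hy : y ∈ subshift m) :
    letterOp (subshift m) t (tower m s t h) y
      = Real.exp s * (tower m s t h y + (lam - 1) * h (foldI y)) := by
  set b := y 0 with hb
  set F : ℕ → BinSeq → ℝ := fun q z => Real.exp (-(s * q)) * prodWt q z ^ t * h (foldI z) with hF
  set T : ℕ → ℝ := fun q => (subshift m).indicator (F q) (rep q b y) with hT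
  have hexp : ∀ q : ℕ, Real.exp (-(s * q)) = Real.exp s * Real.exp (-(s * (q + 1 : ℕ))) := by
    intro q; rw [← Real.exp_add]; congr 1; push_cast; ring
  have hstep : ∀ (a : Fin 2) (q : ℕ), sw (cons a y) ^ t * F q (rep (q + 1) a y)
      = Real.exp s * F (q + 1) (rep (q + 1) a y) := by
    intro a q
    simp only [hF]
    rw [prodWt_succ, shift_rep q 1, rep_succ 0, rep_zero,
      Real.mul_rpow (prodWt_nonneg _ _) (sw_nonneg _), hexp]
    ring
  have htow : tower m s t h y = ∑ q ∈ Finset.range m, T q := rfl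
  have hT0 : T 0 = h (foldI y) := by
    simp only [hT, rep_zero]
    rw [Set.indicator_of_mem hy]
    simp [hF]
  have hTm : T m = 0 := by
    refine Set.indicator_of_notMem (fun H : rep m b y ∈ subshift m => H 0 b fun i hi => ?_) _
    rw [zero_add]
    rcases hi.lt_or_eq with hi | rfl
    · exact rep_of_lt _ _ hi
    · rw [rep_of_ge _ _ le_rfl, Nat.sub_self]
  have hsame : (subshift m).indicator (fun z => sw z ^ t * tower m s t h z) (cons b y)
      = Real.exp s * ∑ q ∈ Finset.range m, T (q + 1) := by
    by_cases hc : cons b y ∈ subshift m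
    · rw [Set.indicator_of_mem hc, tower, cons_zero, Finset.mul_sum, Finset.mul_sum]
      refine Finset.sum_congr rfl fun q _ => ?_
      simp only [hT]
      rw [rep_cons]
      by_cases hr : rep (q + 1) b y ∈ subshift m
      · rw [Set.indicator_of_mem hr, Set.indicator_of_mem hr]
        exact hstep b q
      · rw [Set.indicator_of_notMem hr, Set.indicator_of_notMem hr, mul_zero, mul_zero]
    · rw [Set.indicator_of_notMem hc, Finset.sum_eq_zero, mul_zero]
      intro q _
      refine Set.indicator_of_notMem (fun hr => hc ?_) _
      have := shift_mem_subshift (n := q) hr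
      rwa [shift_rep, rep_succ, rep_zero] at this
  have hne : 1 - b ≠ y 0 := fun H => by
    have : ∀ c : Fin 2, 1 - c ≠ c := by decide
    exact this b H
  have hother : (subshift m).indicator (fun z => sw z ^ t * tower m s t h z) (cons (1 - b) y)
      = Real.exp s * (lam * h (foldI y)) := by
    have hc : cons (1 - b) y ∈ subshift m := by
      have := rep_mem_subshift hy hne hm
      rwa [rep_succ, rep_zero] at this
    rw [Set.indicator_of_mem hc, tower, cons_zero, Finset.mul_sum, ← hh, Finset.mul_sum,
      Finset.sum_range]
    refine Finset.sum_congr rfl fun q _ => ?_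
    have hr : rep (q + 1) (1 - b) y ∈ subshift m := rep_mem_subshift hy hne q.2
    rw [rep_cons, Set.indicator_of_mem hr]
    have e := hstep (1 - b) q
    simp only [hF] at e
    rw [e, prodWt_rep hne q.2, foldI_rep hne, ← Real.exp_mul, ← Real.exp_add]
    congr 3
    push_cast
    ring
  have hsum : ∑ q ∈ Finset.range m, T (q + 1) = tower m s t h y - h (foldI y) := by
    rw [htow, ← hT0]
    have h1 := Finset.sum_range_succ' T m
    have h2 := Finset.sum_range_succ T m
    rw [hTm] at h2
    linarith
  rw [letterOp, sum_fin2 _ b, hsame, hother, hsum]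
  ring

lemma tower_bounds (hm : 1 ≤ m) {c C : ℝ} (hc : 0 < c) (hb : ∀ u, c ≤ h u ∧ h u ≤ C) :
    ∃ C', ∀ y ∈ subshift m, h (foldI y) ≤ tower m s t h y ∧ tower m s t h y ≤ C' := by
  have hnn : ∀ (q : ℕ) z, 0 ≤ Real.exp (-(s * q)) * prodWt q z ^ t * h (foldI z) := fun q z =>
    mul_nonneg (mul_nonneg (Real.exp_pos _).le (Real.rpow_nonneg (prodWt_nonneg _ _) _))
      (hc.le.trans (hb _).1)
  refine ⟨∑ q ∈ Finset.range m, Real.exp (-(s * q)) * (max (minWt m ^ t) (2 ^ t)) ^ q * C,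
    fun y hy => ⟨?_, ?_⟩⟩
  · rw [tower]
    refine le_trans (le_of_eq ?_) (Finset.single_le_sum
      (fun q _ => Set.indicator_nonneg (fun z _ => hnn q z) _) (Finset.mem_range.2 hm))
    rw [rep_zero, Set.indicator_of_mem hy]
    simp
  · refine Finset.sum_le_sum fun q _ => ?_
    have hC : 0 ≤ C := hc.le.trans ((hb (foldI y)).1.trans (hb (foldI y)).2)
    have hmax : 0 ≤ max (minWt m ^ t) (2 ^ t) := le_max_of_le_right (by positivity)
    by_cases hr : rep q (y 0) y ∈ subshift m
    · rw [Set.indicator_of_mem hr]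
      have h1 : prodWt q (rep q (y 0) y) ^ t ≤ (max (minWt m ^ t) (2 ^ t)) ^ q :=
        rpow_le_max_pow (minWt_pos m) q (minWt_pow_le hr q) (prodWt_le q _) two_pos
      have h2 := (hb (foldI (rep q (y 0) y))).2
      have h3 := hc.le.trans (hb (foldI (rep q (y 0) y))).1
      gcongr
    · rw [Set.indicator_of_notMem hr]; positivity

/-- The pressure `p_m(t)` is the parameter `s` for which the induced operator has the
eigenvalue `1`. -/
lemma approxP_eq_of_eigenfunction (hm : 1 ≤ m) {c C : ℝ} (hc : 0 < c)
    (hb : ∀ u, c ≤ h u ∧ h u ≤ C)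
    (hh : ∀ u, ∑ j : Fin m, Real.exp (t * runSum j u - s * ((j : ℕ) + 1)) * h (branch j u)
      = h u) : approxP m t = s := by
  obtain ⟨C', hC'⟩ := tower_bounds (s := s) (t := t) hm hc hb
  have hH : ∀ y ∈ subshift m, c ≤ tower m s t h y ∧ tower m s t h y ≤ C' := fun y hy =>
    ⟨(hb _).1.trans (hC' y hy).1, (hC' y hy).2⟩
  have e : ∀ y ∈ subshift m, letterOp (subshift m) t (tower m s t h) y
      = Real.exp s * tower m s t h y := fun y hy => by
    rw [letterOp_tower (lam := 1) hm (by simpa using hh) hy, sub_self, zero_mul, add_zero]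
  have h1 := approxP_le_of_supersolution hm hc hH (Real.exp_pos s) fun y hy => (e y hy).le
  have h2 := le_approxP_of_subsolution hm hc hH (Real.exp_pos s) fun y hy => (e y hy).ge
  rw [Real.log_exp] at h1 h2
  exact le_antisymm h1 h2

lemma eigenvalue_eq_one (hm : 1 ≤ m) {c C : ℝ} (hc : 0 < c) (hb : ∀ u, c ≤ h u ∧ h u ≤ C)
    (hlam : 0 < lam)
    (hh : ∀ u, ∑ j : Fin m, Real.exp (t * runSum j u - approxP m t * ((j : ℕ) + 1)) *
      h (branch j u) = lam * h u) : lam = 1 := by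
  set s := approxP m t with hs
  obtain ⟨C', hC'⟩ := tower_bounds (s := s) (t := t) hm hc hb
  have hH : ∀ y ∈ subshift m, c ≤ tower m s t h y ∧ tower m s t h y ≤ C' := fun y hy =>
    ⟨(hb _).1.trans (hC' y hy).1, (hC' y hy).2⟩
  have hcC : c ≤ C' := (hH _ (alt_mem_subshift hm 0)).1.trans (hH _ (alt_mem_subshift hm 0)).2
  have hC'0 : 0 < C' := hc.trans_le hcC
  have e := fun y (hy : y ∈ subshift m) => letterOp_tower hm hh hy
  have hq1 : c / C' ≤ 1 := div_le_one_of_le₀ hcC hC'0.le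
  have hq0 : 0 < c / C' := div_pos hc hC'0
  have hfrac : ∀ y ∈ subshift m, c / C' * tower m s t h y ≤ h (foldI y) := fun y hy => by
    refine le_trans ?_ (hb (foldI y)).1
    rw [div_mul_eq_mul_div, div_le_iff₀ hC'0]
    exact mul_le_mul_of_nonneg_left (hH y hy).2 hc.le
  rcases lt_trichotomy lam 1 with hl | hl | hl
  · exfalso
    have hpos : 0 < 1 - (1 - lam) * (c / C') := by nlinarith
    have h1 := approxP_le_of_supersolution (t := t) hm hc hH
      (mul_pos (Real.exp_pos s) hpos) fun y hy => by
        rw [e y hy, mul_assoc]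
        refine mul_le_mul_of_nonneg_left ?_ (Real.exp_pos s).le
        nlinarith [hfrac y hy]
    rw [Real.log_mul (Real.exp_pos s).ne' hpos.ne', Real.log_exp] at h1
    have h2 := Real.log_neg hpos (by nlinarith)
    linarith
  · exact hl
  · exfalso
    have hpos : 1 < 1 + (lam - 1) * (c / C') := by nlinarith
    have h1 := le_approxP_of_subsolution (t := t) hm hc hH
      (mul_pos (Real.exp_pos s) (zero_lt_one.trans hpos)) fun y hy => by
        rw [e y hy, mul_assoc]
        refine mul_le_mul_of_nonneg_left ?_ (Real.exp_pos s).le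
        nlinarith [hfrac y hy]
    rw [Real.log_mul (Real.exp_pos s).ne' (zero_lt_one.trans hpos).ne', Real.log_exp] at h1
    have h2 := Real.log_pos hpos
    linarith

lemma abs_exp_sub_exp_le {x y R : ℝ} (hx : x ≤ R) (hy : y ≤ R) :
    |Real.exp x - Real.exp y| ≤ Real.exp R * |x - y| := by
  have key : ∀ x y : ℝ, x ≤ R → Real.exp x - Real.exp y ≤ Real.exp R * |x - y| := by
    intro x y hx
    have h1 := mul_le_mul_of_nonneg_left (Real.add_one_le_exp (y - x)) (Real.exp_pos x).le
    rw [← Real.exp_add, add_sub_cancel] at h1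
    have h2 : Real.exp x * (x - y) ≤ Real.exp x * |x - y| :=
      mul_le_mul_of_nonneg_left (le_abs_self _) (Real.exp_pos x).le
    have h3 : Real.exp x * |x - y| ≤ Real.exp R * |x - y| := by gcongr
    linarith
  rw [abs_le]
  have h1 := key x y hx
  have h2 := key y x hy
  rw [abs_sub_comm] at h2
  constructor <;> linarith

/-- The approximating pressures are real-analytic. -/
theorem analyticAt_approxP (hm : 1 ≤ m) (t₀ : ℝ) : AnalyticAt ℝ (approxP m) t₀ := by
  obtain ⟨B, hB0, hB⟩ := exists_runSum_bound m
  have : Nonempty (Fin m) := ⟨⟨0, hm⟩⟩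
  have : Nonempty HalfInt := ⟨⟨0, le_rfl, by norm_num⟩⟩
  have hD : ∀ u v : HalfInt, dist u v ≤ 1 := fun u v => by
    rw [Subtype.dist_eq, Real.dist_eq, abs_le]
    constructor <;> linarith [u.2.1, u.2.2, v.2.1, v.2.2]
  have hS : ∀ (j : Fin m) (u v : HalfInt), dist (branch j u) (branch j v) ≤ dist u v / 2 :=
    fun j => dist_branch_le j
  set s₀ := approxP m t₀ with hs₀
  let a : Fin m → HalfInt → ℝ := fun j u => t₀ * runSum j u - s₀ * ((j : ℕ) + 1)
  have ha : ∀ j u v, |a j u - a j v| ≤ |t₀| * B * dist u v := fun j u v => by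
    simp only [a]
    rw [sub_sub_sub_cancel_right, ← mul_sub, abs_mul, mul_assoc]
    exact mul_le_mul_of_nonneg_left ((hB j j.2).2 u v) (abs_nonneg _)
  have hR : ∀ j u, |a j u| ≤ |t₀| * B + |s₀| * m := fun j u => by
    refine (abs_sub _ _).trans ?_
    rw [abs_mul, abs_mul]
    have h1 := (hB j j.2).1 u
    have h2 : |((j : ℕ) : ℝ) + 1| ≤ m := by
      rw [abs_of_nonneg (by positivity)]; exact_mod_cast j.2
    gcongr
  obtain ⟨v, hv, lam, hlam0, hlam⟩ := exists_eigenfunction hD hS (by positivity) ha hR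
  set E : ℝ := 2 * (|t₀| * B) with hE
  set R : ℝ := |t₀| * B + |s₀| * m with hRdef
  have hE0 : 0 ≤ E := by positivity
  have hvv : ∀ x y, |v x - v y| ≤ E := fun x y => (hv x y).trans
    (mul_le_of_le_one_right hE0 (hD x y))
  let u₀ : HalfInt := ⟨0, le_rfl, by norm_num⟩
  have hb1 : ∀ u, Real.exp (v u₀ - E) ≤ Real.exp (v u) ∧ Real.exp (v u) ≤ Real.exp (v u₀ + E) :=
    fun u => by
      have := abs_le.1 (hvv u u₀)
      constructor <;> rw [Real.exp_le_exp] <;> linarith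
  have hlam1 : lam = 1 := eigenvalue_eq_one hm (Real.exp_pos _) hb1 hlam0 hlam
  subst hlam1
  simp only [one_mul] at hlam
  -- normalization of the weights
  let p : Fin m → HalfInt → ℝ := fun j u => Real.exp (a j u + v (branch j u) - v u)
  have hlogB : ∀ j u, |a j u + v (branch j u) - v u| ≤ R + E := fun j u => by
    rw [add_sub_assoc]
    exact (abs_add_le _ _).trans (add_le_add (hR j u) (hvv _ _))
  have hplip : ∀ j u w, |p j u - p j w| ≤ Real.exp (R + E) * (3 * E) * dist u w := fun j u w => by
    refine (abs_exp_sub_exp_le ((le_abs_self _).trans (hlogB j u))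
      ((le_abs_self _).trans (hlogB j w))).trans ?_
    rw [mul_assoc]
    refine mul_le_mul_of_nonneg_left ?_ (Real.exp_pos _).le
    have e : a j u + v (branch j u) - v u - (a j w + v (branch j w) - v w)
        = (a j u - a j w) + (v (branch j u) - v (branch j w)) - (v u - v w) := by ring
    rw [e]
    have h1 := ha j u w
    have h2 := (hv (branch j u) (branch j w)).trans (mul_le_mul_of_nonneg_left (hS j u w) hE0)
    have h3 := hv u w
    have h4 := abs_sub ((a j u - a j w) + (v (branch j u) - v (branch j w))) (v u - v w)
    have h5 := abs_add_le (a j u - a j w) (v (branch j u) - v (branch j w))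
    have h6 : 0 ≤ |t₀| * B * dist u w := by positivity
    simp only [hE] at *
    linarith
  have hp : IsMarkov (m * (Real.exp (R + E) * (3 * E))) (Real.exp (-(R + E))) p := by
    refine ⟨fun u => ?_, fun j u => ?_, fun u w => ?_⟩
    · have : ∀ j, p j u = Real.exp (a j u) * Real.exp (v (branch j u)) / Real.exp (v u) :=
        fun j => by simp only [p]; rw [Real.exp_sub, Real.exp_add]
      simp only [this]
      rw [← Finset.sum_div, hlam, div_self (Real.exp_pos _).ne']
    · exact Real.exp_le_exp.2 (abs_le.1 (hlogB j u)).1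
    · refine (Finset.sum_le_sum fun j _ => hplip j u w).trans_eq ?_
      simp [mul_assoc]
  obtain ⟨σ, hσ, hσ0, hev⟩ := exists_analytic_solution (S := fun j : Fin m => branch j) (B := B)
    (φ := fun j u => runSum j u) (τ := fun j => (j : ℕ) + 1) hS (Real.exp_pos _) (by positivity) hp
    (fun j => (hB j j.2).1) (fun j => (hB j j.2).2) (fun j => by positivity)
  have hkey : ∀ᶠ t in 𝓝 t₀, s₀ + σ (t - t₀) = approxP m t := by
    have htend : Tendsto (fun t => t - t₀) (𝓝 t₀) (𝓝 0) := by
      have := (continuous_sub_right t₀).tendsto t₀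
      rwa [sub_self] at this
    filter_upwards [htend.eventually hev] with t ht
    obtain ⟨k, hk, hkeq⟩ := ht
    refine (approxP_eq_of_eigenfunction (h := fun u => k u * Real.exp (v u)) hm
      (c := 1 / 2 * Real.exp (v u₀ - E)) (C := 3 / 2 * Real.exp (v u₀ + E)) (by positivity)
      (fun u => ⟨?_, ?_⟩) fun u => ?_).symm
    · exact mul_le_mul (hk u).1 (hb1 u).1 (Real.exp_pos _).le ((by norm_num : (0 : ℝ) ≤ 1 / 2).trans
        (hk u).1)
    · exact mul_le_mul (hk u).2 (hb1 u).2 (Real.exp_pos _).le (by norm_num)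
    · rw [← hkeq, Finset.sum_mul]
      refine Finset.sum_congr rfl fun j _ => ?_
      have e : Real.exp (t * runSum j u - (s₀ + σ (t - t₀)) * ((j : ℕ) + 1)) *
          Real.exp (v (branch j u)) = p j u * Real.exp ((t - t₀) * runSum j u -
            σ (t - t₀) * ((j : ℕ) + 1)) * Real.exp (v u) := by
        simp only [p, a]
        rw [← Real.exp_add, ← Real.exp_add, ← Real.exp_add]
        congr 1
        ring
      rw [mul_comm (k _), ← mul_assoc, e]
      ring
  refine AnalyticAt.congr ?_ hkey
  refine analyticAt_const.add (AnalyticAt.comp (g := σ) (f := fun t => t - t₀) ?_ ?_)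
  · rwa [sub_self]
  · exact analyticAt_id.sub analyticAt_const

end Runs

/-! ### Cutting long runs: convergence of the approximating pressures -/

section Surgery

/-- `IsSurgery w x x'`: the sequence `x'` arises from `x` by flipping letters that sit in the
middle of a constant block of radius `w` (cut off at `0`), no two of them adjacent. -/
def IsSurgery (w : ℕ) (x x' : BinSeq) : Prop :=
  ∀ i, x' i ≠ x i → (∀ j, i ≤ j + w → j ≤ i + w → x j = x i) ∧ x' (i + 1) = x (i + 1)

lemma IsSurgery.shift {w : ℕ} {x x' : BinSeq} (h : IsSurgery w x x') (n : ℕ) :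
    IsSurgery w (shift n x) (shift n x') := fun i hi => by
  obtain ⟨h1, h2⟩ := h (i + n) hi
  refine ⟨fun j hj1 hj2 => h1 (j + n) (by omega) (by omega), ?_⟩
  have e : i + 1 + n = i + n + 1 := by omega
  simp only [ThueMorse.shift, e, h2]

/-- A surgery can only decrease the distance to the integers by a factor close to `1`. -/
lemma IsSurgery.mul_fold_le {w : ℕ} (hw : 1 ≤ w) {x x' : BinSeq} (h : IsSurgery w x x') :
    (1 - 2 * (1 / 2) ^ w) * fold x ≤ fold x' := by
  have hx := fold_nonneg x
  have hle : (1 - 2 * (1 / 2 : ℝ) ^ w) * fold x ≤ fold x :=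
    mul_le_of_le_one_left hx (by linarith [pow_pos (one_half_pos (α := ℝ)) w])
  by_cases hall : ∀ i, x' i = x i
  · rwa [show x' = x from funext hall]
  push Not at hall
  -- `N` is the first letter that is flipped
  obtain ⟨N, hN, hmin⟩ : ∃ N, x' N ≠ x N ∧ ∀ i < N, x' i = x i :=
    ⟨Nat.find hall, Nat.find_spec hall, fun i hi => not_not.1 (Nat.find_min hall hi)⟩
  obtain ⟨hwin, hnext⟩ := h N hN
  rcases Nat.eq_zero_or_pos N with rfl | hN0
  · have h1 : fold x ≤ (1 / 2) ^ (w + 1) :=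
      fold_le_of_run fun i hi => hwin i (by omega) (by omega)
    have h2 : (1 / 2 : ℝ) ^ (1 + 1) ≤ fold x' := le_fold_of_ne (by
      rw [zero_add] at hnext
      rw [hnext, hwin 1 (by omega) (by omega)]
      exact hN.symm)
    have h3 : (1 / 2 : ℝ) ^ (w + 1) ≤ (1 / 2) ^ (1 + 1) :=
      pow_le_pow_of_le_one (by norm_num) (by norm_num) (by omega)
    linarith
  by_cases hk : ∃ k, k ≤ N ∧ x k ≠ x 0
  · -- `k` is the end of the first run of `x`
    obtain ⟨k, ⟨hkN, hk0⟩, hkmin⟩ : ∃ k, (k ≤ N ∧ x k ≠ x 0) ∧ ∀ i < k, ¬ (i ≤ N ∧ x i ≠ x 0) :=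
      ⟨Nat.find hk, Nat.find_spec hk, fun i hi => Nat.find_min hk hi⟩
    have hkpos : 0 < k := Nat.pos_of_ne_zero fun H => hk0 (by rw [H])
    have hkw : k + w ≤ N := by
      by_contra! H
      have h1 := hwin k (by omega) (by omega)
      have h2 := hwin (k - 1) (by omega) (by omega)
      have h3 : x (k - 1) = x 0 := by
        by_contra H'
        exact hkmin (k - 1) (by omega) ⟨by omega, H'⟩
      exact hk0 (by rw [h1, ← h2, h3])
    have h1 := le_fold_of_ne hk0
    have h2 := abs_fold_sub_le hN0 (x := x) (y := x') fun i hi => (hmin i hi).symm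
    have h3 : (1 / 2 : ℝ) ^ N ≤ (1 / 2) ^ (k + w) :=
      pow_le_pow_of_le_one (by norm_num) (by norm_num) hkw
    have h4 : (1 / 2 : ℝ) ^ (k + w) = 2 * (1 / 2) ^ w * (1 / 2) ^ (k + 1) := by
      rw [pow_add, pow_succ]; ring
    have h5 : 2 * (1 / 2 : ℝ) ^ w * (1 / 2) ^ (k + 1) ≤ 2 * (1 / 2) ^ w * fold x := by gcongr
    have h6 := (abs_le.1 h2).2
    linarith
  · push Not at hk
    have h1 : fold x ≤ (1 / 2) ^ (N + 1) := fold_le_of_run fun i hi => hk i (by omega)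
    have h2 : (1 / 2 : ℝ) ^ (N + 1) ≤ fold x' := le_fold_of_ne (by
      rw [hmin 0 hN0, ← hk N le_rfl]; exact hN)
    linarith

lemma IsSurgery.mul_sw_le {w : ℕ} (hw : 1 ≤ w) {x x' : BinSeq} (h : IsSurgery w x x') :
    (1 - 2 * (1 / 2) ^ w) ^ 2 * sw x ≤ sw x' := by
  have hp : (1 / 2 : ℝ) ^ w ≤ (1 / 2) ^ 1 :=
    pow_le_pow_of_le_one (by norm_num) (by norm_num) hw
  have hc0 : 0 ≤ 1 - 2 * (1 / 2 : ℝ) ^ w := by linarith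
  have hc1 : 1 - 2 * (1 / 2 : ℝ) ^ w ≤ 1 := by linarith [pow_pos (one_half_pos (α := ℝ)) w]
  rw [← wt_fold, ← wt_fold]
  exact (sq_mul_wt_le hc0 hc1 (fold_nonneg x) (fold_le_half x)).trans
    (wt_mono (mul_nonneg hc0 (fold_nonneg x)) (h.mul_fold_le hw) (fold_le_half x'))

lemma IsSurgery.mul_prodWt_le {w : ℕ} (hw : 1 ≤ w) {x x' : BinSeq} (h : IsSurgery w x x')
    (n : ℕ) : ((1 - 2 * (1 / 2) ^ w) ^ 2) ^ n * prodWt n x ≤ prodWt n x' := by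
  calc _ = ∏ l ∈ Finset.range n, (1 - 2 * (1 / 2 : ℝ) ^ w) ^ 2 * sw (ThueMorse.shift l x) := by
        rw [Finset.prod_mul_distrib, Finset.prod_const, Finset.card_range, prodWt]
    _ ≤ _ := Finset.prod_le_prod (fun l _ => mul_nonneg (sq_nonneg _) (sw_nonneg _))
        fun l _ => (h.shift l).mul_sw_le hw

open Classical in
/-- The surgery that flips every `(w+1)`-st letter provided it lies in the middle of a constant
block of radius `w`. -/
def cutRuns (w : ℕ) (x : BinSeq) : BinSeq := fun i =>
  if w + 1 ∣ i ∧ ∀ j, i ≤ j + w → j ≤ i + w → x j = x i then 1 - x i else x i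

lemma cutRuns_ne_iff {w : ℕ} {x : BinSeq} {i : ℕ} : cutRuns w x i ≠ x i ↔
    w + 1 ∣ i ∧ ∀ j, i ≤ j + w → j ≤ i + w → x j = x i := by
  unfold cutRuns
  split_ifs with h
  · exact iff_of_true (fin2_ne_iff.2 rfl) h
  · simpa using h

lemma isSurgery_cutRuns {w : ℕ} (hw : 1 ≤ w) (x : BinSeq) : IsSurgery w x (cutRuns w x) := by
  intro i hi
  rw [cutRuns_ne_iff] at hi
  refine ⟨hi.2, ?_⟩
  by_contra H
  have h1 := (cutRuns_ne_iff.1 H).1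
  have h2 := (Nat.dvd_add_right hi.1).1 h1
  have := Nat.le_of_dvd one_pos h2
  omega

lemma cutRuns_mem_subshift {w : ℕ} (hw : 1 ≤ w) (x : BinSeq) :
    cutRuns w x ∈ subshift (3 * w + 1) := by
  intro l a H
  have hs := isSurgery_cutRuns hw x
  -- a letter flipped inside a constant block of the result would differ from its successor
  have heq : ∀ i ≤ 3 * w, x (l + i) = a := by
    intro i hi
    by_contra hne
    have h1 : cutRuns w x (l + i) ≠ x (l + i) := by
      rw [H i (by omega)]; exact fun H' => hne H'.symm
    obtain ⟨h2, h3⟩ := hs _ h1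
    rw [h2 (l + i + 1) (by omega) (by omega), add_assoc, H (i + 1) (by omega)] at h3
    exact hne h3.symm
  -- a multiple of `w + 1` in the middle third of the block
  obtain ⟨p, hp, hp1, hp2⟩ : ∃ p, w + 1 ∣ p ∧ l + w ≤ p ∧ p ≤ l + 2 * w := by
    refine ⟨(w + 1) * ((l + 2 * w) / (w + 1)), dvd_mul_right _ _, ?_, Nat.mul_div_le _ _⟩
    have := Nat.lt_mul_div_succ (l + 2 * w) (Nat.succ_pos w)
    rw [mul_add] at this
    simp only [Nat.succ_eq_add_one] at this
    omega
  have hpa : x p = a := by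
    have := heq (p - l) (by omega)
    rwa [show l + (p - l) = p by omega] at this
  have hflip : cutRuns w x p ≠ x p := cutRuns_ne_iff.2 ⟨hp, fun j hj1 hj2 => by
    have := heq (j - l) (by omega)
    rw [show l + (j - l) = j by omega] at this
    rw [this, hpa]⟩
  refine hflip ?_
  have := H (p - l) (by omega)
  rw [show l + (p - l) = p by omega] at this
  rw [this, hpa]

/-- The word that marks the positions `(w+1) j` with `F j = 1`. -/
def gridWord (w n : ℕ) (F : Fin (n / (w + 1) + 1) → Fin 2) : Fin n → Fin 2 := fun i =>
  if w + 1 ∣ (i : ℕ) then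
    F ⟨i / (w + 1), Nat.lt_succ_of_le (Nat.div_le_div_right i.2.le)⟩ else 0

lemma exists_gridWord {w n : ℕ} {u : Fin n → Fin 2} {x : BinSeq} (hx : x ∈ cylinder u) :
    ∃ F, cutRuns w x ∈ cylinder (u + gridWord w n F) := by
  refine ⟨fun j => cutRuns w x ((w + 1) * j) - x ((w + 1) * j), fun i => ?_⟩
  rw [Pi.add_apply, ← hx i, gridWord]
  split_ifs with h
  · simp only [Nat.mul_div_cancel' h]
    abel
  · rw [add_zero]
    by_contra H
    exact h (cutRuns_ne_iff.1 H).1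

variable {t : ℝ}

lemma realSum_univ_le (ht : 0 ≤ t) {w : ℕ} (hw : 2 ≤ w) (n : ℕ) :
    realSum Set.univ t n ≤ 2 ^ (n / (w + 1) + 1) * (((1 - 2 * (1 / 2) ^ w) ^ 2) ^ (-t)) ^ n *
      realSum (subshift (3 * w + 1)) t n := by
  set c : ℝ := (1 - 2 * (1 / 2) ^ w) ^ 2 with hc
  have hc0 : 0 < c := by
    have hp : (1 / 2 : ℝ) ^ w ≤ (1 / 2) ^ 2 :=
      pow_le_pow_of_le_one (by norm_num) (by norm_num) hw
    have : 0 < 1 - 2 * (1 / 2 : ℝ) ^ w := by linarith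
    positivity
  set D : ℝ := (c ^ (-t)) ^ n with hD
  have hD0 : 0 < D := by positivity
  have hu := hasPressure_fullP ht
  have hM := hasPressure_approxP (m := 3 * w + 1) (by omega) t
  have hpt : ∀ x : BinSeq, ENNReal.ofReal (prodWt n x) ^ t
      ≤ ENNReal.ofReal D * ENNReal.ofReal (prodWt n (cutRuns w x)) ^ t := by
    intro x
    rw [ofReal_rpow_prodWt ht, ofReal_rpow_prodWt ht, ← ENNReal.ofReal_mul hD0.le]
    refine ENNReal.ofReal_le_ofReal ?_
    have h1 := (isSurgery_cutRuns (by omega : 1 ≤ w) x).mul_prodWt_le (by omega) n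
    have h2 := Real.rpow_le_rpow (mul_nonneg (by positivity) (prodWt_nonneg n x)) h1 ht
    rw [Real.mul_rpow (by positivity) (prodWt_nonneg n x), ← hc] at h2
    have h3 : D * (c ^ n) ^ t = 1 := by
      rw [hD, ← Real.rpow_natCast c, ← Real.rpow_mul hc0.le, mul_comm (n : ℝ), Real.rpow_mul hc0.le,
        Real.rpow_natCast, ← mul_pow, ← Real.rpow_add hc0, neg_add_cancel, Real.rpow_zero, one_pow]
    calc prodWt n x ^ t = D * ((c ^ n) ^ t * prodWt n x ^ t) := by rw [← mul_assoc, h3, one_mul]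
      _ ≤ _ := mul_le_mul_of_nonneg_left h2 hD0.le
  have key : partitionSum Set.univ t n
      ≤ 2 ^ (n / (w + 1) + 1) * (ENNReal.ofReal D * partitionSum (subshift (3 * w + 1)) t n) := by
    set S : (Fin n → Fin 2) → ENNReal := fun v =>
      ⨆ x ∈ cylinder v ∩ subshift (3 * w + 1), ENNReal.ofReal (prodWt n x) ^ t with hS
    rw [partitionSum_eq, partitionSum_eq]
    calc _ ≤ ∑ u : Fin n → Fin 2, ∑ F, ENNReal.ofReal D * S (u + gridWord w n F) := by
          refine Finset.sum_le_sum fun u _ => iSup₂_le fun x hx => ?_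
          obtain ⟨F, hF⟩ := exists_gridWord (w := w) hx.1
          refine (hpt x).trans (le_trans ?_ (Finset.single_le_sum (fun _ _ => zero_le)
            (Finset.mem_univ F)))
          refine mul_le_mul' le_rfl ?_
          exact le_iSup₂_of_le (f := fun z (_ : z ∈ cylinder (u + gridWord w n F) ∩
            subshift (3 * w + 1)) => ENNReal.ofReal (prodWt n z) ^ t) (cutRuns w x)
            ⟨hF, cutRuns_mem_subshift (by omega) x⟩ le_rfl
      _ = ∑ F : Fin (n / (w + 1) + 1) → Fin 2, ENNReal.ofReal D * ∑ u, S u := by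
          rw [Finset.sum_comm]
          refine Finset.sum_congr rfl fun F _ => ?_
          rw [← Finset.mul_sum]
          congr 1
          exact Equiv.sum_comp (Equiv.addRight (gridWord w n F)) S
      _ = _ := by simp [hS]
  rw [← hu.ofReal_realSum, ← hM.ofReal_realSum, ← ENNReal.ofReal_mul hD0.le,
    show (2 : ENNReal) = ENNReal.ofReal 2 by simp, ← ENNReal.ofReal_pow two_pos.le,
    ← ENNReal.ofReal_mul (by positivity), ENNReal.ofReal_le_ofReal_iff
      (mul_nonneg (by positivity) (mul_nonneg hD0.le (hM.pos n).le)), ← mul_assoc] at key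
  exact key

lemma fullP_le_add (ht : 0 ≤ t) {w : ℕ} (hw : 2 ≤ w) : fullP t ≤
    Real.log 2 / (w + 1) - 2 * t * Real.log (1 - 2 * (1 / 2) ^ w) + approxP (3 * w + 1) t := by
  have hu := hasPressure_fullP ht
  have hM := hasPressure_approxP (m := 3 * w + 1) (by omega) t
  have hp : (1 / 2 : ℝ) ^ w ≤ (1 / 2) ^ 2 :=
    pow_le_pow_of_le_one (by norm_num) (by norm_num) hw
  have hc : 0 < 1 - 2 * (1 / 2 : ℝ) ^ w := by linarith
  have hd' : Tendsto (fun k : ℕ => (w + 1) * k) atTop atTop :=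
    tendsto_id.const_mul_atTop' (Nat.succ_pos w)
  have h1 := hu.tendsto.comp hd'
  have h2 : Tendsto (fun k : ℕ => Real.log 2 / (w + 1) / k + (Real.log 2 / (w + 1) -
      2 * t * Real.log (1 - 2 * (1 / 2) ^ w)) + Real.log (realSum (subshift (3 * w + 1)) t
      ((w + 1) * k)) / ((w + 1) * k : ℕ)) atTop
      (𝓝 (0 + (Real.log 2 / (w + 1) - 2 * t * Real.log (1 - 2 * (1 / 2) ^ w)) +
        approxP (3 * w + 1) t)) :=
    ((tendsto_const_div_atTop_nhds_zero_nat _).add_const _).add (hM.tendsto.comp hd')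
  rw [zero_add] at h2
  refine le_of_tendsto_of_tendsto h1 h2 ?_
  filter_upwards [eventually_gt_atTop 0] with k hk
  simp only [Function.comp]
  have h3 := realSum_univ_le ht hw ((w + 1) * k)
  rw [Nat.mul_div_cancel_left _ (Nat.succ_pos w)] at h3
  have h4 := Real.log_le_log (hu.pos _) h3
  rw [Real.log_mul (by positivity) (hM.pos _).ne', Real.log_mul (by positivity) (by positivity),
    Real.log_pow, Real.log_pow, Real.log_rpow (by positivity), Real.log_pow] at h4
  have hk' : (0 : ℝ) < ((w + 1) * k : ℕ) := by positivity
  refine (div_le_div_of_nonneg_right h4 hk'.le).trans_eq ?_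
  push_cast
  have : (k : ℝ) ≠ 0 := by positivity
  field_simp
  ring

lemma approxP_mono {m m' : ℕ} (hm : 1 ≤ m) (h : m ≤ m') (t : ℝ) : approxP m t ≤ approxP m' t :=
  (hasPressure_approxP hm t).le_of_subset (hasPressure_approxP (hm.trans h) t) (subshift_mono h)

lemma approxP_le_fullP {m : ℕ} (hm : 1 ≤ m) (ht : 0 ≤ t) : approxP m t ≤ fullP t :=
  (hasPressure_approxP hm t).le_of_subset (hasPressure_fullP ht) (Set.subset_univ _)

theorem tendsto_approxP (ht : 0 ≤ t) : Tendsto (fun m => approxP m t) atTop (𝓝 (fullP t)) := by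
  have h1 : Tendsto (fun w : ℕ => fullP t - (Real.log 2 / (w + 1) -
      2 * t * Real.log (1 - 2 * (1 / 2) ^ w))) atTop
      (𝓝 (fullP t - (0 - 2 * t * Real.log (1 - 2 * 0)))) := by
    refine tendsto_const_nhds.sub (Tendsto.sub ?_ (Tendsto.const_mul _ (Tendsto.log ?_ (by simp))))
    · exact_mod_cast (tendsto_const_div_atTop_nhds_zero_nat (Real.log 2)).comp (tendsto_add_atTop_nat 1)
    · exact tendsto_const_nhds.sub
        ((tendsto_pow_atTop_nhds_zero_of_lt_one (by norm_num) (by norm_num)).const_mul _)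
  simp only [mul_zero, sub_zero, Real.log_one] at h1
  rw [tendsto_order]
  refine ⟨fun a ha => ?_, fun a ha => ?_⟩
  · obtain ⟨w, hw, hw2⟩ := ((h1.eventually_const_lt ha).and (eventually_ge_atTop 2)).exists
    filter_upwards [eventually_ge_atTop (3 * w + 1)] with m hm
    have := fullP_le_add ht hw2
    have := approxP_mono (by omega) hm t
    linarith
  · filter_upwards [eventually_ge_atTop 1] with m hm
    exact (approxP_le_fullP hm ht).trans_lt ha

end Surgery

/-! ### Long runs and negative parameters -/

section NegativeParameters

/-- The sequence `0^m 1^m 0^m 1^m ⋯`. -/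
def blocks (m : ℕ) : BinSeq := fun i => Fin.ofNat 2 (i / m)

lemma blocks_mem_subshift {m : ℕ} (hm : 1 ≤ m) : blocks m ∈ subshift m := by
  intro l a H
  have h := (H 0 (Nat.zero_le m)).trans (H m le_rfl).symm
  simp only [blocks, Fin.ext_iff, Fin.val_ofNat, add_zero] at h
  rw [Nat.add_div_right _ hm] at h
  omega

lemma prod_range_mul_pow (c : ℝ) (m : ℕ) :
    ∏ l ∈ Finset.range m, c * ((1 / 2) ^ (m - l)) ^ 2 = (c * (1 / 2) ^ (m + 1)) ^ m := by
  induction m with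
  | zero => simp
  | succ m ih =>
    rw [Finset.prod_range_succ']
    simp only [Nat.add_sub_add_right, Nat.sub_zero]
    rw [ih, mul_pow, mul_pow, ← pow_mul, ← pow_mul, ← pow_mul,
      show (m + 1 + 1) * (m + 1) = (m + 1) * m + (m + 1) * 2 by ring, pow_add _ ((m + 1) * m),
      pow_succ c]
    ring

lemma prodWt_blocks_le {m : ℕ} (hm : 1 ≤ m) (k : ℕ) :
    prodWt (m * k) (blocks m) ≤ ((20 * (1 / 2) ^ (m + 1)) ^ m) ^ k := by
  induction k with
  | zero => simp
  | succ k ih =>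
    rw [mul_add_one, prodWt_add, pow_succ]
    refine mul_le_mul ih ?_ (prodWt_nonneg _ _) (by positivity)
    rw [← prod_range_mul_pow]
    refine Finset.prod_le_prod (fun _ _ => sw_nonneg _) fun l hl => ?_
    rw [Finset.mem_range] at hl
    rw [← wt_fold]
    refine (wt_le _).trans ?_
    have h : fold (shift l (shift (m * k) (blocks m))) ≤ (1 / 2) ^ (m - l) := by
      refine fold_le_of_run fun i hi => ?_
      simp only [shift, blocks]
      rw [Nat.add_mul_div_left _ _ hm, Nat.add_mul_div_left _ _ hm, Nat.div_eq_of_lt (by omega),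
        Nat.div_eq_of_lt (by omega)]
    have := fold_nonneg (shift l (shift (m * k) (blocks m)))
    gcongr

lemma le_approxP_of_neg {m : ℕ} (hm : 1 ≤ m) {t : ℝ} (ht : t < 0) :
    t * (Real.log 20 - (m + 1) * Real.log 2) ≤ approxP m t := by
  have hP := hasPressure_approxP hm t
  set b : ℝ := 20 * (1 / 2) ^ (m + 1) with hb
  have hb0 : 0 < b := by positivity
  have h := hP.ge_of_forall (d := m) hm (A := 1) (ρ := (b ^ m) ^ t) one_pos (by positivity)
    fun k => by
      have h1 := le_partitionSum (blocks_mem_subshift hm) t (m * k)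
      have h0 := prodWt_pos (blocks_mem_subshift hm) (m * k)
      rw [← hP.ofReal_realSum, ENNReal.ofReal_rpow_of_pos h0,
        ENNReal.ofReal_le_ofReal_iff (hP.pos _).le] at h1
      refine le_trans ?_ h1
      rw [one_mul, ← Real.rpow_natCast, ← Real.rpow_mul (by positivity), mul_comm t,
        Real.rpow_mul (by positivity), Real.rpow_natCast]
      exact Real.rpow_le_rpow_of_nonpos h0 (prodWt_blocks_le hm k) ht.le
  rw [Real.log_rpow (by positivity), Real.log_pow, hb, Real.log_mul (by norm_num) (by positivity),
    Real.log_pow, one_div, Real.log_inv] at h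
  refine le_trans (le_of_eq ?_) h
  have : (m : ℝ) ≠ 0 := by positivity
  push_cast
  field_simp
  ring

lemma tendsto_approxP_of_neg {t : ℝ} (ht : t < 0) :
    Tendsto (fun m => approxP m t) atTop atTop := by
  have h : Tendsto (fun m : ℕ => -t * Real.log 2 * (m : ℝ) + t * (Real.log 20 - Real.log 2))
      atTop atTop := by
    refine tendsto_atTop_add_const_right _ _ (tendsto_natCast_atTop_atTop.const_mul_atTop ?_)
    exact mul_pos (neg_pos.2 ht) (Real.log_pos one_lt_two)
  refine tendsto_atTop_mono' _ ?_ h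
  filter_upwards [eventually_ge_atTop 1] with m hm
  refine le_trans (le_of_eq ?_) (le_approxP_of_neg hm ht)
  ring

end NegativeParameters

/-! ### Bounds for the pressure by sub- and supersolutions -/

section Bounds

variable {t : ℝ}

lemma letterOp_le {X : Set BinSeq} {H : BinSeq → ℝ} (hH : ∀ z, 0 ≤ H z) (y : BinSeq) :
    letterOp X t H y ≤ sw (cons 0 y) ^ t * H (cons 0 y) + sw (cons 1 y) ^ t * H (cons 1 y) := by
  rw [letterOp, Fin.sum_univ_two]
  have h : ∀ z, 0 ≤ sw z ^ t * H z := fun z => mul_nonneg (Real.rpow_nonneg (sw_nonneg z) t) (hH z)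
  exact add_le_add (Set.indicator_le_self' (fun z _ => h z) _)
    (Set.indicator_le_self' (fun z _ => h z) _)

lemma letterOp_univ (H : BinSeq → ℝ) (y : BinSeq) : letterOp Set.univ t H y =
    sw (cons 0 y) ^ t * H (cons 0 y) + sw (cons 1 y) ^ t * H (cons 1 y) := by
  rw [letterOp, Fin.sum_univ_two, Set.indicator_univ]

lemma fullP_le_of_forall (ht : 0 ≤ t) {B : ℝ} (h : ∀ m, 1 ≤ m → approxP m t ≤ B) : fullP t ≤ B :=
  le_of_tendsto (tendsto_approxP ht) ((eventually_ge_atTop 1).mono h)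

/-- A bounded nonnegative subsolution that does not vanish everywhere bounds the pressure from
below. -/
lemma le_fullP_of_subsolution (ht : 0 ≤ t) {H : BinSeq → ℝ} {C ρ : ℝ} {y : BinSeq} (hy : 0 < H y)
    (hC : ∀ z, H z ≤ C) (hρ : 0 < ρ) (h : ∀ z, ρ * H z ≤ letterOp Set.univ t H z) :
    Real.log ρ ≤ fullP t := by
  have hP := hasPressure_fullP ht
  have hC0 : 0 < C := hy.trans_le (hC y)
  have := hP.ge_of_forall one_pos (A := H y / C) (ρ := ρ) (by positivity) hρ fun k => by
    rw [one_mul]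
    refine le_trans ?_ (iterate_letterOp_le_realSum (fun _ _ _ => Set.mem_univ _) hP k
      (Set.mem_univ y))
    have h1 := le_iterate_letterOp hρ.le (fun z _ => h z) k y (Set.mem_univ y)
    have h2 := iterate_letterOp_mono (X := Set.univ) (t := t) (H := H) (G := fun z => C * 1)
      (fun z _ => by rw [mul_one]; exact hC z) k y (Set.mem_univ y)
    rw [iterate_letterOp_const_mul k C fun _ => 1] at h2
    rw [div_mul_eq_mul_div, div_le_iff₀ hC0]
    linarith
  simpa using this

lemma fullP_eq_log_two (ht : 0 ≤ t) (h : ∀ y, sw (cons 0 y) ^ t + sw (cons 1 y) ^ t = 2) :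
    fullP t = Real.log 2 := by
  have h1 : ∀ y, letterOp Set.univ t (fun _ => 1) y = 2 := fun y => by
    rw [letterOp_univ, mul_one, mul_one, h]
  refine le_antisymm (fullP_le_of_forall ht fun m hm => ?_) ?_
  · simpa using approxP_le_of_iterate_le hm one_pos two_pos fun y => (h1 y).le
  · exact le_fullP_of_subsolution ht (H := fun _ => 1) (C := 1) (y := alt 0) one_pos
      (fun _ => le_rfl) two_pos fun z => by rw [h1, mul_one]

lemma fullP_zero : fullP 0 = Real.log 2 :=
  fullP_eq_log_two le_rfl fun y => by rw [Real.rpow_zero, Real.rpow_zero]; norm_num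

lemma fullP_one : fullP 1 = Real.log 2 :=
  fullP_eq_log_two zero_le_one fun y => by rw [Real.rpow_one, Real.rpow_one, sw_cons_add]

end Bounds

/-! ### The asymptote at infinity -/

section Asymptote

lemma sw_eq_mul (a : Fin 2) (y : BinSeq) :
    sw y = 2 * sw (cons a y) * (2 - sw (cons a y)) := by
  have h1 := sw_cons_add y
  have h2 := sw_cons_mul y
  obtain rfl | rfl : a = 0 ∨ a = 1 := by
    by_cases h : a = 0
    · exact Or.inl h
    · exact Or.inr (fin2_eq_one_of_ne h)
  · rw [show 2 - sw (cons 0 y) = sw (cons 1 y) by linarith, mul_assoc, h2]; ring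
  · rw [show 2 - sw (cons 1 y) = sw (cons 0 y) by linarith, mul_assoc, mul_comm (sw _), h2]; ring

lemma sq_sw_mul_sw_le (a : Fin 2) (y : BinSeq) : sw (cons a y) ^ 2 * sw y ≤ (3 / 2) ^ 3 := by
  rw [sw_eq_mul a y]
  set c := sw (cons a y)
  have : 0 ≤ (c - 3 / 2) ^ 2 * ((c + 1 / 2) ^ 2 + 1 / 2) := by positivity
  linarith

lemma sq_sw_mul_sw_le_two {a : Fin 2} {y : BinSeq} (h : a = y 0) :
    sw (cons a y) ^ 2 * sw y ≤ 2 := by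
  have hc0 := sw_nonneg (cons a y)
  have hc1 : sw (cons a y) ≤ 1 := by
    rw [← wt_fold, fold_cons_same h]
    refine (wt_mono (by linarith [fold_nonneg y]) (y := 1 / 4) (by linarith [fold_le_half y])
      (by norm_num)).trans_eq ?_
    rw [wt, show 2 * Real.pi * (1 / 4) = Real.pi / 2 by ring, Real.cos_pi_div_two, sub_zero]
  rw [sw_eq_mul a y]
  set c := sw (cons a y)
  have h1 : c ^ 3 ≤ 1 := pow_le_one₀ hc0 hc1
  have : 0 ≤ (1 - c) * ((1 - c ^ 3) + c + c ^ 2) :=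
    mul_nonneg (by linarith) (by linarith [sq_nonneg c])
  linarith

variable {t : ℝ}

/-- The function `f^{-t/3}` is a supersolution, because `f(x)^2 f(2x) ≤ (3/2)^3` and, when the
first two binary digits of `x` agree, `f(x)^2 f(2x) ≤ 2`. -/
lemma approxP_le_log (ht : 0 ≤ t) {m : ℕ} (hm : 1 ≤ m) :
    approxP m t ≤ Real.log ((3 / 2) ^ t + 2 ^ (t / 3)) := by
  have ht3 : 0 ≤ t / 3 := by positivity
  refine approxP_le_of_supersolution hm (H := fun z => sw z ^ (-(t / 3)))
    (c := 2 ^ (-(t / 3))) (C := minWt m ^ (-(t / 3))) (by positivity)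
    (fun y hy => ⟨Real.rpow_le_rpow_of_nonpos (sw_pos hy) (sw_le_two y) (by linarith),
      Real.rpow_le_rpow_of_nonpos (minWt_pos m) (minWt_le_sw hy) (by linarith)⟩) (by positivity)
    fun y hy => ?_
  refine (letterOp_le (fun z => Real.rpow_nonneg (sw_nonneg z) _) y).trans ?_
  have hy0 := sw_pos hy
  have key : ∀ (a : Fin 2) (E : ℝ), sw (cons a y) ^ 2 * sw y ≤ E →
      sw (cons a y) ^ t * sw (cons a y) ^ (-(t / 3)) ≤ E ^ (t / 3) * sw y ^ (-(t / 3)) := by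
    intro a E hE
    have hc : 0 < sw (cons a y) := by
      refine (sw_nonneg _).lt_of_ne fun H => ?_
      rw [sw_eq_mul a y, ← H] at hy0
      simp at hy0
    have h1 : sw (cons a y) ^ t * sw (cons a y) ^ (-(t / 3))
        = (sw (cons a y) ^ 2 * sw y) ^ (t / 3) * sw y ^ (-(t / 3)) := by
      rw [Real.mul_rpow (by positivity) hy0.le, mul_assoc, ← Real.rpow_add hy0, add_neg_cancel,
        Real.rpow_zero, mul_one, ← Real.rpow_add hc, ← Real.rpow_natCast, ← Real.rpow_mul hc.le]
      congr 1
      push_cast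
      ring
    rw [h1]
    gcongr
  have e : ((3 / 2 : ℝ) ^ 3) ^ (t / 3) = (3 / 2) ^ t := by
    rw [← Real.rpow_natCast, ← Real.rpow_mul (by norm_num)]
    congr 1
    push_cast
    ring
  rw [add_mul]
  by_cases h0 : (0 : Fin 2) = y 0
  · have h1 := key 0 2 (sq_sw_mul_sw_le_two h0)
    have h2 := key 1 _ (sq_sw_mul_sw_le 1 y)
    rw [e] at h2
    linarith
  · have h1 := key 1 2 (sq_sw_mul_sw_le_two (fin2_eq_one_of_ne (Ne.symm h0)).symm)
    have h2 := key 0 _ (sq_sw_mul_sw_le 0 y)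
    rw [e] at h2
    linarith

lemma mul_log_le_fullP (ht : 0 ≤ t) : Real.log (3 / 2) * t ≤ fullP t := by
  have hP := hasPressure_fullP ht
  have := hP.ge_of_forall one_pos (A := 1) (ρ := (3 / 2) ^ t) one_pos (by positivity) fun k => by
    have := ofReal_le_partitionSum (a := 0) (Set.mem_univ _) t k
    rw [← hP.ofReal_realSum, ENNReal.ofReal_le_ofReal_iff (hP.pos _).le] at this
    rwa [one_mul, one_mul]
  rw [Real.log_rpow (by norm_num)] at this
  simpa [mul_comm] using this

lemma fullP_le (ht : 0 ≤ t) :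
    fullP t ≤ Real.log (3 / 2) * t + ((2 : ℝ) ^ (1 / 3 : ℝ) / (3 / 2)) ^ t := by
  refine (fullP_le_of_forall ht fun m hm => approxP_le_log ht hm).trans ?_
  have h1 : (3 / 2 : ℝ) ^ t + 2 ^ (t / 3)
      = (3 / 2) ^ t * (1 + ((2 : ℝ) ^ (1 / 3 : ℝ) / (3 / 2)) ^ t) := by
    rw [mul_add, mul_one, ← Real.mul_rpow (by norm_num) (by positivity),
      mul_div_cancel₀ _ (by norm_num : (3 / 2 : ℝ) ≠ 0), ← Real.rpow_mul two_pos.le]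
    congr 2
    ring
  rw [h1, Real.log_mul (by positivity) (by positivity), Real.log_rpow (by norm_num), mul_comm t]
  have h2 := Real.log_le_sub_one_of_pos
    (by positivity : 0 < 1 + ((2 : ℝ) ^ (1 / 3 : ℝ) / (3 / 2)) ^ t)
  linarith

lemma tendsto_fullP_sub : Tendsto (fun t => fullP t - Real.log (3 / 2) * t) atTop (𝓝 0) := by
  have hr : (2 : ℝ) ^ (1 / 3 : ℝ) / (3 / 2) < 1 := by
    rw [div_lt_one (by norm_num)]
    refine lt_of_pow_lt_pow_left₀ 3 (by norm_num) ?_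
    rw [← Real.rpow_natCast, ← Real.rpow_mul two_pos.le]
    norm_num
  have h := tendsto_rpow_atTop_of_base_lt_one _
    (lt_of_lt_of_le (by norm_num) (by positivity : (0 : ℝ) ≤ (2 : ℝ) ^ (1 / 3 : ℝ) / (3 / 2))) hr
  refine tendsto_of_tendsto_of_tendsto_of_le_of_le' tendsto_const_nhds h ?_ ?_
  · filter_upwards [eventually_ge_atTop 0] with t ht
    linarith [mul_log_le_fullP ht]
  · filter_upwards [eventually_ge_atTop 0] with t ht
    linarith [fullP_le ht]

end Asymptote

/-! ### The right derivative at the origin -/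

section Derivative

variable {t : ℝ}

/-- The function `f^t` is a subsolution with `ρ = 2^{1-t}`, by the inequality between the
arithmetic and the geometric mean. -/
lemma le_fullP_of_amgm (ht : 0 ≤ t) : Real.log 2 - t * Real.log 2 ≤ fullP t := by
  have h := le_fullP_of_subsolution ht (H := fun z => sw z ^ t) (C := 2 ^ t) (y := alt 0)
    (ρ := 2 * (2 ^ t)⁻¹) (by simp only [sw_alt]; positivity)
    (fun z => Real.rpow_le_rpow (sw_nonneg z) (sw_le_two z) ht) (by positivity) fun z => by
      have h1 : sw (cons 0 z) ^ t * sw (cons 1 z) ^ t = sw z ^ t * (2 ^ t)⁻¹ := by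
        rw [← Real.mul_rpow (sw_nonneg _) (sw_nonneg _), sw_cons_mul,
          Real.div_rpow (sw_nonneg _) two_pos.le, div_eq_mul_inv]
      rw [letterOp_univ]
      linarith [two_mul_le_add_sq (sw (cons 0 z) ^ t) (sw (cons 1 z) ^ t)]
  rwa [Real.log_mul (by norm_num) (by positivity), Real.log_inv, Real.log_rpow two_pos,
    ← sub_eq_add_neg] at h

lemma sq_log_add_sq_log_le {c d : ℝ} (hc : 0 < c) (hd : 0 < d) (h : c + d = 2) :
    Real.log c ^ 2 + Real.log d ^ 2 ≤ 5 / 4 * Real.log (2 * c * d) ^ 2 + 26 := by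
  wlog hcd : c ≤ d generalizing c d
  · have := this hd hc (by linarith) (by linarith)
    rw [show 2 * c * d = 2 * d * c by ring]
    linarith
  have hl : Real.log 2 ≤ 1 := (Real.log_le_sub_one_of_pos two_pos).trans_eq (by norm_num)
  have hl0 := Real.log_pos one_lt_two
  have hA := Real.log_nonpos hc.le (by linarith : c ≤ 1)
  have hB0 := Real.log_nonneg (by linarith : 1 ≤ d)
  have hB1 := (Real.log_le_log hd (by linarith : d ≤ 2)).trans hl
  rw [mul_assoc, Real.log_mul (by norm_num) (by positivity), Real.log_mul hc.ne' hd.ne']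
  set A := Real.log c
  set B := Real.log d
  set l := Real.log 2
  have h1 : 0 ≤ -A * (2 - (l + B)) := mul_nonneg (by linarith) (by linarith)
  have h2 : B ^ 2 ≤ 1 := pow_le_one₀ hB0 hB1
  have h3 : (l + (A + B)) ^ 2 = A ^ 2 + 2 * (A * (l + B)) + (l + B) ^ 2 := by ring
  rw [h3]
  linarith [sq_nonneg (A + 10), sq_nonneg (l + B)]

/-- For small `t` the function `f^t + δ (log f)^2` with `δ` of order `ε t` is a supersolution with
`ρ = 2^{1-t} (1 + ε t)`: the defect of `f^t` is quadratic in `t log f`, and the second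
summand, on which the operator has a growth rate less than `2^{1-t}`, absorbs it near the
zeros of `f`. -/
lemma approxP_le_of_small {ε : ℝ} (hε : 0 < ε) (ht : 0 < t) (ht1 : t ≤ 1 / 26)
    (ht2 : t ≤ ε / 1280) {m : ℕ} (hm : 1 ≤ m) :
    approxP m t ≤ Real.log 2 - t * Real.log 2 + ε * t := by
  set δ : ℝ := ε * t / 40 with hδ
  have hδ0 : 0 < δ := by positivity
  set τ : ℝ := 2 ^ t with hτ
  have hτ0 : 0 < τ := by positivity
  have hτ1 : τ ≤ 1 + t := by
    have := rpow_one_add_le_one_add_mul_self (s := 1) (by norm_num) ht.le (by linarith)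
    rwa [one_add_one_eq_two, mul_one] at this
  have hτi : 8 / 9 ≤ τ⁻¹ := by
    rw [le_inv_comm₀ (by norm_num) hτ0]; linarith
  have hρ : 0 < 2 * τ⁻¹ * (1 + ε * t) := by positivity
  set M : ℝ := |Real.log (minWt m)| + Real.log 2
  have hl2 := Real.log_pos one_lt_two
  have h := approxP_le_of_supersolution (t := t) hm (H := fun z => sw z ^ t + δ * Real.log (sw z) ^ 2)
    (c := minWt m ^ t) (C := 2 ^ t + δ * M ^ 2) (Real.rpow_pos_of_pos (minWt_pos m) t)
    (fun y hy => ?_) hρ fun y hy => ?_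
  · rw [Real.log_mul (by positivity) (by positivity), Real.log_mul (by norm_num) (by positivity),
      Real.log_inv, Real.log_rpow two_pos] at h
    have := Real.log_le_sub_one_of_pos (by positivity : 0 < 1 + ε * t)
    linarith
  · have h1 := minWt_le_sw hy
    have h2 := Real.log_le_log (minWt_pos m) h1
    have h3 := Real.log_le_log (sw_pos hy) (sw_le_two y)
    have h4 : |Real.log (sw y)| ≤ M := by
      rw [abs_le]
      constructor <;> linarith [neg_abs_le (Real.log (minWt m)), abs_nonneg (Real.log (minWt m))]
    refine ⟨?_, ?_⟩
    · exact (Real.rpow_le_rpow (minWt_pos m).le h1 ht.le).trans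
        (le_add_of_nonneg_right (by positivity))
    · refine add_le_add (Real.rpow_le_rpow (sw_nonneg y) (sw_le_two y) ht.le) ?_
      rw [← sq_abs]
      gcongr
  · refine (letterOp_le (fun z => add_nonneg (Real.rpow_nonneg (sw_nonneg z) _) (by positivity))
      y).trans ?_
    have hs := sw_pos hy
    have hsum := sw_cons_add y
    have hmul := sw_cons_mul y
    have hc0 := sw_nonneg (cons 0 y)
    have hd0 := sw_nonneg (cons 1 y)
    have hc2 := sw_le_two (cons 0 y)
    have hd2 := sw_le_two (cons 1 y)
    set c := sw (cons 0 y)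
    set d := sw (cons 1 y)
    set s := sw y
    replace hc0 : 0 < c := hc0.lt_of_ne fun H => by rw [← H, zero_mul] at hmul; linarith
    replace hd0 : 0 < d := hd0.lt_of_ne fun H => by rw [← H, mul_zero] at hmul; linarith
    set Q := Real.log c ^ 2 + Real.log d ^ 2 with hQ
    set G := Real.log s ^ 2 with hG
    have hQG : Q ≤ 5 / 4 * G + 26 := by
      have := sq_log_add_sq_log_le hc0 hd0 hsum
      rwa [show 2 * c * d = s by rw [mul_assoc, hmul]; ring] at this
    -- the defect of the subsolution `f^t`
    have hcd : c ^ t * d ^ t = s ^ t * τ⁻¹ := by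
      rw [← Real.mul_rpow hc0.le hd0.le, hmul, Real.div_rpow hs.le two_pos.le, div_eq_mul_inv]
    have hdef : (c ^ t - d ^ t) ^ 2 ≤ 4 * t ^ 2 * Q := by
      have h1 : |c ^ t - d ^ t| ≤ τ * |Real.log c * t - Real.log d * t| := by
        rw [hτ, Real.rpow_def_of_pos hc0, Real.rpow_def_of_pos hd0, Real.rpow_def_of_pos two_pos]
        exact abs_exp_sub_exp_le
          (mul_le_mul_of_nonneg_right (Real.log_le_log hc0 hc2) ht.le)
          (mul_le_mul_of_nonneg_right (Real.log_le_log hd0 hd2) ht.le)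
      have h2 : (c ^ t - d ^ t) ^ 2 ≤ (τ * |Real.log c * t - Real.log d * t|) ^ 2 := by
        rw [← sq_abs]; gcongr
      rw [mul_pow, sq_abs, ← sub_mul, mul_pow] at h2
      have h3 : τ ^ 2 ≤ 2 := by
        calc τ ^ 2 ≤ (1 + 1 / 26) ^ 2 := by gcongr; linarith
          _ ≤ 2 := by norm_num
      have h4 : (Real.log c - Real.log d) ^ 2 ≤ 2 * Q := by
        rw [hQ]; linarith [sq_nonneg (Real.log c + Real.log d)]
      calc _ ≤ τ ^ 2 * ((Real.log c - Real.log d) ^ 2 * t ^ 2) := h2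
        _ ≤ 2 * (2 * Q * t ^ 2) := by gcongr
        _ = _ := by ring
    have hQ0 : 0 ≤ Q := by positivity
    have hG0 : 0 ≤ G := by positivity
    have hct : c ^ t ≤ 9 / 8 := by
      refine (Real.rpow_le_rpow hc0.le hc2 ht.le).trans ?_
      linarith
    have hdt : d ^ t ≤ 9 / 8 := by
      refine (Real.rpow_le_rpow hd0.le hd2 ht.le).trans ?_
      linarith
    have h1 : c ^ t * Real.log c ^ 2 + d ^ t * Real.log d ^ 2 ≤ 9 / 8 * Q := by
      rw [hQ, mul_add]; gcongr
    have h2 : 4 * t ^ 2 ≤ δ / 8 := by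
      rw [hδ, sq]
      have : t * t ≤ ε / 1280 * t := by gcongr
      linarith
    have h3 : (c ^ t - d ^ t) ^ 2 + δ * (c ^ t * Real.log c ^ 2 + d ^ t * Real.log d ^ 2)
        ≤ 5 / 4 * δ * (5 / 4 * G + 26) := by
      calc _ ≤ 4 * t ^ 2 * Q + δ * (9 / 8 * Q) := by gcongr
        _ ≤ δ / 8 * Q + δ * (9 / 8 * Q) := by gcongr
        _ = 5 / 4 * δ * Q := by ring
        _ ≤ _ := by gcongr
    have h4 : 5 / 4 * δ * (5 / 4 * G + 26) ≤ 16 / 9 * (ε * t * s ^ t) + 16 / 9 * (δ * G) := by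
      have e : ε * t = 40 * δ := by rw [hδ]; ring
      rw [e]
      have hst : 0 ≤ s ^ t := by positivity
      have h5 : 5 / 4 * (5 / 4 * G + 26) ≤ 16 / 9 * (40 * s ^ t) + 16 / 9 * G := by
        rcases le_or_gt 169 G with hG1 | hG1
        · linarith
        · have h6 : |Real.log s| < 13 := by
            refine lt_of_pow_lt_pow_left₀ 2 (by norm_num) ?_
            rw [sq_abs]
            linarith
          have h7 : 1 / 2 ≤ s ^ t := by
            rw [Real.rpow_def_of_pos hs]
            have h8 := Real.add_one_le_exp (Real.log s * t)
            have h9 : -13 * t ≤ Real.log s * t := by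
              gcongr
              linarith [(abs_lt.1 h6).1]
            linarith
          linarith
      calc _ = δ * (5 / 4 * (5 / 4 * G + 26)) := by ring
        _ ≤ δ * (16 / 9 * (40 * s ^ t) + 16 / 9 * G) := by gcongr
        _ = _ := by ring
    have h5 : 16 / 9 * (ε * t * s ^ t) + 16 / 9 * (δ * G)
        ≤ 2 * τ⁻¹ * (ε * t * s ^ t + (1 + ε * t) * (δ * G)) := by
      have hst : 0 ≤ s ^ t := by positivity
      have h6 : δ * G ≤ (1 + ε * t) * (δ * G) :=
        le_mul_of_one_le_left (by positivity) (by linarith [mul_pos hε ht])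
      calc _ = 2 * (8 / 9) * (ε * t * s ^ t + δ * G) := by ring
        _ ≤ _ := by gcongr
    have h6 : c ^ t * (c ^ t + δ * Real.log c ^ 2) + d ^ t * (d ^ t + δ * Real.log d ^ 2)
        = 2 * (c ^ t * d ^ t) + ((c ^ t - d ^ t) ^ 2 +
          δ * (c ^ t * Real.log c ^ 2 + d ^ t * Real.log d ^ 2)) := by ring
    rw [h6, hcd]
    linarith

lemma hasDerivWithinAt_fullP :
    HasDerivWithinAt fullP (-Real.log 2) (Set.Ici 0) 0 := by
  rw [hasDerivWithinAt_iff_isLittleO, Asymptotics.isLittleO_iff]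
  intro ε hε
  have hmem : Set.Iio (min (1 / 26) (ε / 1280)) ∈ 𝓝 (0 : ℝ) :=
    Iio_mem_nhds (lt_min (by norm_num) (by positivity))
  filter_upwards [self_mem_nhdsWithin, mem_nhdsWithin_of_mem_nhds hmem] with t ht ht'
  rw [Set.mem_Ici] at ht
  rw [fullP_zero, sub_zero, smul_eq_mul, Real.norm_eq_abs, Real.norm_eq_abs, abs_of_nonneg ht,
    abs_le]
  rcases ht.eq_or_lt with rfl | ht0
  · simp [fullP_zero]
  · have h1 := le_fullP_of_amgm ht
    have h2 := fullP_le_of_forall ht fun m hm => approxP_le_of_small hε ht0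
      (ht'.le.trans (min_le_left _ _)) (ht'.le.trans (min_le_right _ _)) hm
    have : 0 < ε * t := by positivity
    constructor <;> linarith

end Derivative

/-! ### The pressure as an extended real -/

section Extended

lemma pressure_ne_bot (t : ℝ) : pressure t ≠ ⊥ := by
  rcases lt_or_ge t 0 with ht | ht
  · rw [pressure_of_neg ht]; exact top_ne_bot
  · rw [pressure_eq ht]; exact EReal.coe_ne_bot _

lemma tendsto_pressureSeq_univ (t : ℝ) :
    Tendsto (pressureSeq Set.univ t) atTop (𝓝 (pressure t)) := by
  rcases lt_or_ge t 0 with ht | ht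
  · rw [pressure_of_neg ht]; exact tendsto_pressureSeq_of_neg ht
  · rw [pressure_eq ht]; exact (hasPressure_fullP ht).tendsto_pressureSeq

lemma pressure_convex {s t a b : ℝ} (ha : 0 ≤ a) (hb : 0 ≤ b) (hab : a + b = 1) :
    pressure (a * s + b * t) ≤ (a : EReal) * pressure s + (b : EReal) * pressure t := by
  rcases ha.eq_or_lt with rfl | ha
  · rw [zero_add] at hab
    simp [hab]
  rcases hb.eq_or_lt with rfl | hb
  · rw [add_zero] at hab
    simp [hab]
  have hmul : ∀ {c r : ℝ}, 0 < c → (c : EReal) * pressure r ≠ ⊥ := fun {c r} hc => by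
    rcases lt_or_ge r 0 with hr | hr
    · rw [pressure_of_neg hr, EReal.coe_mul_top_of_pos hc]; exact top_ne_bot
    · rw [pressure_eq hr, ← EReal.coe_mul]; exact EReal.coe_ne_bot _
  rcases lt_or_ge s 0 with hs | hs
  · rw [pressure_of_neg hs, EReal.coe_mul_top_of_pos ha, EReal.top_add_of_ne_bot (hmul hb)]
    exact le_top
  rcases lt_or_ge t 0 with ht | ht
  · rw [pressure_of_neg ht, EReal.coe_mul_top_of_pos hb, EReal.add_top_of_ne_bot (hmul ha)]
    exact le_top
  have hst : 0 ≤ a * s + b * t := by positivity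
  rw [pressure_eq hs, pressure_eq ht, pressure_eq hst, ← EReal.coe_mul, ← EReal.coe_mul,
    ← EReal.coe_add, EReal.coe_le_coe_iff]
  exact (hasPressure_fullP hs).convex (hasPressure_fullP ht) ha hb hab (hasPressure_fullP hst)

lemma convexOn_approxP {m : ℕ} (hm : 1 ≤ m) : ConvexOn ℝ Set.univ (approxP m) := by
  rw [convexOn_iff_forall_pos]
  exact ⟨convex_univ, fun s _ t _ a b ha hb hab => (hasPressure_approxP hm s).convex
    (hasPressure_approxP hm t) ha hb hab (hasPressure_approxP hm _)⟩

lemma tendsto_pressureApprox (t : ℝ) :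
    Tendsto (fun m : ℕ => pressureApprox m t) atTop (𝓝 (pressure t)) := by
  have h : Tendsto (fun m : ℕ => (approxP m t : EReal)) atTop (𝓝 (pressure t)) := by
    rcases lt_or_ge t 0 with ht | ht
    · rw [pressure_of_neg ht]
      exact EReal.tendsto_coe_nhds_top_iff.2 (tendsto_approxP_of_neg ht)
    · rw [pressure_eq ht]
      exact (continuous_coe_real_ereal.tendsto _).comp (tendsto_approxP ht)
  refine h.congr' ?_
  filter_upwards [eventually_ge_atTop 1] with m hm
  exact (pressureApprox_eq hm t).symm

end Extended

end

end ThueMorse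

open ThueMorse in
theorem proposition7p1 :
    -- `p : ℝ → ℝ ∪ {+∞}` is well defined: the defining limit exists and is not `-∞`
    (∀ t : ℝ, Tendsto (pressureSeq Set.univ t) atTop (𝓝 (pressure t)) ∧ pressure t ≠ ⊥) ∧
    -- `p` is convex
    (∀ s t a b : ℝ, 0 ≤ a → 0 ≤ b → a + b = 1 →
      pressure (a * s + b * t) ≤ (a : EReal) * pressure s + (b : EReal) * pressure t) ∧
    -- each `p_m`, `m ≥ 1`, is a well-defined, real-valued, convex, real-analytic function on `ℝ`
    (∀ m : ℕ, 1 ≤ m →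
      (∀ t : ℝ, Tendsto (pressureSeq (subshift m) t) atTop (𝓝 (pressureApprox m t)) ∧
        pressureApprox m t ≠ ⊥ ∧ pressureApprox m t ≠ ⊤) ∧
      ConvexOn ℝ Set.univ (fun t : ℝ => (pressureApprox m t).toReal) ∧
      AnalyticOnNhd ℝ (fun t : ℝ => (pressureApprox m t).toReal) Set.univ) ∧
    -- `p_m → p` pointwise
    (∀ t : ℝ, Tendsto (fun m : ℕ => pressureApprox m t) atTop (𝓝 (pressure t))) ∧
    -- the domain of `p`
    {t : ℝ | pressure t < ⊤} = Set.Ici 0 ∧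
    pressure 0 = (Real.log 2 : ℝ) ∧
    pressure 1 = (Real.log 2 : ℝ) ∧
    -- the asymptote at `+∞`
    Tendsto (fun t : ℝ => pressure t - ((Real.log (3 / 2) * t : ℝ) : EReal)) atTop (𝓝 0) ∧
    -- the right derivative at `0`
    HasDerivWithinAt (fun t : ℝ => (pressure t).toReal) (-Real.log 2) (Set.Ici 0) 0 := by
  refine ⟨fun t => ⟨tendsto_pressureSeq_univ t, pressure_ne_bot t⟩,
    fun s t a b ha hb hab => pressure_convex ha hb hab,
    fun m hm => ⟨fun t => ?_, convexOn_approxP hm, fun t _ => analyticAt_approxP hm t⟩,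
    tendsto_pressureApprox, ?_, ?_, ?_, ?_, hasDerivWithinAt_fullP⟩
  · rw [pressureApprox_eq hm]
    exact ⟨(hasPressure_approxP hm t).tendsto_pressureSeq, EReal.coe_ne_bot _, EReal.coe_ne_top _⟩
  · ext t
    rw [Set.mem_ofPred_eq, Set.mem_Ici]
    rcases lt_or_ge t 0 with ht | ht
    · simp [pressure_of_neg ht, ht]
    · simp [pressure_eq ht, ht, EReal.coe_lt_top]
  · rw [pressure_eq le_rfl, fullP_zero]
  · rw [pressure_eq zero_le_one, fullP_one]
  · refine ((continuous_coe_real_ereal.tendsto 0).comp tendsto_fullP_sub).congr' ?_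
    filter_upwards [eventually_ge_atTop 0] with t ht
    rw [pressure_eq ht, ← EReal.coe_sub]
    rfl
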